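/- **Theorem.** A *game arena* consists of a finite directed graph $(V,E)$ in which every vertex has at least one successor, a partition $(V_0,V_1)$ of $V$ into the vertices of Player 0 and of Player 1, and an initial vertex $v_0$. A *play* is an infinite path $\rho=\rho_0\rho_1\ldots$ with $\rho_0=v_0$. A *strategy* $\sigma_i$ of Player $i$ assigns to every finite path $hv$ from $v_0$ that ends in a vertex $v\in V_i$ a successor $\sigma_i(hv)$ of $v$; a play $\rho$ is *consistent* with $\sigma_i$ if $\rho_{j+1}=\sigma_i(\rho_0\ldots\rho_j)$ whenever $\rho_j\in V_i$. A *reachability Stackelberg-Pareto game* is a game arena together with target sets $T_0,T_1,\dots,T_t\subseteq V$, where $t\ge 1$: Player 0 wants to visit $T_0$, and Player 1 has the $t$ objectives to visit $T_1,\dots,T_t$. The *payoff* of a play $\rho$ is the vector $\mathrm{pay}(\rho)\in\{0,1\}^t$ with $\mathrm{pay}_i(\rho)=1$ iff $\rho$ visits $T_i$; payoffs are ordered componentwise. For a strategy $\sigma_0$ of Player 0, let $P_{\sigma_0}$ be the set of maximal elements of $\{\mathrm{pay}(\rho)\mid \rho \text{ a play consistent with }\sigma_0\}$. The *Stackelberg-Pareto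 Synthesis (SPS) problem* asks, given such a game, whether there is a strategy $\sigma_0$ of Player 0 such that for every strategy $\sigma_1$ of Player 1, if the payoff of the unique play $\rho$ consistent with $\sigma_0$ and $\sigma_1$ lies in $P_{\sigma_0}$, then $\rho$ visits $T_0$. The SPS problem for reachability Stackelberg-Pareto games is fixed-parameter tractable for the parameter $t$, the number of objectives of Player 1: there are a computable function $f:\mathbb N\to\mathbb N$, a constant $c$ and a single (deterministic) Turing machine that, given any such game encoded as a binary word $x$ (with $|V|$ and $t$ in unary, the bit vectors of the owners of the vertices, of the initial vertex and of the target sets, and the adjacency matrix), decides the SPS problem for it in at most $f(t)\cdot|x|^{c}$ steps. -/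

import Mathlib

/-! ### Game arenas, plays, strategies -/

/-- A game arena on the vertex set `V`. The partition `(V₀, V₁)` is given by the function `owner`:
`V_i` is the set of the vertices `v` with `owner v = i`. -/
structure GameArena (V : Type*) where
  owner : V → Fin 2
  E : Finset (V × V)
  exists_succ : ∀ v, ∃ v', (v, v') ∈ E
  init : V

namespace GameArena

variable {V : Type*} (G : GameArena V)

def IsPlay (ρ : ℕ → V) : Prop :=
  ρ 0 = G.init ∧ ∀ j, (ρ j, ρ (j + 1)) ∈ G.E

def Plays : Set (ℕ → V) := {ρ | G.IsPlay ρ}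

/-- Histories: nonempty finite paths that start in the initial vertex. -/
def IsHistory (h : List V) : Prop :=
  h.head? = some G.init ∧ h.IsChain (fun v v' => (v, v') ∈ G.E)

/-- A strategy of Player `i`: it assigns to every history `hv` that ends in a vertex `v` of Player
`i` a successor of `v`. The values of `move` on the other lists play no role. -/
structure Strategy (i : Fin 2) where
  move : List V → V
  legal : ∀ (h : List V) (v : V), G.IsHistory (h ++ [v]) → G.owner v = i →
    (v, move (h ++ [v])) ∈ G.E

/-- The finite prefix `ρ 0, …, ρ j` of an infinite sequence. -/
def pref (ρ : ℕ → V) (j : ℕ) : List V := (List.range (j + 1)).map ρ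

variable {G}

/-- `ρ` follows the strategy `σ` at every vertex of Player `i`. -/
def Strategy.Consistent {i : Fin 2} (σ : G.Strategy i) (ρ : ℕ → V) : Prop :=
  ∀ j, G.owner (ρ j) = i → ρ (j + 1) = σ.move (pref ρ j)

/-- The set of plays consistent with `σ`. -/
def Strategy.plays {i : Fin 2} (σ : G.Strategy i) : Set (ℕ → V) :=
  {ρ | G.IsPlay ρ ∧ σ.Consistent ρ}

/-- `ρ` is the outcome of the strategy profile `(σ₀, σ₁)`: the play consistent with both
strategies (see `existsUnique_isOutcome`). -/
def IsOutcome (σ₀ : G.Strategy 0) (σ₁ : G.Strategy 1) (ρ : ℕ → V) : Prop :=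
  G.IsPlay ρ ∧ σ₀.Consistent ρ ∧ σ₁.Consistent ρ

theorem pref_succ (ρ : ℕ → V) (j : ℕ) : pref ρ (j + 1) = pref ρ j ++ [ρ (j + 1)] := by
  simp [pref, List.range_succ]

theorem existsUnique_isOutcome (σ₀ : G.Strategy 0) (σ₁ : G.Strategy 1) :
    ∃! ρ, IsOutcome σ₀ σ₁ ρ := by
  classical
  let next : List V → V → V := fun h v =>
    if G.owner v = 0 then σ₀.move (h ++ [v]) else σ₁.move (h ++ [v])
  let st : ℕ → List V × V := fun k =>
    Nat.rec ([], G.init) (fun _ s => (s.1 ++ [s.2], next s.1 s.2)) k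
  let ρ : ℕ → V := fun k => (st k).2
  have hpref : ∀ k, pref ρ k = (st k).1 ++ [(st k).2] := by
    intro k
    induction k with
    | zero => rfl
    | succ k ih => rw [pref_succ, ih]
  have hown : ∀ v, G.owner v ≠ 0 → G.owner v = 1 := fun v h => by omega
  have hnext : ∀ k, G.IsHistory (pref ρ k) → (ρ k, ρ (k + 1)) ∈ G.E := by
    intro k hk
    rw [hpref] at hk
    change ((st k).2, next (st k).1 (st k).2) ∈ G.E
    by_cases h : G.owner (st k).2 = 0
    · simpa [next, h] using σ₀.legal _ _ hk h
    · simpa [next, h] using σ₁.legal _ _ hk (hown _ h)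
  have hhist : ∀ k, G.IsHistory (pref ρ k) := by
    intro k
    induction k with
    | zero => exact ⟨rfl, by simp [pref]⟩
    | succ k ih =>
      have hE := hnext k ih
      rw [pref_succ]
      refine ⟨by simp [ih.1], ?_⟩
      rw [List.isChain_append]
      refine ⟨ih.2, by simp, ?_⟩
      intro x hx y hy
      rw [hpref] at hx
      simp at hx hy
      subst hx hy
      exact hE
  refine ⟨ρ, ⟨⟨rfl, fun j => hnext j (hhist j)⟩, ?_, ?_⟩, ?_⟩
  · intro j hj
    rw [hpref]
    change next (st j).1 (st j).2 = _
    simp only [next]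
    rw [if_pos hj]
  · intro j hj
    rw [hpref]
    change next (st j).1 (st j).2 = _
    have : G.owner (st j).2 ≠ 0 := by
      have : G.owner (st j).2 = 1 := hj
      simp [this]
    simp only [next]
    rw [if_neg this]
  · rintro τ ⟨hτ, h0, h1⟩
    have key : ∀ k, pref τ k = pref ρ k ∧ τ k = ρ k := by
      intro k
      induction k with
      | zero =>
        have : τ 0 = ρ 0 := hτ.1
        exact ⟨by simp [pref, this], this⟩
      | succ k ih =>
        have hs : τ (k + 1) = ρ (k + 1) := by
          change _ = next (st k).1 (st k).2
          have e : τ k = (st k).2 := ih.2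
          by_cases h : G.owner (st k).2 = 0
          · rw [h0 k (by rw [e]; exact h), ih.1, hpref]
            simp [next, h]
          · rw [h1 k (by rw [e]; exact hown _ h), ih.1, hpref]
            simp [next, h]
        exact ⟨by rw [pref_succ, pref_succ, ih.1, hs], hs⟩
    funext k
    exact (key k).2

/-- The reachability objective of a target set. -/
def reach (G : GameArena V) (T : Finset V) : Set (ℕ → V) :=
  {ρ | G.IsPlay ρ ∧ ∃ j, ρ j ∈ T}

end GameArena

/-! ### Stackelberg-Pareto games and the synthesis problem -/

/-- A Stackelberg-Pareto game in which Player 1 has the objectives `obj 0, …, obj (t - 1)`. -/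
structure SPGame (V : Type*) (t : ℕ) where
  arena : GameArena V
  obj₀ : Set (ℕ → V)
  obj : Fin t → Set (ℕ → V)
  obj₀_subset : obj₀ ⊆ arena.Plays
  obj_subset : ∀ i, obj i ⊆ arena.Plays

namespace SPGame

variable {V : Type*} {t : ℕ} (𝒢 : SPGame V t)

open Classical in
/-- The payoff of a play. Payoffs are ordered componentwise, with `false < true`. -/
noncomputable def payoff (ρ : ℕ → V) : Fin t → Bool := fun i => decide (ρ ∈ 𝒢.obj i)

/-- The set of Pareto-optimal payoffs for the strategy `σ₀`. -/
def paretoSet (σ₀ : 𝒢.arena.Strategy 0) : Set (Fin t → Bool) :=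
  {p | Maximal (fun q => ∃ ρ ∈ σ₀.plays, 𝒢.payoff ρ = q) p}

/-- `σ₀` is a solution to the Stackelberg-Pareto synthesis problem. -/
def IsSolution (σ₀ : 𝒢.arena.Strategy 0) : Prop :=
  ∀ (σ₁ : 𝒢.arena.Strategy 1) (ρ : ℕ → V), GameArena.IsOutcome σ₀ σ₁ ρ →
    𝒢.payoff ρ ∈ 𝒢.paretoSet σ₀ → ρ ∈ 𝒢.obj₀

/-- The Stackelberg-Pareto synthesis problem asks whether there is a solution. -/
def HasSolution : Prop := ∃ σ₀ : 𝒢.arena.Strategy 0, 𝒢.IsSolution σ₀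

end SPGame

/-- A reachability Stackelberg-Pareto game, given by its arena and the target sets. -/
structure ReachSPGame (V : Type*) (t : ℕ) where
  arena : GameArena V
  target₀ : Finset V
  target : Fin t → Finset V

/-- The Stackelberg-Pareto game with the reachability objectives of the target sets. -/
def ReachSPGame.toSPGame {V : Type*} {t : ℕ} (g : ReachSPGame V t) : SPGame V t where
  arena := g.arena
  obj₀ := g.arena.reach g.target₀
  obj i := g.arena.reach (g.target i)
  obj₀_subset _ h := h.1
  obj_subset _ _ h := h.1

/-! ### Instances of the decision problem and their encoding as binary words -/

/-- An instance: a reachability Stackelberg-Pareto game with vertices `0, …, n - 1`, in which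
Player 1 has `t ≥ 1` objectives. -/
structure ReachSPInstance where
  n : ℕ
  t : ℕ
  one_le_t : 1 ≤ t
  game : ReachSPGame (Fin n) t

namespace ReachSPInstance

/-- The characteristic vector of a set of vertices. -/
def bits {n : ℕ} (S : Finset (Fin n)) : List Bool := List.ofFn fun v => decide (v ∈ S)

/-- The binary encoding of an instance: `n` and `t` in unary, each ended by a `0`, followed by the
bits that tell, in this order, for every vertex its owner, for every vertex whether it is the
initial one, the target set of Player 0, the target sets of Player 1 and the rows of the adjacency
matrix. -/
def encode (I : ReachSPInstance) : List Bool :=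
  List.replicate I.n true ++ [false] ++ List.replicate I.t true ++ [false] ++
    (List.ofFn fun v => decide (I.game.arena.owner v = 1)) ++
    bits {I.game.arena.init} ++
    bits I.game.target₀ ++
    (List.ofFn fun i => bits (I.game.target i)).flatten ++
    (List.ofFn fun v => List.ofFn fun v' => decide ((v, v') ∈ I.game.arena.E)).flatten

theorem encode_injective : Function.Injective encode := by
  have rep : ∀ (a b : ℕ) (l l' : List Bool),
      List.replicate a true ++ false :: l = List.replicate b true ++ false :: l' →
      a = b ∧ l = l' := by
    intro a
    induction a with
    | zero => intro b l l' h; cases b <;> simp_all [List.replicate_succ]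
    | succ a ih => intro b l l' h; cases b with
      | zero => simp_all [List.replicate_succ]
      | succ b => simp [List.replicate_succ] at h; have := ih _ _ _ h; simp_all
  rintro ⟨n,t,h,⟨o,E,hE,i⟩,T0,T⟩ ⟨n',t',h',⟨o',E',hE',i'⟩,T0',T'⟩ e
  simp only [encode, List.append_assoc, List.singleton_append] at e
  obtain ⟨rfl, e⟩ := rep _ _ _ _ e
  obtain ⟨rfl, e⟩ := rep _ _ _ _ e
  obtain ⟨e1, e⟩ := List.append_inj e (by simp)
  obtain ⟨e2, e⟩ := List.append_inj e (by simp [bits])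
  obtain ⟨e3, e⟩ := List.append_inj e (by simp [bits])
  obtain ⟨e4, e5⟩ := List.append_inj e (by simp [bits, Function.comp_def, List.map_ofFn])
  have fl : ∀ {m k : ℕ} (F F' : Fin m → Fin k → Bool),
      (List.ofFn fun x => List.ofFn (F x)).flatten =
        (List.ofFn fun x => List.ofFn (F' x)).flatten →
      F = F' := by
    intro m k F F' hh
    have := (List.eq_iff_flatten_eq (L := List.ofFn fun x => List.ofFn (F x))
      (L' := List.ofFn fun x => List.ofFn (F' x))).2
      ⟨hh, by simp [List.map_ofFn, Function.comp_def]⟩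
    have := List.ofFn_injective this
    funext x
    exact List.ofFn_injective (congrFun this x)
  have e4 := fl _ _ e4
  have e5 := fl _ _ e5
  have b : ∀ {S S' : Finset (Fin n)}, bits S = bits S' → S = S' := by
    intro S S' hh; ext v; have := congrFun (List.ofFn_injective hh) v; simpa using this
  have e1 : o = o' := by
    funext v; have := congrFun (List.ofFn_injective e1) v; simp at this; omega
  have e2 := b e2
  have e3 := b e3
  simp at e2 e3
  have : T = T' := by
    funext x; ext v; have := congrFun (congrFun e4 x) v; simpa using this
  have : E = E' := by
    ext ⟨x, v⟩; have := congrFun (congrFun e5 x) v; simpa using this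
  subst_vars; rfl

/-- The instances with a positive answer. -/
def SPS : Set ReachSPInstance := {I | I.game.toSPGame.HasSolution}

end ReachSPInstance

/-! ### Fixed-parameter tractability -/

/-- The decision problem `L`, for inputs `a : α` that are given as the words `enc a` and with the
parameter `κ a`, is fixed-parameter tractable: for some computable function `f` and some constant
`c`, a Turing machine (in the multi-stack form of Mathlib) decides whether `a ∈ L` in at most
`f (κ a) * |enc a| ^ c` steps. The machine, `f` and `c` do not depend on `a` or on `κ a`. -/
def InFPT {α Γ : Type} [Fintype Γ] (enc : α → List Γ) (κ : α → ℕ) (L : Set α) : Prop :=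
  ∃ (M : Turing.TM2ComputableAux Γ Bool) (f : ℕ → ℕ) (c : ℕ), Computable f ∧
    ∀ a : α, ∃ b : Bool, (b = true ↔ a ∈ L) ∧
      Nonempty (Turing.TM2OutputsInTime M.tm
        ((enc a).map M.inputAlphabet.symm)
        (some ((Computability.encodeBool b).map M.outputAlphabet.symm))
        (f (κ a) * (enc a).length ^ c))

/-!
For Player 0 it is enough to know which vertex is reached and which targets have been visited, and
for a guessed set `W` of maximal payoffs the strategies that work are described by three inductively
defined relations: Player 0 can force a visit to `T₀` (`Attr`); Player 1 can avoid `T₀` and get a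
payoff that is not strictly below one in `W` (`Lose`); Player 0 can let Player 1 realize all payoffs
in `S`, each on its own play, and keep all other plays out of `Lose` (`Good`). The set `W` is
guessed as a number below `2 ^ 2 ^ (t + 1)`, so all these relations live on a universe of size
`N = |x| * 2 ^ 2 ^ (t + 1)`, where arithmetic, the decoding of the input and the three relations are
least fixed points of first-order formulas. As in the theorem of Immerman and Vardi, a fixed
sequence of such definitions is evaluated in time polynomial in `N`, that is `f(t) * |x| ^ c`.
-/

open Function StateTransition

/-! ### Structured programs on stacks of bits and their compilation -/

/-- Stores of a program: every register of `K` holds a stack of bits. -/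
abbrev StackStore (K : Type) := K → List Bool

/-- Structured programs whose registers are stacks of bits, an intermediate language between the
decision procedure and Turing machines with several stacks. The condition `p` of a conditional or
of a loop is applied to the top of the stack `k`, and to `none` if that stack is empty. -/
inductive StackProg (K : Type) where
  | skip : StackProg K
  | push (k : K) (b : Bool) : StackProg K
  | pop (k : K) : StackProg K
  | mv (k k' : K) : StackProg K
  | seq (a b : StackProg K) : StackProg K
  | ite (p : Option Bool → Bool) (k : K) (a b : StackProg K) : StackProg K
  | loop (p : Option Bool → Bool) (k : K) (a : StackProg K) : StackProg K

namespace StackProg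

variable {K : Type}

/-- The labels of the compiled program. -/
def Lab : StackProg K → Type
  | skip => Unit
  | push _ _ => Unit
  | pop _ => Unit
  | mv _ _ => Unit
  | seq a b => a.Lab ⊕ b.Lab
  | ite _ _ a b => Option (a.Lab ⊕ b.Lab)
  | loop _ _ a => Option a.Lab

/-- The finiteness of the set of labels. -/
@[reducible]
def labFintype : (c : StackProg K) → Fintype c.Lab
  | skip => inferInstanceAs (Fintype Unit)
  | push _ _ => inferInstanceAs (Fintype Unit)
  | pop _ => inferInstanceAs (Fintype Unit)
  | mv _ _ => inferInstanceAs (Fintype Unit)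
  | seq a b =>
    letI := a.labFintype
    letI := b.labFintype
    inferInstanceAs (Fintype (a.Lab ⊕ b.Lab))
  | ite _ _ a b =>
    letI := a.labFintype
    letI := b.labFintype
    inferInstanceAs (Fintype (Option (a.Lab ⊕ b.Lab)))
  | loop _ _ a =>
    letI := a.labFintype
    inferInstanceAs (Fintype (Option a.Lab))

/-- The label at which the compiled program starts. -/
def entry : (c : StackProg K) → c.Lab
  | skip => ()
  | push _ _ => ()
  | pop _ => ()
  | mv _ _ => ()
  | seq a _ => Sum.inl a.entry
  | ite _ _ _ _ => none
  | loop _ _ _ => none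

variable [DecidableEq K]

/-- Big-step semantics with a step counter: `Exec c S S' T` says that the program `c` takes the
store `S` to the store `S'` in at most `T` steps. -/
inductive Exec : StackProg K → StackStore K → StackStore K → ℕ → Prop where
  | skip (S) : Exec .skip S S 1
  | push (k b S) : Exec (.push k b) S (update S k (b :: S k)) 1
  | pop (k S) : Exec (.pop k) S (update S k (S k).tail) 1
  | mv {k k' S b l} : S k = b :: l →
      Exec (.mv k k') S (update (update S k l) k' (b :: update S k l k')) 1
  | mvNil {k k' S} : S k = [] → Exec (.mv k k') S S 1
  | seq {a b S S' S'' T T'} : Exec a S S' T → Exec b S' S'' T' → Exec (.seq a b) S S'' (T + T')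
  | iteTrue {p k a b S S' T} : p (S k).head? = true → Exec a S S' T →
      Exec (.ite p k a b) S S' (T + 1)
  | iteFalse {p k a b S S' T} : p (S k).head? = false → Exec b S S' T →
      Exec (.ite p k a b) S S' (T + 1)
  | loopFalse {p k a S} : p (S k).head? = false → Exec (.loop p k a) S S 1
  | loopTrue {p k a S S' S'' T T'} : p (S k).head? = true → Exec a S S' T →
      Exec (.loop p k a) S' S'' T' → Exec (.loop p k a) S S'' (T + T' + 1)
  | weaken {c S S' T T₁} : Exec c S S' T → T ≤ T₁ → Exec c S S' T₁

/-- The registers that occur in a program. -/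
def regs : StackProg K → Finset K
  | skip => ∅
  | push k _ => {k}
  | pop k => {k}
  | mv k k' => {k, k'}
  | seq a b => a.regs ∪ b.regs
  | ite _ k a b => insert k (a.regs ∪ b.regs)
  | loop _ k a => insert k a.regs

/-- Statements of a machine whose stacks are the registers in `R`, with one cell of internal memory
for the symbol read last. -/
abbrev MachineStmt (R : Finset K) (L : Type) := Turing.TM2.Stmt (fun _ : R => Bool) L (Option Bool)

open Turing.TM2.Stmt in
/-- The code of a program as a part of a larger machine: its labels are embedded by `emb`, and it is
left through the label `dest`. -/
def code {R : Finset K} {L : Type} :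
    (c : StackProg K) → c.regs ⊆ R → (c.Lab → L) → L → c.Lab → MachineStmt R L
  | skip, _, _, dest => fun _ => goto fun _ => dest
  | push k b, h, _, dest => fun _ =>
    Turing.TM2.Stmt.push ⟨k, h (by simp [regs])⟩ (fun _ => b) (goto fun _ => dest)
  | pop k, h, _, dest => fun _ =>
    Turing.TM2.Stmt.pop ⟨k, h (by simp [regs])⟩ (fun _ o => o) (goto fun _ => dest)
  | mv k k', h, _, dest => fun _ =>
    Turing.TM2.Stmt.pop ⟨k, h (by simp [regs])⟩ (fun _ o => o)
      (branch Option.isSome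
        (Turing.TM2.Stmt.push ⟨k', h (by simp [regs])⟩ (fun o => o.getD false) (goto fun _ => dest))
        (goto fun _ => dest))
  | seq a b, h, emb, dest => fun l => match l with
    | Sum.inl l => a.code (Finset.union_subset_left h)
        (fun x => emb (Sum.inl x)) (emb (Sum.inr b.entry)) l
    | Sum.inr l => b.code (Finset.union_subset_right h) (fun x => emb (Sum.inr x)) dest l
  | ite p k a b, h, emb, dest => fun l => match l with
    | none => peek ⟨k, h (by simp [regs])⟩ (fun _ o => o) (branch p
        (goto fun _ => emb (some (Sum.inl a.entry))) (goto fun _ => emb (some (Sum.inr b.entry))))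
    | some (Sum.inl l) =>
      a.code (Finset.union_subset_left (Finset.insert_subset_iff.1 h).2)
        (fun x => emb (some (Sum.inl x))) dest l
    | some (Sum.inr l) =>
      b.code (Finset.union_subset_right (Finset.insert_subset_iff.1 h).2)
        (fun x => emb (some (Sum.inr x))) dest l
  | loop p k a, h, emb, dest => fun l => match l with
    | none => peek ⟨k, h (by simp [regs])⟩ (fun _ o => o) (branch p
        (goto fun _ => emb (some a.entry)) (goto fun _ => dest))
    | some l => a.code (Finset.insert_subset_iff.1 h).2 (fun x => emb (some x)) (emb none) l

section Simulation

theorem evalsToInTime_one {σ : Type*} (f : σ → Option σ) {a b : σ} (h : f a = some b) :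
    Nonempty (EvalsToInTime f a (some b) 1) :=
  ⟨⟨⟨1, by simpa [flip] using h⟩, le_rfl⟩⟩

theorem evalsToInTime_trans {σ : Type*} {f : σ → Option σ} {a b : σ} {c : Option σ} {m m' : ℕ}
    (h : Nonempty (EvalsToInTime f a (some b) m)) (h' : Nonempty (EvalsToInTime f b c m')) :
    Nonempty (EvalsToInTime f a c (m + m')) := by
  obtain ⟨h⟩ := h
  obtain ⟨h'⟩ := h'
  exact ⟨add_comm m' m ▸ EvalsToInTime.trans f m m' a b c h h'⟩

theorem evalsToInTime_mono {σ : Type*} {f : σ → Option σ} {a : σ} {c : Option σ} {m m' : ℕ}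
    (h : Nonempty (EvalsToInTime f a c m)) (hm : m ≤ m') :
    Nonempty (EvalsToInTime f a c m') := by
  obtain ⟨h⟩ := h
  exact ⟨⟨h.toEvalsTo, h.steps_le_m.trans hm⟩⟩

theorem restrict_update {R : Finset K} {k : K} (hk : k ∈ R) (S : StackStore K) (l : List Bool) :
    R.restrict (update S k l) = update (R.restrict S) ⟨k, hk⟩ l := by
  funext i
  simp only [Finset.restrict, update_apply, Subtype.ext_iff]

/-- Every machine that contains the code of `c` gets in at most `T` steps from the start of the code
with store `S` to its exit with store `S'`. -/
def Simulates (c : StackProg K) (S S' : StackStore K) (T : ℕ) : Prop :=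
  ∀ {R : Finset K} (hR : c.regs ⊆ R) {L : Type} (M : L → MachineStmt R L) (emb : c.Lab → L)
    (dest : L), (∀ l, M (emb l) = c.code hR emb dest l) → ∀ r, ∃ r',
      Nonempty (EvalsToInTime (Turing.TM2.step M) ⟨some (emb c.entry), r, R.restrict S⟩
        (some ⟨some dest, r', R.restrict S'⟩) T)

variable {k k' : K} {a b c : StackProg K} {S S' S'' : StackStore K} {T T' : ℕ}
  {p : Option Bool → Bool}

theorem simulates_skip : Simulates .skip S S 1 := fun _ _ _ _ _ hM r =>
  ⟨r, evalsToInTime_one _ (by simp [hM, code])⟩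

theorem simulates_push (x : Bool) : Simulates (.push k x) S (update S k (x :: S k)) 1 :=
  fun hR _ _ _ _ hM r => ⟨r, evalsToInTime_one _ (by
    have hk := hR (Finset.mem_singleton_self k)
    simp only [Turing.TM2.step, hM, code, Turing.TM2.stepAux, restrict_update hk,
      Finset.restrict])⟩

theorem simulates_pop : Simulates (.pop k) S (update S k (S k).tail) 1 :=
  fun hR _ _ _ _ hM _ => ⟨(S k).head?, evalsToInTime_one _ (by
    have hk := hR (Finset.mem_singleton_self k)
    simp only [Turing.TM2.step, hM, code, Turing.TM2.stepAux, restrict_update hk,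
      Finset.restrict])⟩

theorem simulates_mv {x : Bool} {l : List Bool} (hS : S k = x :: l) :
    Simulates (.mv k k') S (update (update S k l) k' (x :: update S k l k')) 1 := by
  intro R hR L M emb dest hM r
  have hk : k ∈ R := hR (by simp [regs])
  have hk' : k' ∈ R := hR (by simp [regs])
  refine ⟨some x, evalsToInTime_one _ ?_⟩
  simp only [Turing.TM2.step, hM, code, Turing.TM2.stepAux, Finset.restrict, hS,
    List.head?_cons, List.tail_cons, Option.getD_some, Option.isSome_some, cond_true,
    ← restrict_update hk, ← restrict_update hk']

theorem simulates_mv_nil (hS : S k = []) : Simulates (.mv k k') S S 1 := by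
  intro R hR L M emb dest hM r
  have hk : k ∈ R := hR (by simp [regs])
  refine ⟨none, evalsToInTime_one _ ?_⟩
  have hu : update (R.restrict S) ⟨k, hk⟩ [] = R.restrict S := by
    rw [← restrict_update hk, ← hS, update_eq_self]
  simp only [Turing.TM2.step, hM, code, Turing.TM2.stepAux, Finset.restrict, hS,
    List.head?_nil, List.tail_nil, Option.isSome_none, cond_false, hu]

theorem Simulates.seq (ha : Simulates a S S' T) (hb : Simulates b S' S'' T') :
    Simulates (.seq a b) S S'' (T + T') := by
  intro R hR L M emb dest hM r
  obtain ⟨r₁, h₁⟩ := ha (Finset.union_subset_left hR) M (fun x => emb (Sum.inl x))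
    (emb (Sum.inr b.entry)) (fun l => hM (Sum.inl l)) r
  obtain ⟨r₂, h₂⟩ := hb (Finset.union_subset_right hR) M (fun x => emb (Sum.inr x)) dest
    (fun l => hM (Sum.inr l)) r₁
  exact ⟨r₂, evalsToInTime_trans h₁ h₂⟩

theorem Simulates.iteTrue (hp : p (S k).head? = true) (ha : Simulates a S S' T) :
    Simulates (.ite p k a b) S S' (T + 1) := by
  intro R hR L M emb dest hM r
  obtain ⟨r₁, h₁⟩ := ha (Finset.union_subset_left (Finset.insert_subset_iff.1 hR).2) M
    (fun x => emb (some (Sum.inl x))) dest (fun l => hM (some (Sum.inl l))) (S k).head?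
  refine ⟨r₁, add_comm 1 T ▸ evalsToInTime_trans (evalsToInTime_one _ ?_) h₁⟩
  rw [Turing.TM2.step, hM]
  simp only [code, entry, Turing.TM2.stepAux, Finset.restrict, hp, cond_true]

theorem Simulates.iteFalse (hp : p (S k).head? = false) (hb : Simulates b S S' T) :
    Simulates (.ite p k a b) S S' (T + 1) := by
  intro R hR L M emb dest hM r
  obtain ⟨r₁, h₁⟩ := hb (Finset.union_subset_right (Finset.insert_subset_iff.1 hR).2) M
    (fun x => emb (some (Sum.inr x))) dest (fun l => hM (some (Sum.inr l))) (S k).head?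
  refine ⟨r₁, add_comm 1 T ▸ evalsToInTime_trans (evalsToInTime_one _ ?_) h₁⟩
  rw [Turing.TM2.step, hM]
  simp only [code, entry, Turing.TM2.stepAux, Finset.restrict, hp, cond_false]

theorem simulates_loop_false (hp : p (S k).head? = false) : Simulates (.loop p k a) S S 1 := by
  intro R hR L M emb dest hM r
  refine ⟨(S k).head?, evalsToInTime_one _ ?_⟩
  rw [Turing.TM2.step, hM]
  simp only [code, entry, Turing.TM2.stepAux, Finset.restrict, hp, cond_false]

theorem Simulates.loopTrue (hp : p (S k).head? = true) (ha : Simulates a S S' T)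
    (hl : Simulates (.loop p k a) S' S'' T') : Simulates (.loop p k a) S S'' (T + T' + 1) := by
  intro R hR L M emb dest hM r
  obtain ⟨r₁, h₁⟩ := ha (Finset.insert_subset_iff.1 hR).2 M (fun x => emb (some x)) (emb none)
    (fun l => hM (some l)) (S k).head?
  obtain ⟨r₂, h₂⟩ := hl hR M emb dest hM r₁
  refine ⟨r₂, evalsToInTime_mono (evalsToInTime_trans
    (evalsToInTime_trans (evalsToInTime_one _ ?_) h₁) h₂) (by omega)⟩
  rw [Turing.TM2.step, hM]
  simp only [code, entry, Turing.TM2.stepAux, Finset.restrict, hp, cond_true]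

theorem Simulates.weaken (h : Simulates c S S' T) (hT : T ≤ T') : Simulates c S S' T' := by
  intro R hR L M emb dest hM r
  obtain ⟨r₁, h₁⟩ := h hR M emb dest hM r
  exact ⟨r₁, evalsToInTime_mono h₁ hT⟩

theorem Exec.simulates (h : Exec c S S' T) : Simulates c S S' T := by
  induction h with
  | skip => exact simulates_skip
  | push => exact simulates_push _
  | pop => exact simulates_pop
  | mv h => exact simulates_mv h
  | mvNil h => exact simulates_mv_nil h
  | seq _ _ iha ihb => exact iha.seq ihb
  | iteTrue hp _ ih => exact ih.iteTrue hp
  | iteFalse hp _ ih => exact ih.iteFalse hp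
  | loopFalse hp => exact simulates_loop_false hp
  | loopTrue hp _ _ iha ihb => exact iha.loopTrue hp ihb
  | weaken _ hT ih => exact ih.weaken hT

end Simulation

/-- The machine that runs the program `c`, with the register `io` for the input and the output. -/
def machine (c : StackProg K) (io : K) : Turing.FinTM2 :=
  letI := c.labFintype
  { K := (insert io c.regs : Finset K)
    k₀ := ⟨io, Finset.mem_insert_self _ _⟩
    k₁ := ⟨io, Finset.mem_insert_self _ _⟩
    Γ := fun _ => Bool
    Λ := Option c.Lab
    main := some c.entry
    σ := Option Bool
    initialState := none
    Γk₀Fin := inferInstanceAs (Fintype Bool)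
    m := fun l => match l with
      | none => Turing.TM2.Stmt.load (fun _ => none) Turing.TM2.Stmt.halt
      | some l => c.code (Finset.subset_insert _ _) some none l }

/-- The machine of a program, with bits as its input and output symbols. -/
def machineAux (c : StackProg K) (io : K) : Turing.TM2ComputableAux Bool Bool where
  tm := c.machine io
  inputAlphabet := Equiv.refl Bool
  outputAlphabet := Equiv.refl Bool

/-- The store in which the register `io` holds the word `x` and all other registers are empty. -/
def ioStore (io : K) (x : List Bool) : StackStore K := update (fun _ => []) io x

theorem dite_eq_restrict_ioStore {R : Finset K} {io : K} (hio : io ∈ R) (k : R) (x : List Bool) :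
    (if _ : k = ⟨io, hio⟩ then x.map (Equiv.refl Bool).symm else []) =
      R.restrict (ioStore io x) k := by
  simp [ioStore, Finset.restrict, update_apply, Subtype.ext_iff]

theorem Exec.outputs {c : StackProg K} {io : K} {x y : List Bool} {T : ℕ}
    (h : Exec c (ioStore io x) (ioStore io y) T) :
    Nonempty (Turing.TM2OutputsInTime (c.machineAux io).tm
      (x.map (c.machineAux io).inputAlphabet.symm)
      (some (y.map (c.machineAux io).outputAlphabet.symm)) (T + 1)) := by
  obtain ⟨r, h₁⟩ := h.simulates (Finset.subset_insert io c.regs) (c.machine io).m some none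
    (fun _ => rfl) none
  have h₂ := evalsToInTime_trans h₁ (evalsToInTime_one (Turing.TM2.step (c.machine io).m)
    (b := ⟨none, none, (insert io c.regs).restrict (ioStore io y)⟩) rfl)
  have e₁ : Turing.initList (c.machineAux io).tm (x.map (c.machineAux io).inputAlphabet.symm) =
      ⟨some (some c.entry), none, (insert io c.regs).restrict (ioStore io x)⟩ := by
    unfold Turing.initList
    congr 1
    exact funext fun k => dite_eq_restrict_ioStore _ k x
  have e₂ : Turing.haltList (c.machineAux io).tm (y.map (c.machineAux io).outputAlphabet.symm) =
      ⟨none, none, (insert io c.regs).restrict (ioStore io y)⟩ := by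
    unfold Turing.haltList
    congr 1
    exact funext fun k => dite_eq_restrict_ioStore _ k y
  unfold Turing.TM2OutputsInTime
  rw [e₁, Option.map_some, e₂]
  exact h₂

end StackProg

namespace StackProg

section Basic

variable {K : Type} [DecidableEq K]

theorem Exec.of_eq {c : StackProg K} {S S₁ S' : StackStore K} {T T' : ℕ} (h : Exec c S S₁ T)
    (hS : S₁ = S') (hT : T ≤ T') : Exec c S S' T' :=
  hS ▸ h.weaken hT

theorem Exec.loop_family {p : Option Bool → Bool} {k : K} {c : StackProg K} {m T : ℕ}
    (F : ℕ → StackStore K)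
    (h : ∀ j < m, p (F (j + 1) k).head? = true ∧ Exec c (F (j + 1)) (F j) T)
    (h₀ : p (F 0 k).head? = false) : Exec (.loop p k c) (F m) (F 0) (m * (T + 1) + 1) := by
  induction m with
  | zero => simpa using Exec.loopFalse h₀
  | succ m ih =>
    obtain ⟨hp, hc⟩ := h m (Nat.lt_succ_self m)
    exact (Exec.loopTrue hp hc (ih fun j hj => h j (by omega))).weaken (by ring_nf; omega)

/-- Empty a stack. -/
def clear (k : K) : StackProg K := .loop Option.isSome k (.pop k)

theorem exec_clear (k : K) (S : StackStore K) :
    Exec (clear k) S (update S k []) (2 * (S k).length + 1) := by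
  generalize hl : S k = l
  induction l generalizing S with
  | nil => exact (Exec.loopFalse (by simp [hl])).of_eq (by rw [← hl, update_eq_self]) (by simp)
  | cons b l ih =>
    exact (Exec.loopTrue (by simp [hl]) (Exec.pop k S)
      (ih (update S k (S k).tail) (by simp [hl]))).of_eq (by simp)
      (by simp only [List.length_cons]; omega)

/-- Move the stack `a` onto the stack `b`, which reverses it. -/
def transfer (a b : K) : StackProg K := .loop Option.isSome a (.mv a b)

theorem exec_transfer {a b : K} (hab : a ≠ b) (S : StackStore K) :
    Exec (transfer a b) S (update (update S a []) b ((S a).reverse ++ S b))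
      (2 * (S a).length + 1) := by
  generalize hl : S a = l
  induction l generalizing S with
  | nil => exact (Exec.loopFalse (by simp [hl])).of_eq (by funext i; grind [update_apply]) (by simp)
  | cons x l ih =>
    refine (Exec.loopTrue (by simp [hl]) (Exec.mv hl)
      (ih _ (by simp [hab]))).of_eq ?_ (by simp only [List.length_cons]; omega)
    funext i
    grind [update_apply]

/-- The unary representation of a natural number. -/
abbrev unary (n : ℕ) : List Bool := List.replicate n true

/-- Add the length of the stack `x` to the unary number `a`, with `tmp` as a buffer. -/
def copyTo (x tmp a : K) : StackProg K :=
  .seq (.loop Option.isSome x (.seq (.mv x tmp) (.push a true))) (transfer tmp x)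

theorem exec_copyTo_loop {x tmp a : K} (hxt : x ≠ tmp) (hxa : x ≠ a) (hta : tmp ≠ a)
    (S : StackStore K) :
    Exec (.loop Option.isSome x (.seq (.mv x tmp) (.push a true))) S
      (update (update (update S x []) tmp ((S x).reverse ++ S tmp)) a
        (unary (S x).length ++ S a)) (3 * (S x).length + 1) := by
  generalize hl : S x = l
  induction l generalizing S with
  | nil => exact (Exec.loopFalse (by simp [hl])).of_eq (by funext i; grind [update_apply]) (by simp)
  | cons b l ih =>
    refine (Exec.loopTrue (by simp [hl]) ((Exec.mv hl).seq (Exec.push a true _))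
      (ih _ (by simp [hxt, hxa]))).of_eq ?_ (by simp only [List.length_cons]; omega)
    have : unary (l.length + 1) = unary l.length ++ [true] := List.replicate_succ'
    funext i
    grind [update_apply]

theorem exec_copyTo {x tmp a : K} (hxt : x ≠ tmp) (hxa : x ≠ a) (hta : tmp ≠ a)
    (S : StackStore K) (ht : S tmp = []) :
    Exec (copyTo x tmp a) S (update S a (unary (S x).length ++ S a)) (5 * (S x).length + 2) := by
  refine ((exec_copyTo_loop hxt hxa hta S).seq (exec_transfer hxt.symm _)).of_eq ?_ ?_
  · funext i
    grind [update_apply]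
  · simp [hta, ht]
    omega

/-- Run `c` once for every symbol of the stack `k`, which is popped before each run. -/
def forEach (k : K) (c : StackProg K) : StackProg K := .loop Option.isSome k (.seq (.pop k) c)

/-- In families of runs indexed by a size `N ≥ 2`, the program `c` takes a store `S` to every store
`S'` with `P N S S'`, in time polynomial in `N`. -/
def PolyExec (c : StackProg K) (P : ℕ → StackStore K → StackStore K → Prop) : Prop :=
  ∃ e, ∀ N, 2 ≤ N → ∀ S S', P N S S' → Exec c S S' (N ^ e)

namespace PolyExec

variable {a b c : StackProg K} {P Q : ℕ → StackStore K → StackStore K → Prop}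

theorem of_exec (C d : ℕ)
    (h : ∀ N, 2 ≤ N → ∀ S S', P N S S' → Exec c S S' (C * N ^ d)) : PolyExec c P := by
  refine ⟨C + d, fun N hN S S' hP => (h N hN S S' hP).weaken ?_⟩
  rw [pow_add]
  exact Nat.mul_le_mul_right _ (Nat.lt_pow_self hN).le

theorem mono (h : PolyExec c Q) (hPQ : ∀ N, 2 ≤ N → ∀ S S', P N S S' → Q N S S') :
    PolyExec c P :=
  let ⟨e, he⟩ := h
  ⟨e, fun N hN S S' hP => he N hN S S' (hPQ N hN S S' hP)⟩

theorem skip : PolyExec (.skip : StackProg K) fun _ S S' => S' = S :=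
  of_exec 1 0 fun _ _ S _ h => h ▸ (Exec.skip S)

theorem push (k : K) (x : Bool) : PolyExec (.push k x) fun _ S S' => S' = update S k (x :: S k) :=
  of_exec 1 0 fun _ _ S _ h => h ▸ (Exec.push k x S)

theorem pop (k : K) : PolyExec (.pop k) fun _ S S' => S' = update S k (S k).tail :=
  of_exec 1 0 fun _ _ S _ h => h ▸ (Exec.pop k S)

theorem mv {k k' : K} (hk : k ≠ k') :
    PolyExec (.mv k k') fun _ S S' =>
      S' = update (update S k (S k).tail) k' ((S k).head?.toList ++ S k') := by
  refine of_exec 1 0 fun _ _ S S' h => ?_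
  subst h
  rcases hS : S k with _ | ⟨x, l⟩
  · exact (Exec.mvNil hS).of_eq (by funext i; grind [update_apply]) le_rfl
  · exact (Exec.mv hS).of_eq (by funext i; grind [update_apply]) le_rfl

theorem seq (ha : PolyExec a P) (hb : PolyExec b Q) :
    PolyExec (.seq a b) fun N S S'' => ∃ S', P N S S' ∧ Q N S' S'' := by
  obtain ⟨d, hd⟩ := ha
  obtain ⟨e, he⟩ := hb
  refine of_exec 2 (max d e) fun N hN S S'' ⟨S', hP, hQ⟩ => ?_
  have h₁ : N ^ d ≤ N ^ max d e := Nat.pow_le_pow_right (by omega) (le_max_left _ _)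
  have h₂ : N ^ e ≤ N ^ max d e := Nat.pow_le_pow_right (by omega) (le_max_right _ _)
  exact ((hd N hN S S' hP).seq (he N hN S' S'' hQ)).weaken (by omega)

theorem ite {p : Option Bool → Bool} {k : K} (ha : PolyExec a P) (hb : PolyExec b Q) :
    PolyExec (.ite p k a b) fun N S S' => if p (S k).head? then P N S S' else Q N S S' := by
  obtain ⟨d, hd⟩ := ha
  obtain ⟨e, he⟩ := hb
  refine of_exec 2 (max d e) fun N hN S S' h => ?_
  have h₀ : 0 < N ^ max d e := Nat.pow_pos (by omega)
  have h₁ : N ^ d ≤ N ^ max d e := Nat.pow_le_pow_right (by omega) (le_max_left _ _)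
  have h₂ : N ^ e ≤ N ^ max d e := Nat.pow_le_pow_right (by omega) (le_max_right _ _)
  split_ifs at h with hp
  · exact (Exec.iteTrue hp (hd N hN S S' h)).weaken (by omega)
  · exact (Exec.iteFalse (Bool.eq_false_iff.2 hp) (he N hN S S' h)).weaken (by omega)

theorem loop {p : Option Bool → Bool} {k : K} (d : ℕ) (h : PolyExec c P) :
    PolyExec (.loop p k c) fun N S S' => ∃ m ≤ N ^ d, ∃ F : ℕ → StackStore K, F m = S ∧ F 0 = S' ∧
      p (F 0 k).head? = false ∧ ∀ j < m, p (F (j + 1) k).head? = true ∧ P N (F (j + 1)) (F j) := by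
  obtain ⟨e, he⟩ := h
  refine of_exec 3 (d + e) fun N hN S S' ⟨m, hm, F, hS, hS', h₀, hF⟩ => ?_
  subst hS hS'
  refine (Exec.loop_family F (fun j hj => ⟨(hF j hj).1, he N hN _ _ (hF j hj).2⟩) h₀).weaken ?_
  have hd : 1 ≤ N ^ d := Nat.pow_pos (by omega)
  have he : 1 ≤ N ^ e := Nat.pow_pos (by omega)
  rw [pow_add]
  nlinarith [Nat.mul_le_mul_right (N ^ e + 1) hm]

/-- The stores `G j` in this rule describe the situation in which `j` runs are still to come, up to
the stack `k` of the counter. -/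
theorem forEach {k : K} (d : ℕ) (h : PolyExec c P) :
    PolyExec (forEach k c) fun N S S' => ∃ m ≤ N ^ d, ∃ G : ℕ → StackStore K,
      S = update (G m) k (unary m) ∧ S' = update (G 0) k [] ∧
      ∀ j < m, P N (update (G (j + 1)) k (unary j)) (update (G j) k (unary j)) := by
  refine (((pop k).seq h).loop d).mono ?_
  rintro N - _ _ ⟨m, hm, G, rfl, rfl, hG⟩
  refine ⟨m, hm, fun j => update (G j) k (unary j), rfl, rfl, by simp, fun j hj => ⟨?_, ?_⟩⟩
  · simp [List.replicate_succ]
  · exact ⟨_, rfl, by simpa [List.replicate_succ] using hG j hj⟩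

theorem clear (k : K) (d : ℕ) :
    PolyExec (clear k) fun N S S' => (S k).length ≤ N ^ d ∧ S' = update S k [] := by
  refine of_exec 3 d fun N hN S S' ⟨_, h⟩ => (exec_clear k S).of_eq h.symm ?_
  have : 0 < N ^ d := Nat.pow_pos (by omega)
  omega

theorem transfer {k k' : K} (hk : k ≠ k') (d : ℕ) :
    PolyExec (transfer k k') fun N S S' => (S k).length ≤ N ^ d ∧
      S' = update (update S k []) k' ((S k).reverse ++ S k') := by
  refine of_exec 3 d fun N hN S S' ⟨_, h⟩ => (exec_transfer hk S).of_eq h.symm ?_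
  have : 0 < N ^ d := Nat.pow_pos (by omega)
  omega

theorem copyTo {x tmp k : K} (hxt : x ≠ tmp) (hxk : x ≠ k) (htk : tmp ≠ k) (d : ℕ) :
    PolyExec (copyTo x tmp k) fun N S S' => (S x).length ≤ N ^ d ∧ S tmp = [] ∧
      S' = update S k (unary (S x).length ++ S k) := by
  refine of_exec 7 d fun N hN S S' ⟨_, ht, h⟩ => (exec_copyTo hxt hxk htk S ht).of_eq h.symm ?_
  have : 0 < N ^ d := Nat.pow_pos (by omega)
  omega

end PolyExec

end Basic

end StackProg

/-! ### First-order formulas over an initial segment of the natural numbers -/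

/-- First-order formulas in the order and in relation symbols; variables are de Bruijn levels. -/
inductive FOFormula where
  | lt (i j : ℕ) : FOFormula
  | rel (r : ℕ) (args : List ℕ) : FOFormula
  | neg (φ : FOFormula) : FOFormula
  | and (φ ψ : FOFormula) : FOFormula
  | ex (φ : FOFormula) : FOFormula

/-- Interpretations of the relation symbols. -/
abbrev RelStore := ℕ → List ℕ → Prop

namespace FOFormula

/-- Truth in the structure with the elements `0, …, N - 1`; variables without a value have the
value `0`. -/
def Holds (N : ℕ) (ρ : RelStore) : List ℕ → FOFormula → Prop
  | env, lt i j => env.getD i 0 < env.getD j 0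
  | env, rel r args => ρ r (args.map fun i => env.getD i 0)
  | env, neg φ => ¬ φ.Holds N ρ env
  | env, and φ ψ => φ.Holds N ρ env ∧ ψ.Holds N ρ env
  | env, ex φ => ∃ x < N, φ.Holds N ρ (env ++ [x])

/-- The relation symbols are used with the arities `ar`. -/
def WF (ar : ℕ → ℕ) : FOFormula → Prop
  | lt _ _ => True
  | rel r args => args.length = ar r
  | neg φ => φ.WF ar
  | and φ ψ => φ.WF ar ∧ ψ.WF ar
  | ex φ => φ.WF ar

end FOFormula

/-! ### Evaluation of formulas by programs -/

/-- The position of a tuple over `0, …, N - 1` in the lexicographic order: its value as a number in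
base `N`. -/
def tuplePos (N : ℕ) (args : List ℕ) : ℕ := args.foldl (fun a x => a * N + x) 0

theorem foldl_eq_add_tuplePos (N : ℕ) (args : List ℕ) (a : ℕ) :
    args.foldl (fun a x => a * N + x) a = a * N ^ args.length + tuplePos N args := by
  induction args generalizing a with
  | nil => simp [tuplePos]
  | cons x l ih =>
    rw [tuplePos, List.foldl_cons, List.foldl_cons, ih, ih (0 * N + x), List.length_cons]
    ring

theorem tuplePos_cons (N x : ℕ) (l : List ℕ) :
    tuplePos N (x :: l) = x * N ^ l.length + tuplePos N l := by
  rw [tuplePos, List.foldl_cons, foldl_eq_add_tuplePos, zero_mul, zero_add]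

theorem tuplePos_lt {N : ℕ} {args : List ℕ} (h : ∀ x ∈ args, x < N) :
    tuplePos N args < N ^ args.length := by
  induction args with
  | nil => simp [tuplePos]
  | cons x l ih =>
    have hl := ih fun y hy => h y (List.mem_cons_of_mem _ hy)
    have hx : x < N := h x List.mem_cons_self
    rw [tuplePos_cons, List.length_cons, pow_succ]
    have : (x + 1) * N ^ l.length ≤ N * N ^ l.length := Nat.mul_le_mul_right _ hx
    linarith

/-- The registers of the decision procedure: the input, the size of the universe, an accumulator and
two auxiliary stacks for arithmetic, a stack of truth values, a table under construction, the values
of the variables, the tables of the relations, and loop counters. -/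
inductive Reg where
  | input | size | acc | aux | tmp | res | out
  | var (i : ℕ)
  | rel (r : ℕ)
  | cnt (j : ℕ)
  deriving DecidableEq

namespace StackProg

/-- The size register holds `N`, and the stacks for arithmetic are empty. -/
structure Ready (N : ℕ) (S : StackStore Reg) : Prop where
  size : S .size = unary N
  acc : S .acc = []
  aux : S .aux = []
  tmp : S .tmp = []

/-- The store represents the interpretation `ρ` of the relations by tables, and the values `env` of
the variables by unary numbers. -/
structure Represents (ar : ℕ → ℕ) (N : ℕ) (ρ : RelStore) (env : List ℕ) (S : StackStore Reg) : Prop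
    extends Ready N S where
  var : ∀ i, S (.var i) = unary (env.getD i 0)
  env_lt : ∀ x ∈ env, x < N
  table : ∀ r args, args.length = ar r → (∀ x ∈ args, x < N) →
    ((S (.rel r)).getD (tuplePos N args) false ↔ ρ r args)
  length_le : ∀ r, (S (.rel r)).length ≤ N ^ ar r

/-- The registers on which `Represents` imposes no condition. -/
def IsScratch : Reg → Prop
  | .input | .res | .out | .cnt _ => True
  | _ => False

namespace Represents

variable {ar : ℕ → ℕ} {N : ℕ} {ρ : RelStore} {env : List ℕ} {S : StackStore Reg}

theorem getD_lt (h : Represents ar N ρ env S) (hN : 2 ≤ N) (i : ℕ) : env.getD i 0 < N := by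
  rw [List.getD_eq_getElem?_getD]
  cases hi : env[i]? with
  | none => simp only [Option.getD_none]; omega
  | some x => exact h.env_lt x (List.mem_of_getElem? hi)

theorem var_length (h : Represents ar N ρ env S) : S (.var env.length) = [] := by
  simp [h.var]

theorem update_scratch (h : Represents ar N ρ env S) {k : Reg} (hk : IsScratch k)
    (l : List Bool) : Represents ar N ρ env (update S k l) := by
  have hS : ∀ i, ¬ IsScratch i → update S k l i = S i := fun i hi =>
    update_of_ne (by rintro rfl; exact hi hk) _ _
  have hvar : ∀ i, update S k l (.var i) = S (.var i) := fun i => hS _ id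
  have hrel : ∀ r, update S k l (.rel r) = S (.rel r) := fun r => hS _ id
  exact ⟨⟨(hS _ id).trans h.size, (hS _ id).trans h.acc, (hS _ id).trans h.aux,
    (hS _ id).trans h.tmp⟩, fun i => (hvar i).trans (h.var i), h.env_lt,
    by simpa only [hrel] using h.table, by simpa only [hrel] using h.length_le⟩

theorem update_var (h : Represents ar N ρ env S) {x : ℕ} (hx : x < N) :
    Represents ar N ρ (env ++ [x]) (update S (.var env.length) (unary x)) := by
  refine ⟨⟨by simp [h.size], by simp [h.acc], by simp [h.aux], by simp [h.tmp]⟩, fun i => ?_,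
    fun y hy => ?_, fun r args => by simpa using h.table r args, fun r => by
      simpa using h.length_le r⟩
  · rcases lt_trichotomy i env.length with hi | rfl | hi
    · simp [hi, hi.ne, h.var, List.getElem?_append_left hi]
    · simp
    · have : ¬ i ≤ env.length := by omega
      rw [update_of_ne (by simpa using hi.ne'), h.var, List.getD_eq_default _ _ hi.le,
        List.getD_eq_default _ _ (by simpa using hi)]
  · rcases List.mem_append.1 hy with hy | hy
    · exact h.env_lt y hy
    · exact List.mem_singleton.1 hy ▸ hx

end Represents

/-- Run `c` once for every element of the universe, with `k` as the loop counter. -/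
def forSize (k : Reg) (c : StackProg Reg) : StackProg Reg :=
  .seq (copyTo .size .tmp k) (forEach k c)

theorem PolyExec.forSize {k : Reg} {c : StackProg Reg}
    {P : ℕ → StackStore Reg → StackStore Reg → Prop} (hk : k ≠ .size ∧ k ≠ .tmp)
    (h : PolyExec c P) :
    PolyExec (forSize k c) fun N S S' => Ready N S ∧ S k = [] ∧ S' k = [] ∧
      ∃ G : ℕ → StackStore Reg, G N = S ∧ G 0 = S' ∧
        ∀ j < N, P N (update (G (j + 1)) k (unary j)) (update (G j) k (unary j)) := by
  refine ((PolyExec.copyTo (x := .size) (tmp := .tmp) (by simp) hk.1.symm hk.2.symm 1).seq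
    (h.forEach 1)).mono ?_
  rintro N - _ _ ⟨hS, hk, hk', G, rfl, rfl, hG⟩
  refine ⟨_, ⟨by simp [hS.size], hS.tmp, rfl⟩, N, by simp, G, ?_, ?_, hG⟩
  · simp [hS.size, hk]
  · rw [← hk', update_eq_self]

/-- Replace the number `a` in the accumulator by `a * N`. -/
def mulSize : StackProg Reg :=
  .seq (forEach .acc (copyTo .size .tmp .aux)) (transfer .aux .acc)

theorem polyExec_mulSize (d : ℕ) :
    PolyExec mulSize fun N S S' => ∃ S₀ a, Ready N S₀ ∧ a ≤ N ^ d ∧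
      S = update S₀ .acc (unary a) ∧ S' = update S₀ .acc (unary (a * N)) := by
  refine ((PolyExec.forEach d
    (PolyExec.copyTo (x := Reg.size) (tmp := .tmp) (k := .aux) (by simp) (by simp) (by simp) 1)).seq
    (PolyExec.transfer (k := Reg.aux) (k' := .acc) (by simp) (d + 1))).mono ?_
  rintro N - _ _ ⟨S₀, a, hS, ha, rfl, rfl⟩
  refine ⟨_, ⟨a, ha, fun j => update S₀ .aux (unary ((a - j) * N)), ?_, rfl, fun j hj => ?_⟩,
    ?_, ?_⟩
  · simp [← hS.aux]
  · have hstep : (a - j) * N = N + (a - (j + 1)) * N := by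
      rw [show a - j = a - (j + 1) + 1 by omega]
      ring
    refine ⟨by simp [hS.size], by simp [hS.tmp], ?_⟩
    simp only [unary, hstep, List.replicate_add]
    funext i
    grind [update_apply, hS.size]
  · simpa [pow_succ] using Nat.mul_le_mul_right N ha
  · have := hS.aux
    funext i
    simp only [tsub_zero]
    grind [update_apply, List.reverse_replicate]

/-- Append the values of the variables in a list, as digits in base `N`, to the number in the
accumulator. -/
def horner : List ℕ → StackProg Reg
  | [] => .skip
  | i :: l => .seq mulSize (.seq (copyTo (.var i) .tmp .acc) (horner l))

theorem polyExec_horner (args : List ℕ) (d : ℕ) :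
    PolyExec (horner args) fun N S S' => ∃ S₀ a val, Ready N S₀ ∧ a < N ^ d ∧ (∀ i, val i < N) ∧
      (∀ i, S₀ (.var i) = unary (val i)) ∧ S = update S₀ .acc (unary a) ∧
      S' = update S₀ .acc (unary ((args.map val).foldl (fun a x => a * N + x) a)) := by
  induction args generalizing d with
  | nil =>
    refine PolyExec.skip.mono ?_
    rintro N - S S' ⟨S₀, a, val, -, -, -, -, rfl, rfl⟩
    rfl
  | cons i l ih =>
    refine ((polyExec_mulSize d).seq
      ((PolyExec.copyTo (by simp) (by simp) (by simp) 1).seq (ih (d + 1)))).mono ?_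
    rintro N - S S' ⟨S₀, a, val, hS, ha, hval, hvar, rfl, rfl⟩
    refine ⟨_, ⟨S₀, a, hS, ha.le, rfl, rfl⟩, update S₀ .acc (unary (a * N + val i)),
      ⟨?_, ?_, ?_⟩, S₀, a * N + val i, val, hS, ?_, hval, hvar, rfl, rfl⟩
    · simpa [hvar] using (hval i).le
    · simp [hS.tmp]
    · simp [hvar, add_comm (a * N)]
    · have := Nat.mul_le_mul_right N (Nat.succ_le_of_lt ha)
      rw [pow_succ]
      linarith [hval i]

/-- Test for the symbol `true` on the top of a stack. -/
def topTrue (o : Option Bool) : Bool := o == some true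

/-- Push the truth value on the top of the stack `k` onto the stack of results. -/
def pushTop (k : Reg) : StackProg Reg := .ite topTrue k (.push .res true) (.push .res false)

theorem polyExec_pushTop (k : Reg) :
    PolyExec (pushTop k) fun _ S S' => S' = update S .res ((S k).head?.getD false :: S .res) := by
  refine ((PolyExec.push Reg.res true).ite (PolyExec.push Reg.res false)).mono ?_
  rintro N - S _ rfl
  rcases (S k).head? with _ | _ | _ <;> simp [topTrue]

/-- Move symbols from the top of the stack `k` to `tmp`, as many as the number in the accumulator
says. -/
def skipAcc (k : Reg) : StackProg Reg := forEach .acc (.mv k .tmp)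

theorem polyExec_skipAcc {k : Reg} (hk : k ≠ .acc ∧ k ≠ .tmp) (d : ℕ) :
    PolyExec (skipAcc k) fun N S S' => ∃ S₀ a, a ≤ N ^ d ∧ S₀ .acc = [] ∧ S₀ .tmp = [] ∧
      S = update S₀ .acc (unary a) ∧
      S' = update (update S₀ k ((S₀ k).drop a)) .tmp ((S₀ k).take a).reverse := by
  refine ((PolyExec.mv (k := k) (k' := .tmp) hk.2).forEach d).mono ?_
  rintro N - _ _ ⟨S₀, a, ha, hacc, htmp, rfl, rfl⟩
  refine ⟨a, ha, fun j => update (update S₀ k ((S₀ k).drop (a - j))) .tmp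
    ((S₀ k).take (a - j)).reverse, ?_, ?_, fun j hj => ?_⟩
  · have : update S₀ .tmp [] = S₀ := by rw [← htmp, update_eq_self]
    simp [this]
  · simp only [tsub_zero]
    funext i
    grind [update_apply]
  · have hdrop : (S₀ k).drop (a - j) = ((S₀ k).drop (a - (j + 1))).tail := by
      rw [List.tail_drop]
      congr 1
      omega
    have htake : ((S₀ k).take (a - j)).reverse =
        ((S₀ k).drop (a - (j + 1))).head?.toList ++ ((S₀ k).take (a - (j + 1))).reverse := by
      rw [show a - j = a - (j + 1) + 1 by omega, List.take_add_one, List.reverse_append,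
        List.head?_drop]
      cases (S₀ k)[a - (j + 1)]? <;> rfl
    simp only [hdrop, htake]
    funext i
    grind [update_apply]

/-- Push the entry of the table of `r` at the position in the accumulator. -/
def readTable (r : ℕ) : StackProg Reg :=
  .seq (skipAcc (.rel r)) (.seq (pushTop (.rel r)) (transfer .tmp (.rel r)))

theorem polyExec_readTable (r d : ℕ) :
    PolyExec (readTable r) fun N S S' => ∃ S₀ a, a ≤ N ^ d ∧ S₀ .acc = [] ∧ S₀ .tmp = [] ∧
      S = update S₀ .acc (unary a) ∧
      S' = update S₀ .res ((S₀ (.rel r)).getD a false :: S₀ .res) := by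
  refine ((polyExec_skipAcc (k := .rel r) (by simp) d).seq ((polyExec_pushTop (.rel r)).seq
    (PolyExec.transfer (k := .tmp) (k' := .rel r) (by simp) d))).mono ?_
  rintro N - _ _ ⟨S₀, a, ha, hacc, htmp, rfl, rfl⟩
  refine ⟨_, ⟨S₀, a, ha, hacc, htmp, rfl, rfl⟩, _, rfl, by simp [ha], ?_⟩
  have : ((S₀ (.rel r)).drop a).head?.getD false = (S₀ (.rel r)).getD a false := by
    rw [List.head?_drop, List.getD_eq_getElem?_getD]
  have : (S₀ (.rel r)).take a ++ (S₀ (.rel r)).drop a = S₀ (.rel r) :=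
    List.take_append_drop _ _
  funext i
  by_cases hi : i = .res <;> by_cases hi' : i = .rel r <;> by_cases hi'' : i = .tmp <;>
    simp_all

/-- Compare the values of two variables by truncated subtraction. -/
def evalLT (i j : ℕ) : StackProg Reg :=
  .seq (copyTo (.var i) .tmp .aux) <| .seq (copyTo (.var j) .tmp .acc) <|
  .seq (forEach .aux (.pop .acc)) <| .seq (pushTop .acc) (clear .acc)

theorem polyExec_evalLT (i j : ℕ) :
    PolyExec (evalLT i j) fun N S S' => ∃ x < N, ∃ y < N, Ready N S ∧ S (.var i) = unary x ∧
      S (.var j) = unary y ∧ S' = update S .res (decide (x < y) :: S .res) := by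
  refine ((PolyExec.copyTo (x := Reg.var i) (tmp := .tmp) (k := .aux) (by simp) (by simp)
    (by simp) 1).seq <| (PolyExec.copyTo (x := Reg.var j) (tmp := .tmp) (k := .acc) (by simp)
    (by simp) (by simp) 1).seq <| ((PolyExec.pop .acc).forEach 1).seq <|
    (polyExec_pushTop .acc).seq (PolyExec.clear .acc 1)).mono ?_
  rintro N - S _ ⟨x, hx, y, hy, hS, hi, hj, rfl⟩
  have hpush : (unary (y - x)).head?.getD false = decide (x < y) := by
    rcases hm : y - x with _ | m
    · simp; omega
    · simp [List.replicate_succ]; omega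
  refine ⟨_, ⟨by simp [hi, hx.le], hS.tmp, rfl⟩, _, ⟨by simp [hj, hy.le], by simp [hS.tmp], rfl⟩,
    update S .acc (unary (y - x)), ⟨x, by simpa using hx.le,
      fun m => update S .acc (unary (y - (x - m))), ?_, ?_, fun m hm => ?_⟩, _, rfl, ?_, ?_⟩
  · have := hS.acc
    simp only [hi, hS.aux]
    funext k
    grind [update_apply]
  · have := hS.aux
    funext k
    grind [update_apply]
  · have : y - (x - m) = y - (x - (m + 1)) - 1 := by omega
    simp only [this]
    funext k
    grind [update_apply, List.tail_replicate]
  · simp; omega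
  · have := hS.acc
    funext k
    simp only [update_self, hpush]
    grind [update_apply]

/-- Replace the top of the stack of results by its negation. -/
def notTop : StackProg Reg :=
  .ite topTrue .res (.seq (.pop .res) (.push .res false)) (.seq (.pop .res) (.push .res true))

theorem polyExec_notTop :
    PolyExec notTop fun _ S S' => ∃ (S₀ : StackStore Reg) (b : Bool),
      S = update S₀ .res (b :: S₀ .res) ∧ S' = update S₀ .res ((!b) :: S₀ .res) := by
  refine (((PolyExec.pop Reg.res).seq (.push .res false)).ite
    ((PolyExec.pop .res).seq (.push .res true))).mono ?_
  rintro N - _ _ ⟨S, _ | _, rfl, rfl⟩ <;> simp [topTrue]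

/-- Replace the two topmost results by their conjunction. -/
def andTop : StackProg Reg :=
  .ite topTrue .res (.pop .res) (.seq (.pop .res) (.seq (.pop .res) (.push .res false)))

theorem polyExec_andTop :
    PolyExec andTop fun _ S S' => ∃ (S₀ : StackStore Reg) (a b : Bool),
      S = update S₀ .res (b :: a :: S₀ .res) ∧ S' = update S₀ .res ((a && b) :: S₀ .res) := by
  refine ((PolyExec.pop Reg.res).ite
    ((PolyExec.pop .res).seq ((PolyExec.pop .res).seq (.push .res false)))).mono ?_
  rintro N - _ _ ⟨S, a, _ | _, rfl, rfl⟩ <;> simp [topTrue]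

/-- Replace the two topmost results by their disjunction. -/
def orTop : StackProg Reg :=
  .ite topTrue .res (.seq (.pop .res) (.seq (.pop .res) (.push .res true))) (.pop .res)

theorem polyExec_orTop :
    PolyExec orTop fun _ S S' => ∃ (S₀ : StackStore Reg) (a b : Bool),
      S = update S₀ .res (b :: a :: S₀ .res) ∧ S' = update S₀ .res ((a || b) :: S₀ .res) := by
  refine (((PolyExec.pop Reg.res).seq ((PolyExec.pop .res).seq (.push .res true))).ite
    (PolyExec.pop .res)).mono ?_
  rintro N - _ _ ⟨S, a, _ | _, rfl, rfl⟩ <;> simp [topTrue]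

/-- Push the truth value of a formula in `d` free variables onto the stack of results. -/
def evalFormula : FOFormula → ℕ → StackProg Reg
  | .lt i j, _ => evalLT i j
  | .rel r args, _ => .seq (horner args) (readTable r)
  | .neg φ, d => .seq (evalFormula φ d) notTop
  | .and φ ψ, d => .seq (evalFormula φ d) (.seq (evalFormula ψ d) andTop)
  | .ex φ, d => .seq (.push .res false) (forSize (.var d) (.seq (evalFormula φ (d + 1)) orTop))

/-- The transitions between stores that the evaluation of `φ` has to make. -/
def EvalSpec (ar : ℕ → ℕ) (φ : FOFormula) (d N : ℕ) (S S' : StackStore Reg) : Prop :=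
  ∃ (ρ : RelStore) (env : List ℕ) (b : Bool), env.length = d ∧ Represents ar N ρ env S ∧
    (b ↔ φ.Holds N ρ env) ∧ S' = update S .res (b :: S .res)

section EvalFormula

variable {ar : ℕ → ℕ}

theorem polyExec_evalFormula_lt (i j d : ℕ) :
    PolyExec (evalFormula (.lt i j) d) (EvalSpec ar (.lt i j) d) := by
  refine (polyExec_evalLT i j).mono ?_
  rintro N hN S _ ⟨ρ, env, b, -, h, hb, rfl⟩
  refine ⟨_, h.getD_lt hN i, _, h.getD_lt hN j, h.toReady, h.var i, h.var j, ?_⟩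
  rw [show b = decide (env.getD i 0 < env.getD j 0) from
    Bool.eq_iff_iff.2 (hb.trans (by simp [FOFormula.Holds]))]

theorem polyExec_evalFormula_rel {r : ℕ} {args : List ℕ} (hr : args.length = ar r) (d : ℕ) :
    PolyExec (evalFormula (.rel r args) d) (EvalSpec ar (.rel r args) d) := by
  refine ((polyExec_horner args 0).seq (polyExec_readTable r args.length)).mono ?_
  rintro N hN S _ ⟨ρ, env, b, -, h, hb, rfl⟩
  set val : ℕ → ℕ := fun i => env.getD i 0
  have hval : ∀ x ∈ args.map val, x < N := by
    simpa only [List.forall_mem_map] using fun i _ => h.getD_lt hN i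
  have hpos : tuplePos N (args.map val) < N ^ args.length := by simpa using tuplePos_lt hval
  refine ⟨_, ⟨S, 0, val, h.toReady, by simp, h.getD_lt hN, h.var, ?_, rfl⟩,
    S, tuplePos N (args.map val), hpos.le, h.acc, h.tmp, rfl, ?_⟩
  · rw [unary, List.replicate_zero, ← h.acc, update_eq_self]
  · rw [Bool.eq_iff_iff.2 (hb.trans (h.table r _ (by simpa using hr) hval).symm)]

theorem polyExec_evalFormula_neg {φ : FOFormula} {d : ℕ}
    (h : PolyExec (evalFormula φ d) (EvalSpec ar φ d)) :
    PolyExec (evalFormula (.neg φ) d) (EvalSpec ar (.neg φ) d) := by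
  refine (h.seq polyExec_notTop).mono ?_
  rintro N - S _ ⟨ρ, env, b, hd, hS, hb, rfl⟩
  have hb' : (!b) = true ↔ φ.Holds N ρ env := by
    simp only [FOFormula.Holds] at hb
    grind
  exact ⟨_, ⟨ρ, env, !b, hd, hS, hb', rfl⟩, S, _, rfl, by simp⟩

theorem polyExec_evalFormula_and {φ ψ : FOFormula} {d : ℕ}
    (h₁ : PolyExec (evalFormula φ d) (EvalSpec ar φ d))
    (h₂ : PolyExec (evalFormula ψ d) (EvalSpec ar ψ d)) :
    PolyExec (evalFormula (.and φ ψ) d) (EvalSpec ar (.and φ ψ) d) := by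
  classical
  refine (h₁.seq (h₂.seq polyExec_andTop)).mono ?_
  rintro N - S _ ⟨ρ, env, b, hd, hS, hb, rfl⟩
  refine ⟨_, ⟨ρ, env, _, hd, hS, decide_eq_true_iff, rfl⟩, _,
    ⟨ρ, env, _, hd, hS.update_scratch (k := .res) trivial _, decide_eq_true_iff, rfl⟩,
    S, _, _, by simp; rfl, ?_⟩
  rw [Bool.eq_iff_iff.2 (hb.trans (Bool.and_eq_true_iff.trans (and_congr decide_eq_true_iff
    decide_eq_true_iff)).symm)]

theorem polyExec_evalFormula_ex {φ : FOFormula} {d : ℕ}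
    (h : PolyExec (evalFormula φ (d + 1)) (EvalSpec ar φ (d + 1))) :
    PolyExec (evalFormula (.ex φ) d) (EvalSpec ar (.ex φ) d) := by
  classical
  refine ((PolyExec.push .res false).seq
    ((h.seq polyExec_orTop).forSize (k := .var d) (by simp))).mono ?_
  rintro N - S _ ⟨ρ, env, b, rfl, hS, hb, rfl⟩
  have hvar := hS.var_length
  let p (j : ℕ) : Prop := ∃ x < N, j ≤ x ∧ φ.Holds N ρ (env ++ [x])
  have hpN : ¬ p N := fun ⟨x, hx, hx', _⟩ => hx.not_ge hx'
  have hp0 : b = decide (p 0) :=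
    Bool.eq_iff_iff.2 (hb.trans (by simp [FOFormula.Holds, p]))
  refine ⟨_, rfl, ⟨by simp [hS.size], by simp [hS.acc], by simp [hS.aux], by simp [hS.tmp]⟩,
    by simp [hvar], by simp [hvar], fun j => update S .res (decide (p j) :: S .res), by simp [hpN],
    by simp [hp0], fun j hj => ?_⟩
  have hp : p j ↔ p (j + 1) ∨ φ.Holds N ρ (env ++ [j]) := by grind
  refine ⟨_, ⟨ρ, env ++ [j], decide _, by simp,
    (hS.update_scratch (k := .res) trivial _).update_var hj, decide_eq_true_iff, rfl⟩,
    update S (.var env.length) (unary j), decide (p (j + 1)),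
    decide (φ.Holds N ρ (env ++ [j])), ?_, ?_⟩
  · funext i
    grind [update_apply]
  · simp only [hp, Bool.decide_or]
    funext i
    grind [update_apply]

theorem polyExec_evalFormula {φ : FOFormula} (hφ : φ.WF ar) (d : ℕ) :
    PolyExec (evalFormula φ d) (EvalSpec ar φ d) := by
  induction φ generalizing d with
  | lt i j => exact polyExec_evalFormula_lt i j d
  | rel r args => exact polyExec_evalFormula_rel hφ d
  | neg φ ih => exact polyExec_evalFormula_neg (ih hφ d)
  | and φ ψ ih₁ ih₂ => exact polyExec_evalFormula_and (ih₁ hφ.1 d) (ih₂ hφ.2 d)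
  | ex φ ih => exact polyExec_evalFormula_ex (ih hφ (d + 1))

end EvalFormula

end StackProg

/-! ### Programs that compute relations -/

open Classical in
/-- The truth values of `R` on the tuples of length `k` over `0, …, N - 1` in lexicographic
order. -/
noncomputable def tupleTable (N : ℕ) : ℕ → (List ℕ → Prop) → List Bool
  | 0, R => [decide (R [])]
  | k + 1, R => (List.range N).flatMap fun x => tupleTable N k fun a => R (x :: a)

theorem length_tupleTable (N k : ℕ) (R : List ℕ → Prop) : (tupleTable N k R).length = N ^ k := by
  induction k generalizing R with
  | zero => rfl
  | succ k ih => simp [tupleTable, List.length_flatMap, ih, pow_succ, mul_comm]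

theorem tupleTable_congr {N k : ℕ} {R R' : List ℕ → Prop}
    (h : ∀ a, a.length = k → (∀ x ∈ a, x < N) → (R a ↔ R' a)) :
    tupleTable N k R = tupleTable N k R' := by
  induction k generalizing R R' with
  | zero => simp [tupleTable, h []]
  | succ k ih =>
    refine List.flatMap_congr fun x hx => ih fun a ha hlt => h _ (by simp [ha]) ?_
    exact List.forall_mem_cons.2 ⟨List.mem_range.1 hx, hlt⟩

theorem getElem?_flatMap_range {α : Type*} {L M : ℕ} (g : ℕ → List α) (hg : ∀ i, (g i).length = L)
    {i j : ℕ} (hi : i < M) (hj : j < L) :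
    ((List.range M).flatMap g)[i * L + j]? = (g i)[j]? := by
  induction M with
  | zero => omega
  | succ M ih =>
    have hlen : ((List.range M).flatMap g).length = M * L := by
      simp [List.length_flatMap, hg]
    rw [List.range_succ, List.flatMap_append]
    rcases Nat.lt_succ_iff_lt_or_eq.1 hi with h | rfl
    · rw [List.getElem?_append_left, ih h]
      rw [hlen]
      have : (i + 1) * L ≤ M * L := Nat.mul_le_mul_right _ h
      linarith
    · rw [List.getElem?_append_right (by rw [hlen]; omega), hlen]
      simp

theorem getD_tupleTable {N : ℕ} {R : List ℕ → Prop} {args : List ℕ} (h : ∀ x ∈ args, x < N) :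
    (tupleTable N args.length R).getD (tuplePos N args) false ↔ R args := by
  induction args generalizing R with
  | nil => simp [tuplePos, tupleTable]
  | cons x l ih =>
    have hl : ∀ y ∈ l, y < N := fun y hy => h y (List.mem_cons_of_mem _ hy)
    rw [← ih (R := fun a => R (x :: a)) hl, tuplePos_cons, List.length_cons, tupleTable,
      List.getD_eq_getElem?_getD, List.getD_eq_getElem?_getD,
      getElem?_flatMap_range _ (fun i => length_tupleTable N _ _) (h x List.mem_cons_self)
        (tuplePos_lt hl)]

/-- An instruction defines a relation by a formula, or by iterating a formula. -/
inductive RelInstr where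
  | define (r : ℕ) (φ : FOFormula) : RelInstr
  | iterate (r : ℕ) (φ : FOFormula) : RelInstr

namespace FOFormula

/-- Disjunction. -/
def or (φ ψ : FOFormula) : FOFormula := .neg (.and (.neg φ) (.neg ψ))

/-- A formula that never holds. -/
def false : FOFormula := .lt 0 0

end FOFormula

namespace RelInstr

variable (ar : ℕ → ℕ) (N : ℕ)

/-- The relation that the instruction computes. -/
def target : RelInstr → ℕ
  | define r _ => r
  | iterate r _ => r

/-- The formula of the instruction uses the relations with their arities. -/
def WF : RelInstr → Prop
  | define _ φ => φ.WF ar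
  | iterate _ φ => φ.WF ar

/-- Replace the relation `r` by the one that `φ` defines. -/
def assign (r : ℕ) (φ : FOFormula) (ρ : RelStore) : RelStore :=
  update ρ r fun a => a.length = ar r ∧ (∀ x ∈ a, x < N) ∧ φ.Holds N ρ a

/-- The formula that adds to the relation `r` the tuples defined by `φ`. -/
def extend (r : ℕ) (φ : FOFormula) : FOFormula := .or (.rel r (List.range (ar r))) φ

/-- The stages of an inflationary iteration of `φ` that starts from the empty relation. -/
def stage (r : ℕ) (φ : FOFormula) (ρ : RelStore) (m : ℕ) : RelStore :=
  (assign ar N r (extend ar r φ))^[m] (assign ar N r .false ρ)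

/-- The effect of an instruction. An iteration runs through `N ^ k` stages, where `k` is the arity
of the relation. -/
def apply : RelInstr → RelStore → RelStore
  | define r φ => assign ar N r φ
  | iterate r φ => fun ρ => stage ar N r φ ρ (N ^ ar r)

variable {ar N}

theorem stage_of_ne {r s : ℕ} {φ : FOFormula} {ρ : RelStore} (hs : s ≠ r) (m : ℕ) :
    stage ar N r φ ρ m s = ρ s := by
  induction m with
  | zero => exact update_of_ne hs _ _
  | succ m ih => rw [stage, iterate_succ_apply', assign, update_of_ne hs, ← ih, stage]

theorem apply_of_ne {s : ℕ} {I : RelInstr} (ρ : RelStore) (h : s ≠ I.target) :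
    I.apply ar N ρ s = ρ s := by
  cases I with
  | define r φ => exact update_of_ne h _ _
  | iterate r φ => exact stage_of_ne h _

end RelInstr

namespace StackProg

theorem Represents.update_rel {ar : ℕ → ℕ} {N : ℕ} {ρ σ : RelStore} {env : List ℕ}
    {S : StackStore Reg} (h : Represents ar N ρ env S) {r : ℕ} (hσ : ∀ s ≠ r, σ s = ρ s)
    {R : List ℕ → Prop} (hR : ∀ a, a.length = ar r → (∀ x ∈ a, x < N) → (R a ↔ σ r a)) :
    Represents ar N σ env (update S (.rel r) (tupleTable N (ar r) R)) := by
  refine ⟨⟨by simp [h.size], by simp [h.acc], by simp [h.aux], by simp [h.tmp]⟩,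
    fun i => by simp [h.var], h.env_lt, fun s args hs hargs => ?_, fun s => ?_⟩
  · by_cases hsr : s = r
    · subst hsr
      rw [update_self, ← hs, getD_tupleTable hargs, hR _ hs hargs]
    · rw [update_of_ne (by simpa using hsr), hσ s hsr, h.table s args hs hargs]
  · by_cases hsr : s = r
    · subst hsr
      rw [update_self, length_tupleTable]
    · rw [update_of_ne (by simpa using hsr)]
      exact h.length_le s

/-- Evaluate the formula for all values of `k` variables in addition to the first `d` ones, and push
the table of the truth values. -/
def fillTable (φ : FOFormula) : ℕ → ℕ → StackProg Reg
  | d, 0 => .seq (evalFormula φ d) (.mv .res .out)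
  | d, k + 1 => forSize (.var d) (fillTable φ (d + 1) k)

theorem polyExec_fillTable {ar : ℕ → ℕ} {φ : FOFormula} (hφ : φ.WF ar) (d k : ℕ) :
    PolyExec (fillTable φ d k) fun N S S' => ∃ ρ env, env.length = d ∧ Represents ar N ρ env S ∧
      S' = update S .out (tupleTable N k (fun a => φ.Holds N ρ (env ++ a)) ++ S .out) := by
  classical
  induction k generalizing d with
  | zero =>
    refine ((polyExec_evalFormula hφ d).seq (PolyExec.mv (k := .res) (k' := .out)
      (by simp))).mono ?_
    rintro N - S _ ⟨ρ, env, hd, hS, rfl⟩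
    refine ⟨_, ⟨ρ, env, _, hd, hS, decide_eq_true_iff, rfl⟩, ?_⟩
    simp only [tupleTable, List.append_nil]
    funext i
    grind [update_apply]
  | succ k ih =>
    refine ((ih (d + 1)).forSize (k := .var d) (by simp)).mono ?_
    rintro N - S _ ⟨ρ, env, rfl, hS, rfl⟩
    let block (x : ℕ) : List Bool := tupleTable N k fun a => φ.Holds N ρ (env ++ x :: a)
    -- The loop counts down, so the blocks of the table are pushed from the last to the first one.
    refine ⟨hS.toReady, hS.var_length, by simp [hS.var_length],
      fun j => update S .out ((List.range' j (N - j)).flatMap block ++ S .out), by simp, ?_,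
      fun j hj => ⟨ρ, env ++ [j], by simp,
        (hS.update_scratch (k := .out) trivial _).update_var hj, ?_⟩⟩
    · simp only [tupleTable, List.range_eq_range', Nat.sub_zero, block]
    · simp only [show N - j = N - (j + 1) + 1 by omega, List.range'_succ, List.flatMap_cons,
        List.append_assoc, List.singleton_append, block]
      funext i
      grind [update_apply]

/-- Replace the table of the relation `r`, of arity `k`, by the one that the formula defines. -/
def assignTable (r k : ℕ) (φ : FOFormula) : StackProg Reg :=
  .seq (fillTable φ 0 k) <| .seq (clear (.rel r)) <| .seq (transfer .out .tmp)
    (transfer .tmp (.rel r))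

theorem polyExec_assignTable {ar : ℕ → ℕ} (r : ℕ) {φ : FOFormula} (hφ : φ.WF ar) :
    PolyExec (assignTable r (ar r) φ) fun N S S' => ∃ ρ, Represents ar N ρ [] S ∧ S .out = [] ∧
      S' = update S (.rel r) (tupleTable N (ar r) (RelInstr.assign ar N r φ ρ r)) := by
  refine ((polyExec_fillTable hφ 0 (ar r)).seq <| (PolyExec.clear (.rel r) (ar r)).seq <|
    (PolyExec.transfer (k := .out) (k' := .tmp) (by simp) (ar r)).seq <|
    PolyExec.transfer (k := .tmp) (k' := .rel r) (by simp) (ar r)).mono ?_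
  rintro N - S _ ⟨ρ, hS, hout, rfl⟩
  have htable : tupleTable N (ar r) (RelInstr.assign ar N r φ ρ r) =
      tupleTable N (ar r) fun a => φ.Holds N ρ a :=
    tupleTable_congr fun a ha hlt => by
      simpa [RelInstr.assign, ha] using fun _ => hlt
  refine ⟨_, ⟨ρ, [], rfl, hS, rfl⟩, _, ⟨by simpa using hS.length_le r, rfl⟩, _,
    ⟨by simp [hout, length_tupleTable], rfl⟩, by simp [hout, hS.tmp, length_tupleTable], ?_⟩
  have := hS.tmp
  simp only [htable, hout, List.nil_append, List.append_nil]
  funext i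
  grind [update_apply]

/-- Run a program `N ^ k` times. -/
def repeatPow (c : StackProg Reg) : ℕ → StackProg Reg
  | 0 => c
  | k + 1 => forSize (.cnt k) (repeatPow c k)

theorem PolyExec.repeatPow {c : StackProg Reg} {P : ℕ → StackStore Reg → StackStore Reg → Prop}
    (h : PolyExec c P)
    (hP : ∀ N S S' j l, P N S S' → P N (update S (.cnt j) l) (update S' (.cnt j) l)) (k : ℕ) :
    PolyExec (repeatPow c k) fun N S S' => ∃ G : ℕ → StackStore Reg, G 0 = S ∧ G (N ^ k) = S' ∧
      (∀ i, Ready N (G i) ∧ ∀ j < k, G i (.cnt j) = []) ∧ ∀ i < N ^ k, P N (G i) (G (i + 1)) := by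
  induction k with
  | zero =>
    refine h.mono ?_
    rintro N - _ _ ⟨G, rfl, rfl, -, hG⟩
    exact hG 0 Nat.one_pos
  | succ k ih =>
    refine (ih.forSize (k := .cnt k) (by simp)).mono ?_
    rintro N - _ _ ⟨G, rfl, rfl, hG, hP'⟩
    refine ⟨(hG 0).1, (hG 0).2 k (by simp), (hG _).2 k (by simp), fun j => G ((N - j) * N ^ k),
      by simp, by simp [pow_succ'], fun j hj =>
        ⟨fun i => update (G ((N - (j + 1)) * N ^ k + i)) (.cnt k) (unary j), by simp, ?_,
        fun i => ⟨?_, fun j' hj' => ?_⟩, fun i hi => hP _ _ _ _ _ (hP' _ ?_)⟩⟩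
    · simp only [← Nat.succ_mul, show (N - (j + 1)).succ = N - j by omega]
    · obtain ⟨h₁, h₂, h₃, h₄⟩ := (hG ((N - (j + 1)) * N ^ k + i)).1
      exact ⟨by simp [h₁], by simp [h₂], by simp [h₃], by simp [h₄]⟩
    · exact (update_of_ne (by simpa using hj'.ne) _ _).trans ((hG _).2 j' (by omega))
    · have : (N - (j + 1) + 1) * N ^ k ≤ N * N ^ k := Nat.mul_le_mul_right _ (by omega)
      rw [pow_succ']
      linarith

/-- The stack program of an instruction. -/
def ofInstr (ar : ℕ → ℕ) : RelInstr → StackProg Reg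
  | .define r φ => assignTable r (ar r) φ
  | .iterate r φ => .seq (assignTable r (ar r) .false)
      (repeatPow (assignTable r (ar r) (RelInstr.extend ar r φ)) (ar r))

theorem polyExec_ofInstr {ar : ℕ → ℕ} {I : RelInstr} (hI : I.WF ar) :
    PolyExec (ofInstr ar I) fun N S S' => ∃ ρ, Represents ar N ρ [] S ∧ S .out = [] ∧
      (∀ j, S (.cnt j) = []) ∧
      S' = update S (.rel I.target) (tupleTable N (ar I.target) (I.apply ar N ρ I.target)) := by
  cases I with
  | define r φ =>
    refine (polyExec_assignTable r hI).mono ?_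
    rintro N - S _ ⟨ρ, hS, hout, -, rfl⟩
    exact ⟨ρ, hS, hout, rfl⟩
  | iterate r φ =>
    have hφ : (RelInstr.extend ar r φ).WF ar := ⟨List.length_range, hI⟩
    refine ((polyExec_assignTable r (φ := .false) trivial).seq
      ((polyExec_assignTable r hφ).repeatPow ?_ (ar r))).mono ?_
    · rintro N S _ j l ⟨ρ, hS, hout, rfl⟩
      exact ⟨ρ, hS.update_scratch (k := .cnt j) trivial l, by simp [hout],
        update_comm (by simp) _ _ _⟩
    · rintro N - S _ ⟨ρ, hS, hout, hcnt, rfl⟩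
      let σ : ℕ → RelStore := RelInstr.stage ar N r φ ρ
      have hσ : ∀ i, Represents ar N (σ i) []
          (update S (.rel r) (tupleTable N (ar r) (σ i r))) := fun i =>
        hS.update_rel (fun s hs => RelInstr.stage_of_ne hs i) fun _ _ _ => Iff.rfl
      refine ⟨_, ⟨ρ, hS, hout, rfl⟩, fun i => update S (.rel r) (tupleTable N (ar r) (σ i r)), rfl,
        rfl, fun i => ⟨(hσ i).toReady, by simp [hcnt]⟩, fun i _ => ⟨σ i, hσ i, by simp [hout], ?_⟩⟩
      simp only [update_idem, σ, RelInstr.stage, iterate_succ_apply']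

/-- The stack program of a list of instructions. -/
def ofInstrs (ar : ℕ → ℕ) : List RelInstr → StackProg Reg
  | [] => .skip
  | I :: P => .seq (ofInstr ar I) (ofInstrs ar P)

/-- The store to which `ofInstrs` takes a store that represents `ρ`. -/
noncomputable def storeAfter (ar : ℕ → ℕ) (N : ℕ) :
    List RelInstr → RelStore → StackStore Reg → StackStore Reg
  | [], _, S => S
  | I :: P, ρ, S => storeAfter ar N P (I.apply ar N ρ)
      (update S (.rel I.target) (tupleTable N (ar I.target) (I.apply ar N ρ I.target)))

section StoreAfter

variable {ar : ℕ → ℕ} {N : ℕ} {P : List RelInstr} {ρ : RelStore} {S : StackStore Reg}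

theorem storeAfter_of_ne {k : Reg} (hk : ∀ I ∈ P, k ≠ .rel I.target) :
    storeAfter ar N P ρ S k = S k := by
  induction P generalizing ρ S with
  | nil => rfl
  | cons I P ih =>
    rw [List.forall_mem_cons] at hk
    rw [storeAfter, ih hk.2, update_of_ne hk.1]

theorem Represents.update_apply (h : Represents ar N ρ [] S) (I : RelInstr) :
    Represents ar N (I.apply ar N ρ) []
      (update S (.rel I.target) (tupleTable N (ar I.target) (I.apply ar N ρ I.target))) :=
  h.update_rel (fun _ => RelInstr.apply_of_ne ρ) fun _ _ _ => Iff.rfl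

theorem Represents.storeAfter (h : Represents ar N ρ [] S) :
    Represents ar N (P.foldl (fun ρ I => I.apply ar N ρ) ρ) [] (storeAfter ar N P ρ S) := by
  induction P generalizing ρ S with
  | nil => exact h
  | cons I _ ih => exact ih (h.update_apply I)

end StoreAfter

theorem polyExec_ofInstrs {ar : ℕ → ℕ} {P : List RelInstr} (hP : ∀ I ∈ P, I.WF ar) :
    PolyExec (ofInstrs ar P) fun N S S' => ∃ ρ, Represents ar N ρ [] S ∧ S .out = [] ∧
      (∀ j, S (.cnt j) = []) ∧ S' = storeAfter ar N P ρ S := by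
  induction P with
  | nil =>
    refine PolyExec.skip.mono ?_
    rintro N - S _ ⟨ρ, -, -, -, rfl⟩
    rfl
  | cons I P ih =>
    rw [List.forall_mem_cons] at hP
    refine ((polyExec_ofInstr hP.1).seq (ih hP.2)).mono ?_
    rintro N - S _ ⟨ρ, hS, hout, hcnt, rfl⟩
    exact ⟨_, ⟨ρ, hS, hout, hcnt, rfl⟩, I.apply ar N ρ, hS.update_apply I, by simp [hout],
      by simp [hcnt], rfl⟩

end StackProg

/-! ### Fixed points -/

/-- The tuples of length `k` over `0, …, N - 1`. -/
def tuples (N k : ℕ) : Finset (List ℕ) :=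
  (Finset.univ : Finset (Fin k → Fin N)).image fun v => List.ofFn fun i => (v i : ℕ)

theorem mem_tuples {N k : ℕ} {a : List ℕ} : a ∈ tuples N k ↔ a.length = k ∧ ∀ x ∈ a, x < N := by
  simp only [tuples, Finset.mem_image, Finset.mem_univ, true_and]
  constructor
  · rintro ⟨v, rfl⟩
    simp [List.mem_ofFn]
  · rintro ⟨rfl, h⟩
    exact ⟨fun i => ⟨a[i], h _ (List.getElem_mem _)⟩, by simp⟩

theorem card_tuples_le (N k : ℕ) : (tuples N k).card ≤ N ^ k :=
  Finset.card_image_le.trans (by simp)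

namespace RelInstr

variable {ar : ℕ → ℕ} {N r : ℕ} {φ : FOFormula} {ρ : RelStore} {a : List ℕ}

theorem holds_extend (ha : a.length = ar r) :
    (extend ar r φ).Holds N ρ a ↔ ρ r a ∨ φ.Holds N ρ a := by
  have : (List.range (ar r)).map (fun i => a.getD i 0) = a := by
    apply List.ext_getElem
    · simp [ha]
    · intro i _ hi
      simp [List.getD_eq_getElem?_getD, hi]
  simp only [extend, FOFormula.or, FOFormula.Holds, this]
  tauto

theorem apply_define (ha : a.length = ar r) (haN : ∀ x ∈ a, x < N) :
    (define r φ).apply ar N ρ r a ↔ φ.Holds N ρ a := by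
  simp only [apply, assign, update_self]
  exact ⟨fun h => h.2.2, fun h => ⟨ha, haN, h⟩⟩

theorem not_stage_zero : ¬ stage ar N r φ ρ 0 r a := by
  simp [stage, assign, FOFormula.false, FOFormula.Holds]

theorem stage_succ_eq (m : ℕ) :
    stage ar N r φ ρ (m + 1) = assign ar N r (extend ar r φ) (stage ar N r φ ρ m) :=
  iterate_succ_apply' _ _ _

theorem stage_succ {m : ℕ} :
    stage ar N r φ ρ (m + 1) r a ↔ a.length = ar r ∧ (∀ x ∈ a, x < N) ∧
      (stage ar N r φ ρ m r a ∨ φ.Holds N (stage ar N r φ ρ m) a) := by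
  rw [stage_succ_eq, assign, update_self]
  exact and_congr_right fun ha => and_congr_right fun _ => holds_extend ha

theorem stage_eq_update (m : ℕ) :
    stage ar N r φ ρ m = update ρ r (stage ar N r φ ρ m r) := by
  funext s
  by_cases hs : s = r
  · subst hs; simp
  · rw [update_of_ne hs, stage_of_ne hs]

theorem mem_tuples_of_stage {m : ℕ} (h : stage ar N r φ ρ m r a) : a ∈ tuples N (ar r) := by
  cases m with
  | zero => exact absurd h not_stage_zero
  | succ m => exact mem_tuples.2 ⟨(stage_succ.1 h).1, (stage_succ.1 h).2.1⟩

/-- The stages grow inside a set with at most `N ^ ar r` elements. -/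
theorem stage_stabilises : stage ar N r φ ρ (N ^ ar r + 1) = stage ar N r φ ρ (N ^ ar r) := by
  let X (m : ℕ) : Set (List ℕ) := {a | stage ar N r φ ρ m r a}
  have hX : ∀ m, X m ⊆ tuples N (ar r) := fun m _ => mem_tuples_of_stage
  have hmono : ∀ m, X m ⊆ X (m + 1) := fun m a ha =>
    stage_succ.2 (and_assoc.1 ⟨mem_tuples.1 (hX m ha), Or.inl ha⟩)
  have hfin : ∀ m, (X m).Finite := fun m => (tuples N (ar r)).finite_toSet.subset (hX m)
  have hbound : ∀ m, (X m).ncard ≤ N ^ ar r := fun m =>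
    (Set.ncard_le_ncard (hX m) (Finset.finite_toSet _)).trans
      ((Set.ncard_coe_finset _).trans_le (card_tuples_le _ _))
  have heq : ∀ m, (X m).ncard = (X (m + 1)).ncard →
      stage ar N r φ ρ m = stage ar N r φ ρ (m + 1) := fun m h => by
      have : stage ar N r φ ρ m r = stage ar N r φ ρ (m + 1) r :=
        Set.eq_of_subset_of_ncard_le (hmono m) h.ge (hfin _)
      rw [stage_eq_update m, stage_eq_update (m + 1), this]
  refine (heq _ (Nat.stabilises_of_monotone (f := fun m => (X m).ncard)
    (monotone_nat_of_le_succ fun m => Set.ncard_le_ncard (hmono m) (hfin _)) hbound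
    (fun m h => ?_) (Nat.le_succ _)).symm).symm
  have : stage ar N r φ ρ (m + 1) = stage ar N r φ ρ (m + 2) :=
    (stage_succ_eq m).trans ((congrArg _ (heq m h)).trans (stage_succ_eq (m + 1)).symm)
  simp only [X, this]

theorem apply_iterate_closed (ha : a.length = ar r) (haN : ∀ x ∈ a, x < N)
    (h : φ.Holds N ((iterate r φ).apply ar N ρ) a) : (iterate r φ).apply ar N ρ r a := by
  change stage ar N r φ ρ (N ^ ar r) r a
  rw [← stage_stabilises]
  exact stage_succ.2 ⟨ha, haN, Or.inr h⟩

theorem apply_iterate_induction (Q : List ℕ → Prop)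
    (hQ : ∀ R : List ℕ → Prop, (∀ a, R a → Q a) → ∀ a, a.length = ar r → (∀ x ∈ a, x < N) →
      φ.Holds N (update ρ r R) a → Q a)
    (h : (iterate r φ).apply ar N ρ r a) : Q a := by
  change stage ar N r φ ρ (N ^ ar r) r a at h
  generalize N ^ ar r = m at h
  induction m generalizing a with
  | zero => exact absurd h not_stage_zero
  | succ m ih =>
    obtain ⟨ha, haN, h | h⟩ := stage_succ.1 h
    · exact ih h
    · rw [stage_eq_update] at h
      exact hQ _ (fun _ => ih) a ha haN h

end RelInstr

namespace StackProg

/-! ### The size of the universe -/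

/-- Double the unary number `a`, with `b` as a buffer. -/
def double (a b : Reg) : StackProg Reg :=
  .seq (forEach a (.seq (.push b true) (.push b true))) (transfer b a)

theorem polyExec_double {a b : Reg} (hab : a ≠ b) :
    PolyExec (double a b) fun N S S' => ∃ m ≤ N, S a = unary m ∧ S b = [] ∧
      S' = update S a (unary (2 * m)) := by
  refine ((((PolyExec.push b true).seq (PolyExec.push b true)).forEach (k := a) 1).seq
    (PolyExec.transfer hab.symm 2)).mono ?_
  rintro N hN S _ ⟨m, hm, ha, hb, rfl⟩
  refine ⟨_, ⟨m, by simpa, fun j => update S b (unary (2 * (m - j))), ?_, rfl, fun j hj => ?_⟩,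
    ?_, ?_⟩
  · funext i
    grind [update_apply]
  · have hstep : 2 * (m - j) = 2 * (m - (j + 1)) + 1 + 1 := by omega
    refine ⟨_, rfl, ?_⟩
    simp only [unary, hstep, List.replicate_succ]
    funext i
    grind [update_apply]
  · simp only [tsub_zero, ne_eq, hab.symm, not_false_eq_true, update_of_ne, update_self,
      List.length_replicate]
    nlinarith
  · funext i
    grind [update_apply, List.reverse_replicate]

/-- Move the leading ones of the input to `tmp`, and run `c` after every move. -/
def moveOnes (c : StackProg Reg) : StackProg Reg := .loop topTrue .input (.seq (.mv .input .tmp) c)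

/-- The stores `G j` describe the situation before the last `j` moves, up to `input` and `tmp`. -/
theorem PolyExec.moveOnes {c : StackProg Reg} {P : ℕ → StackStore Reg → StackStore Reg → Prop}
    (h : PolyExec c P) :
    PolyExec (moveOnes c) fun N S S' => ∃ m ≤ N, ∃ l l', ∃ G : ℕ → StackStore Reg,
      S = update (update (G m) .input (unary m ++ false :: l)) .tmp l' ∧
      S' = update (update (G 0) .input (false :: l)) .tmp (unary m ++ l') ∧
      ∀ j < m,
        P N (update (update (G (j + 1)) .input (unary j ++ false :: l)) .tmp (unary (m - j) ++ l'))
          (update (update (G j) .input (unary j ++ false :: l)) .tmp (unary (m - j) ++ l')) := by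
  refine (((PolyExec.mv (k := Reg.input) (k' := .tmp) (by simp)).seq h).loop 1).mono ?_
  rintro N - _ _ ⟨m, hm, l, l', G, rfl, rfl, hG⟩
  refine ⟨m, by simpa, fun j => update (update (G j) .input (unary j ++ false :: l)) .tmp
    (unary (m - j) ++ l'), by simp, by simp, by simp [topTrue], fun j hj => ⟨?_, _, rfl, ?_⟩⟩
  · simp [topTrue, List.replicate_succ]
  · have hstep : m - j = m - (j + 1) + 1 := by omega
    convert hG j hj using 1
    simp only [unary, hstep, List.replicate_succ]
    funext i
    grind [update_apply]

/-- Move the leading ones of the input and the zero after them to `tmp`. -/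
def skipField : StackProg Reg := .seq (moveOnes .skip) (.mv .input .tmp)

theorem polyExec_skipField :
    PolyExec skipField fun N S S' => ∃ n ≤ N, ∃ S₀ l l',
      S = update (update S₀ .input (unary n ++ false :: l)) .tmp l' ∧
      S' = update (update S₀ .input l) .tmp (false :: (unary n ++ l')) := by
  refine (PolyExec.skip.moveOnes.seq (PolyExec.mv (k := Reg.input) (k' := .tmp) (by simp))).mono ?_
  rintro N - _ _ ⟨n, hn, S₀, l, l', rfl, rfl⟩
  refine ⟨_, ⟨n, hn, l, l', fun _ => S₀, rfl, rfl, fun _ _ => rfl⟩, ?_⟩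
  funext i
  grind [update_apply]

/-- Move the leading ones of the input to `tmp`, and compute `2 ^ (t + 1)` in the accumulator, where
`t` is their number. -/
def powField : StackProg Reg :=
  .seq (.push .acc true) (.seq (.push .acc true) (moveOnes (double .acc .aux)))

theorem polyExec_powField :
    PolyExec powField fun N S S' => ∃ t, 2 ^ (t + 1) ≤ N ∧ ∃ S₀ l l', S₀ .acc = [] ∧ S₀ .aux = [] ∧
      S = update (update S₀ .input (unary t ++ false :: l)) .tmp l' ∧
      S' = update (update (update S₀ .acc (unary (2 ^ (t + 1)))) .input (false :: l)) .tmp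
        (unary t ++ l') := by
  refine ((PolyExec.push _ _).seq ((PolyExec.push _ _).seq
    (polyExec_double (a := .acc) (b := .aux) (by simp)).moveOnes)).mono ?_
  rintro N - _ _ ⟨t, ht, S₀, l, l', hacc, haux, rfl, rfl⟩
  refine ⟨_, rfl, _, rfl, t, ?_, l, l', fun j => update S₀ .acc (unary (2 ^ (t - j + 1))), ?_,
    by simp, fun j hj => ⟨2 ^ (t - (j + 1) + 1), ?_, by simp, by simp [haux], ?_⟩⟩
  · exact (Nat.lt_two_pow_self.le.trans (Nat.pow_le_pow_right two_pos t.le_succ)).trans ht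
  · simp only [Nat.sub_self, zero_add, pow_one, unary, List.replicate_succ, List.replicate_zero]
    funext i
    grind [update_apply]
  · exact (Nat.pow_le_pow_right two_pos (by omega)).trans ht
  · rw [← pow_succ', show t - (j + 1) + 1 = t - j by omega]
    funext i
    by_cases hi : i = .tmp <;> by_cases hi' : i = .input <;> by_cases hi'' : i = .acc <;>
      simp [*]

/-- Double the size of the universe as often as the number in the accumulator says. -/
def doubleSize : StackProg Reg := forEach .acc (double .size .aux)

theorem polyExec_doubleSize :
    PolyExec doubleSize fun N S S' => ∃ m a, 0 < m ∧ m * 2 ^ a ≤ N ∧ S .size = unary m ∧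
      S .acc = unary a ∧ S .aux = [] ∧
      S' = update (update S .acc []) .size (unary (m * 2 ^ a)) := by
  refine ((polyExec_double (a := .size) (b := .aux) (by simp)).forEach 1).mono ?_
  rintro N - S _ ⟨m, a, hm, hN, hsize, hacc, haux, rfl⟩
  refine ⟨a, ?_, fun j => update S .size (unary (m * 2 ^ (a - j))), ?_, ?_,
    fun j hj => ⟨m * 2 ^ (a - (j + 1)), ?_, by simp, by simp [haux], ?_⟩⟩
  · rw [pow_one]
    exact Nat.lt_two_pow_self.le.trans ((Nat.le_mul_of_pos_left _ hm).trans hN)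
  · simp [← hsize, ← hacc]
  · rw [update_comm (by simp)]
    rfl
  · exact (Nat.mul_le_mul_left m (Nat.pow_le_pow_right two_pos (by omega))).trans hN
  · rw [mul_left_comm, ← pow_succ', show a - (j + 1) + 1 = a - j by omega]
    funext i
    by_cases hi : i = .size <;> by_cases hi' : i = .acc <;> simp [*]

/-- For an input with first fields `n` and `t` in unary, compute the size `N = l * 2 ^ 2 ^ (t + 1)`
of the universe, where `l` is the length of the input, and move the input to the table of the
relation `0`. -/
def setup : StackProg Reg :=
  .seq (copyTo .input .tmp .size) <| .seq skipField <| .seq powField <| .seq doubleSize <|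
  .seq (transfer .input .tmp) (transfer .tmp (.rel 0))

theorem polyExec_setup :
    PolyExec setup fun N S S' => ∃ n t y x,
      x = unary n ++ false :: (unary t ++ false :: y) ∧ N = x.length * 2 ^ 2 ^ (t + 1) ∧
      S = ioStore .input x ∧ S' = update (ioStore .size (unary N)) (.rel 0) x := by
  refine ((PolyExec.copyTo (x := Reg.input) (tmp := .tmp) (k := .size) (by simp) (by simp)
    (by simp) 1).seq (polyExec_skipField.seq (polyExec_powField.seq (polyExec_doubleSize.seq
    ((PolyExec.transfer (k := Reg.input) (k' := .tmp) (by simp) 1).seq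
      (PolyExec.transfer (k := Reg.tmp) (k' := .rel 0) (by simp) 1)))))).mono ?_
  rintro N - _ _ ⟨n, t, y, x, hx, hN, rfl, rfl⟩
  have hlen : x.length = n + (t + y.length) + 2 := by
    simp [hx]
    omega
  have hxN : x.length ≤ N := hN ▸ Nat.le_mul_of_pos_right _ (by positivity)
  have htN : 2 ^ (t + 1) ≤ N :=
    Nat.lt_two_pow_self.le.trans (hN ▸ Nat.le_mul_of_pos_left _ (by omega))
  have hrev : ((false :: y).reverse ++ (unary t ++ false :: unary n)).reverse = x := by
    simp [hx]
  let S₀ : StackStore Reg := ioStore .size (unary x.length)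
  refine ⟨update S₀ .input x, ⟨by simpa [ioStore], by simp [ioStore], ?_⟩,
    _, ⟨n, by omega, S₀, unary t ++ false :: y, [], ?_, rfl⟩,
    _, ⟨t, htN, S₀, y, false :: unary n, by simp [S₀, ioStore], by simp [S₀, ioStore], ?_,
      rfl⟩,
    _, ⟨x.length, 2 ^ (t + 1), by omega, hN.ge, by simp [S₀, ioStore], by simp,
      by simp [S₀, ioStore], rfl⟩,
    _, ⟨?_, rfl⟩, ?_, ?_⟩
  · simp [S₀, ioStore, update_comm (show Reg.input ≠ .size by simp)]
  · have htmp : update S₀ .input x .tmp = [] := by simp [S₀, ioStore]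
    rw [← hx, ← htmp, update_eq_self]
  · simp
  · simp
    omega
  · simp
    omega
  · rw [← hN]
    funext i
    by_cases hi : i = .rel 0
    · subst hi
      simpa [S₀, ioStore] using hrev.symm
    · cases i <;> simp [S₀, ioStore, hi]

/-! ### Machines for definable problems -/

/-- Empty the tables of the relations in a list. -/
def clearTables : List ℕ → StackProg Reg
  | [] => .skip
  | r :: l => .seq (clear (.rel r)) (clearTables l)

theorem polyExec_clearTables (ar : ℕ → ℕ) (l : List ℕ) :
    PolyExec (clearTables l) fun N S S' => (∀ r ∈ l, (S (.rel r)).length ≤ N ^ ar r) ∧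
      (∀ r ∈ l, S' (.rel r) = []) ∧ ∀ k, (∀ r ∈ l, k ≠ .rel r) → S' k = S k := by
  induction l with
  | nil =>
    refine PolyExec.skip.mono ?_
    rintro N - S S' ⟨-, -, h⟩
    exact funext fun k => h k (by simp)
  | cons r l ih =>
    refine ((PolyExec.clear (.rel r) (ar r)).seq ih).mono ?_
    rintro N - S S' ⟨hl, hS', h⟩
    rw [List.forall_mem_cons] at hl hS'
    refine ⟨_, ⟨hl.1, rfl⟩, fun s hs => ?_, hS'.2, fun k hk => ?_⟩
    · by_cases hsr : s = r
      · simp [hsr]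
      · simpa [hsr] using hl.2 s hs
    · by_cases hkr : k = .rel r
      · simpa [hkr] using hS'.1
      · rw [update_of_ne hkr]
        exact h k (List.forall_mem_cons.2 ⟨hkr, hk⟩)

/-- The relations at the start: the relation `0` tells the positions of the ones of the input. -/
def inputRel (x : List Bool) : RelStore := fun r a => r = 0 ∧ x.getD (a.headD 0) false = true

theorem represents_inputRel {ar : ℕ → ℕ} {N : ℕ} {x : List Bool} (h0 : ar 0 = 1)
    (hx : x.length ≤ N) :
    Represents ar N (inputRel x) [] (update (ioStore .size (unary N)) (.rel 0) x) where
  size := by simp [ioStore]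
  acc := by simp [ioStore]
  aux := by simp [ioStore]
  tmp := by simp [ioStore]
  var i := by simp [ioStore]
  env_lt := by simp
  table r args hr _ := by
    by_cases h : r = 0
    · subst h
      obtain ⟨i, rfl⟩ := List.length_eq_one_iff.1 (hr.trans h0)
      simp [inputRel, tuplePos]
    · simp [inputRel, h, ioStore]
  length_le r := by
    by_cases h : r = 0
    · subst h
      simpa [h0] using hx
    · simp [h, ioStore]

theorem Represents.head?_rel {ar : ℕ → ℕ} {N r : ℕ} {ρ : RelStore} {env : List ℕ}
    {S : StackStore Reg} (h : Represents ar N ρ env S) (hr : ar r = 0) :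
    (S (.rel r)).head?.getD false = true ↔ ρ r [] := by
  rw [← h.table r [] (by simp [hr]) (by simp)]
  simp [tuplePos, List.getD_eq_getElem?_getD, List.head?_eq_getElem?]

/-- Compute the relations, and output whether the relation `r` of arity `0` holds. -/
def decider (ar : ℕ → ℕ) (P : List RelInstr) (r : ℕ) : StackProg Reg :=
  .seq setup <| .seq (ofInstrs ar P) <| .seq (pushTop (.rel r)) <| .seq (.mv .res .input) <|
  .seq (clearTables (0 :: P.map RelInstr.target)) (clear .size)

open Classical in
theorem polyExec_decider {ar : ℕ → ℕ} {P : List RelInstr} (hP : ∀ I ∈ P, I.WF ar) {r : ℕ}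
    (h0 : ar 0 = 1) (hr : ar r = 0) :
    PolyExec (decider ar P r) fun N S S' => ∃ n t y x,
      x = unary n ++ false :: (unary t ++ false :: y) ∧ N = x.length * 2 ^ 2 ^ (t + 1) ∧
      S = ioStore .input x ∧ S' = ioStore .input
        [decide (P.foldl (fun ρ I => I.apply ar N ρ) (inputRel x) r [])] := by
  refine (polyExec_setup.seq ((polyExec_ofInstrs hP).seq ((polyExec_pushTop (.rel r)).seq
    ((PolyExec.mv (k := Reg.res) (k' := .input) (by simp)).seq
      ((polyExec_clearTables ar _).seq (PolyExec.clear .size 1)))))).mono ?_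
  rintro N - _ _ ⟨n, t, y, x, hx, hN, rfl, rfl⟩
  have hxN : x.length ≤ N := hN ▸ Nat.le_mul_of_pos_right _ (by positivity)
  have hS := represents_inputRel h0 hxN
  let S₁ : StackStore Reg := update (ioStore .size (unary N)) (.rel 0) x
  let S₂ := storeAfter ar N P (inputRel x) S₁
  have hR : Represents ar N (P.foldl (fun ρ I => I.apply ar N ρ) (inputRel x)) [] S₂ :=
    hS.storeAfter
  have hS₂ : ∀ k, (∀ s ∈ 0 :: P.map RelInstr.target, k ≠ .rel s) →
      S₂ k = ioStore .size (unary N) k := fun k hk => by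
    rw [List.forall_mem_cons, List.forall_mem_map] at hk
    exact (storeAfter_of_ne hk.2).trans (update_of_ne hk.1 _ _)
  generalize hb : decide (P.foldl (fun ρ I => I.apply ar N ρ) (inputRel x) r []) = b
  have htop : (S₂ (.rel r)).head?.getD false = b := by
    rw [← hb, Bool.eq_iff_iff, decide_eq_true_iff, hR.head?_rel hr]
  refine ⟨_, ⟨n, t, y, x, hx, hN, rfl, rfl⟩, S₂, ⟨_, hS, ?_, ?_, rfl⟩, _, rfl, _, rfl,
    update (ioStore .size (unary N)) .input [b], ⟨fun s _ => ?_, ?_, fun k hk => ?_⟩, ?_, ?_⟩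
  · simp [ioStore]
  · simp [ioStore]
  · simpa using hR.length_le s
  · simp [ioStore]
  · have hres : S₂ .res = [] := hS₂ _ (by simp)
    have hinput : S₂ .input = [] := hS₂ _ (by simp)
    have := hS₂ k hk
    grind [update_apply, ioStore]
  · simp [ioStore]
  · funext i
    cases i <;> simp [ioStore]

end StackProg

/-! ### Fixed-parameter tractability of definable problems -/

theorem computable_two_mul_two_pow_two_pow_pow (e : ℕ) :
    Computable fun t : ℕ => 2 * (2 ^ 2 ^ (t + 1)) ^ e := by
  have hpow : Primrec₂ fun m n : ℕ => m ^ n := Primrec₂.unpaired'.1 Nat.Primrec.pow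
  have htwo : Primrec fun _ : ℕ => 2 := Primrec.const 2
  exact (Primrec.nat_mul.comp htwo (hpow.comp
    (hpow.comp htwo (hpow.comp htwo Primrec.succ)) (Primrec.const e))).to_comp

theorem inFPT_of_relProgram {α : Type} {enc : α → List Bool} {κ : α → ℕ} {L : Set α}
    {ar : ℕ → ℕ} {P : List RelInstr} {r : ℕ} (h0 : ar 0 = 1) (hr : ar r = 0)
    (hP : ∀ I ∈ P, I.WF ar)
    (henc : ∀ a, ∃ n y, enc a =
      List.replicate n true ++ false :: (List.replicate (κ a) true ++ false :: y))
    (hL : ∀ a, P.foldl (fun ρ I => I.apply ar ((enc a).length * 2 ^ 2 ^ (κ a + 1)) ρ)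
      (StackProg.inputRel (enc a)) r [] ↔ a ∈ L) : InFPT enc κ L := by
  classical
  obtain ⟨e, he⟩ := StackProg.polyExec_decider hP h0 hr
  refine ⟨(StackProg.decider ar P r).machineAux .input, _, e,
    computable_two_mul_two_pow_two_pow_pow e, fun a => ⟨_, decide_eq_true_iff.trans (hL a), ?_⟩⟩
  obtain ⟨n, y, hx⟩ := henc a
  set N := (enc a).length * 2 ^ 2 ^ (κ a + 1) with hN
  have hlen : 2 ≤ (enc a).length := by
    simp only [hx, List.length_append, List.length_cons]
    omega
  have hN2 : 2 ≤ N := hlen.trans (Nat.le_mul_of_pos_right _ (by positivity))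
  have hexec := he N hN2 _ _ ⟨n, κ a, y, enc a, hx, hN, rfl, rfl⟩
  have hpos : 0 < N ^ e := by positivity
  have htime : 2 * (2 ^ 2 ^ (κ a + 1)) ^ e * (enc a).length ^ e = 2 * N ^ e - 1 + 1 := by
    rw [Nat.sub_add_cancel (by omega), hN, mul_pow]
    ring
  rw [htime]
  exact (hexec.weaken (Nat.le_sub_one_of_lt (by omega))).outputs

/-! ### Plays and strategies -/

namespace GameArena

section Arena

variable {V : Type*} (G : GameArena V)

theorem owner_eq_zero_or_one (v : V) : G.owner v = 0 ∨ G.owner v = 1 := by omega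

theorem owner_ne_one_iff {v : V} : ¬ G.owner v = 1 ↔ G.owner v = 0 := by omega

theorem length_pref (ρ : ℕ → V) (j : ℕ) : (pref ρ j).length = j + 1 := by simp [pref]

theorem getLast?_pref (ρ : ℕ → V) (j : ℕ) : (pref ρ j).getLast? = some (ρ j) := by
  simp [pref, List.range_succ]

theorem pref_congr {ρ ρ' : ℕ → V} {j : ℕ} (h : ∀ k ≤ j, ρ k = ρ' k) : pref ρ j = pref ρ' j :=
  List.map_congr_left fun k hk => h k (Nat.lt_succ_iff.1 (List.mem_range.1 hk))

theorem pref_succ_eq_cons (ρ : ℕ → V) (j : ℕ) :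
    pref ρ (j + 1) = ρ 0 :: pref (fun k => ρ (k + 1)) j := by
  simp [pref, List.range_succ_eq_map (n := j + 1), Function.comp_def]

theorem exists_pref_eq_cons (ρ : ℕ → V) (j : ℕ) : ∃ l, pref ρ j = ρ 0 :: l := by
  cases j with
  | zero => exact ⟨[], rfl⟩
  | succ j => exact ⟨_, pref_succ_eq_cons ρ j⟩

/-- All moves follow edges, also after paths that do not start in the initial vertex. Strategies
that play from an arbitrary vertex are represented by such functions. -/
def Legal (τ : List V → V) : Prop := ∀ (h : List V) (hne : h ≠ []), (h.getLast hne, τ h) ∈ G.E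

variable {G} in
/-- The strategy of Player `i` in the arena that makes the moves of a legal function. -/
def Legal.toStrategy {τ : List V → V} (hτ : G.Legal τ) (i : Fin 2) : G.Strategy i :=
  ⟨τ, fun h v _ _ => by simpa using hτ (h ++ [v]) (by simp)⟩

/-- Some successor of a vertex. -/
noncomputable def someSucc (v : V) : V := (G.exists_succ v).choose

theorem someSucc_mem (v : V) : (v, G.someSucc v) ∈ G.E := (G.exists_succ v).choose_spec

/-- The moves to some successor of the last vertex. -/
noncomputable def anyMove (h : List V) : V := G.someSucc (h.getLast?.getD G.init)

theorem legal_anyMove : G.Legal G.anyMove := by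
  intro h hne
  rw [anyMove, List.getLast?_eq_getLast_of_ne_nil hne]
  exact G.someSucc_mem _

variable {G} in
theorem exists_legal_forall {ι : Type*} {p : ι → Prop} {Q : ι → (List V → V) → Prop}
    (h : ∀ i, p i → ∃ τ, G.Legal τ ∧ Q i τ) :
    ∃ τ : ι → List V → V, (∀ i, G.Legal (τ i)) ∧ ∀ i, p i → Q i (τ i) := by
  have hex : ∀ i, ∃ τ, G.Legal τ ∧ (p i → Q i τ) := fun i => by
    by_cases hi : p i
    · exact (h i hi).imp fun τ hτ => ⟨hτ.1, fun _ => hτ.2⟩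
    · exact ⟨_, G.legal_anyMove, fun hp => absurd hp hi⟩
  choose τ hτ hQ using hex
  exact ⟨τ, hτ, hQ⟩

/-- The infinite paths from `v` in which Player 0 makes the moves of `τ`. -/
structure LocalPlay (τ : List V → V) (v : V) (ρ : ℕ → V) : Prop where
  zero : ρ 0 = v
  mem_edges : ∀ j, (ρ j, ρ (j + 1)) ∈ G.E
  consistent : ∀ j, G.owner (ρ j) = 0 → ρ (j + 1) = τ (pref ρ j)

/-- Prepend a vertex to a sequence. -/
def consSeq (v : V) (ρ : ℕ → V) : ℕ → V
  | 0 => v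
  | k + 1 => ρ k

theorem exists_localPlay {τ : List V → V} (hτ : G.Legal τ) (v : V) : ∃ ρ, G.LocalPlay τ v ρ := by
  let H : GameArena V := { G with init := v }
  have hσ : H.Legal τ := hτ
  obtain ⟨ρ, ⟨h₁, h₂, -⟩, -⟩ :=
    existsUnique_isOutcome (hσ.toStrategy 0) (H.legal_anyMove.toStrategy 1)
  exact ⟨ρ, h₁.1, h₁.2, h₂⟩

variable {G} {τ τ' : List V → V} {v u : V} {ρ : ℕ → V}

theorem LocalPlay.edge (h : G.LocalPlay τ v ρ) : (v, ρ 1) ∈ G.E := h.zero ▸ h.mem_edges 0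

theorem LocalPlay.apply_one (h : G.LocalPlay τ v ρ) (hv : G.owner v = 0) : ρ 1 = τ [v] := by
  rw [h.consistent 0 (h.zero.symm ▸ hv), ← h.zero]
  rfl

theorem LocalPlay.congr (h : G.LocalPlay τ v ρ) (hτ : ∀ l, τ (v :: l) = τ' (v :: l)) :
    G.LocalPlay τ' v ρ := by
  refine ⟨h.zero, h.mem_edges, fun j hj => ?_⟩
  obtain ⟨l, hl⟩ := exists_pref_eq_cons ρ j
  rw [h.consistent j hj, hl, h.zero, hτ]

theorem LocalPlay.shift (h : G.LocalPlay τ v ρ) (hτ : ∀ l, τ (v :: ρ 1 :: l) = τ' (ρ 1 :: l)) :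
    G.LocalPlay τ' (ρ 1) fun k => ρ (k + 1) := by
  refine ⟨rfl, fun j => h.mem_edges (j + 1), fun j hj => ?_⟩
  obtain ⟨l, hl⟩ := exists_pref_eq_cons (fun k => ρ (k + 1)) j
  rw [h.consistent (j + 1) hj, pref_succ_eq_cons, h.zero, hl, hτ]

theorem LocalPlay.cons (h : G.LocalPlay τ' u ρ) (hE : (v, u) ∈ G.E)
    (h₀ : G.owner v = 0 → u = τ [v]) (hτ : ∀ l, τ (v :: u :: l) = τ' (u :: l)) :
    G.LocalPlay τ v (consSeq v ρ) where
  zero := rfl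
  mem_edges
    | 0 => (h.zero ▸ hE : (v, ρ 0) ∈ G.E)
    | j + 1 => h.mem_edges j
  consistent
    | 0, hj => h.zero.trans (h₀ hj)
    | j + 1, hj => by
      obtain ⟨l, hl⟩ := exists_pref_eq_cons ρ j
      change ρ (j + 1) = τ (pref (consSeq v ρ) (j + 1))
      rw [pref_succ_eq_cons]
      change _ = τ (v :: pref ρ j)
      rw [h.consistent j hj, hl, h.zero, hτ]

theorem exists_legal_zero (hv : G.owner v = 0) (hE : (v, u) ∈ G.E) (hτ' : G.Legal τ') :
    ∃ τ, G.Legal τ ∧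
      (∀ ρ, G.LocalPlay τ v ρ → ρ 1 = u ∧ G.LocalPlay τ' u fun k => ρ (k + 1)) ∧
      ∀ ρ, G.LocalPlay τ' u ρ → G.LocalPlay τ v (consSeq v ρ) := by
  classical
  let τ : List V → V
    | [] => v
    | [w] => if w = v then u else G.someSucc w
    | _ :: w :: l => τ' (w :: l)
  have hu : τ [v] = u := if_pos rfl
  have hτ : G.Legal τ := fun h hne => match h, hne with
    | [w], _ => by
      change (w, if w = v then u else G.someSucc w) ∈ G.E
      split_ifs with hw
      · exact hw ▸ hE
      · exact G.someSucc_mem w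
    | _ :: w :: l, _ => hτ' (w :: l) (by simp)
  refine ⟨τ, hτ, fun ρ hρ => ?_, fun ρ hρ => hρ.cons hE (fun _ => hu.symm) fun _ => rfl⟩
  have h1 : ρ 1 = u := (hρ.apply_one hv).trans hu
  exact ⟨h1, h1 ▸ hρ.shift fun l => rfl⟩

theorem exists_legal_one (hv : G.owner v = 1) {τ' : V → List V → V}
    (hτ' : ∀ u, G.Legal (τ' u)) : ∃ τ, G.Legal τ ∧
      (∀ ρ, G.LocalPlay τ v ρ → G.LocalPlay (τ' (ρ 1)) (ρ 1) fun k => ρ (k + 1)) ∧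
      ∀ u, (v, u) ∈ G.E → ∀ ρ, G.LocalPlay (τ' u) u ρ → G.LocalPlay τ v (consSeq v ρ) := by
  let τ : List V → V
    | [] => v
    | [w] => G.someSucc w
    | _ :: w :: l => τ' w (w :: l)
  have hτ : G.Legal τ := fun h hne => match h, hne with
    | [w], _ => G.someSucc_mem w
    | _ :: w :: l, _ => hτ' w (w :: l) (by simp)
  have hv0 : G.owner v ≠ 0 := by omega
  exact ⟨τ, hτ, fun ρ hρ => hρ.shift fun l => rfl,
    fun u hu ρ hρ => hρ.cons hu (fun h => absurd h hv0) fun _ => rfl⟩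

end Arena

/-! ### Deviations of Player 1 from a play -/

section Deviation

variable {V : Type*} {G : GameArena V} {σ₀ : G.Strategy 0} {ρ : ℕ → V} {β : List V → V}

open Classical in
/-- The strategy of Player 1 that follows the play `ρ` up to position `j` and then makes the moves
of `β`. -/
noncomputable def deviation (hρ : G.IsPlay ρ) (j : ℕ) (hβ : G.Legal β) : G.Strategy 1 where
  move h := if ∃ k < j, h = pref ρ k then ρ h.length else β h
  legal h v _ _ := by
    split_ifs with hk
    · obtain ⟨k, -, hk⟩ := hk
      have hv : v = ρ k := by
        simpa only [List.getLast?_concat, getLast?_pref, Option.some.injEq]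
          using congrArg List.getLast? hk
      rw [hk, length_pref, hv]
      exact hρ.2 k
    · exact (hβ.toStrategy 1).legal h v ‹_› ‹_›

theorem deviation_move_pref (hρ : G.IsPlay ρ) {j k : ℕ} (hk : k < j) (hβ : G.Legal β) :
    (deviation hρ j hβ).move (pref ρ k) = ρ (k + 1) :=
  (if_pos ⟨k, hk, rfl⟩).trans (by rw [length_pref])

theorem deviation_move_of_le (hρ : G.IsPlay ρ) {j k : ℕ} (hk : j ≤ k) (hβ : G.Legal β)
    (ρ' : ℕ → V) : (deviation hρ j hβ).move (pref ρ' k) = β (pref ρ' k) := by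
  refine if_neg ?_
  rintro ⟨m, hm, he⟩
  have hlen := congrArg List.length he
  rw [length_pref, length_pref] at hlen
  omega

theorem exists_isOutcome_extend (hρ : ρ ∈ σ₀.plays) (j : ℕ) (hβ : G.Legal β) :
    ∃ (σ₁ : G.Strategy 1) (ρ' : ℕ → V), IsOutcome σ₀ σ₁ ρ' ∧ (∀ k ≤ j, ρ' k = ρ k) ∧
      ∀ k ≥ j, G.owner (ρ' k) = 1 → ρ' (k + 1) = β (pref ρ' k) := by
  obtain ⟨ρ', hρ', -⟩ := existsUnique_isOutcome σ₀ (deviation hρ.1 j hβ)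
  refine ⟨_, ρ', hρ', fun k => ?_, fun k hk h1 => ?_⟩
  · induction k using Nat.strong_induction_on with
    | _ k ih =>
      intro hk
      cases k with
      | zero => exact hρ'.1.1.trans hρ.1.1.symm
      | succ k =>
        have hpref : pref ρ' k = pref ρ k := pref_congr fun m hm => ih m (by omega) (by omega)
        have hlast : ρ' k = ρ k := ih k (by omega) (by omega)
        rcases G.owner_eq_zero_or_one (ρ k) with h0 | h1
        · rw [hρ'.2.1 k (hlast ▸ h0), hρ.2 k h0, hpref]
        · rw [hρ'.2.2 k (hlast ▸ h1), hpref, deviation_move_pref hρ.1 hk]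
  · rw [hρ'.2.2 k h1, deviation_move_of_le hρ.1 hk]

theorem exists_play_extend (hρ : ρ ∈ σ₀.plays) {j : ℕ} (h1 : G.owner (ρ j) = 1) {u : V}
    (hu : (ρ j, u) ∈ G.E) : ∃ ρ' ∈ σ₀.plays, (∀ k ≤ j, ρ' k = ρ k) ∧ ρ' (j + 1) = u := by
  classical
  let β : List V → V := fun h => if h.getLast? = some (ρ j) then u else G.anyMove h
  have hβ : G.Legal β := by
    intro h hne
    simp only [β]
    split_ifs with hl
    · rw [List.getLast?_eq_getLast_of_ne_nil hne] at hl
      rwa [Option.some.inj hl]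
    · exact G.legal_anyMove h hne
  obtain ⟨σ₁, ρ', hρ', hag, hmove⟩ := exists_isOutcome_extend hρ j hβ
  refine ⟨ρ', ⟨hρ'.1, hρ'.2.1⟩, hag, ?_⟩
  rw [hmove j le_rfl (by rwa [hag j le_rfl])]
  exact if_pos (by rw [getLast?_pref, hag j le_rfl])

end Deviation

end GameArena

/-! ### An inductive characterization of the games with a solution -/

namespace ReachSPGame

open GameArena

/-- Comparison of the payoffs that belong to sets of colours: the colour `0` does not count. -/
def PayLE (p q : Set ℕ) : Prop := ∀ i ≠ 0, i ∈ p → i ∈ q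

theorem payLE_of_subset {p q : Set ℕ} (h : p ⊆ q) : PayLE p q := fun _ _ hi => h hi

theorem PayLE.trans {p q r : Set ℕ} (hpq : PayLE p q) (hqr : PayLE q r) : PayLE p r :=
  fun i hi hp => hqr i hi (hpq i hi hp)

/-- The payoff of `c` is strictly smaller than that of some element of `W`. -/
def Below (W : Set (Set ℕ)) (c : Set ℕ) : Prop := ∃ p ∈ W, PayLE c p ∧ ¬ PayLE p c

theorem Below.of_subset {W : Set (Set ℕ)} {c d : Set ℕ} (h : Below W d) (hcd : c ⊆ d) :
    Below W c := by
  obtain ⟨p, hp, hdp, hpd⟩ := h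
  exact ⟨p, hp, (payLE_of_subset hcd).trans hdp, fun hpc => hpd (hpc.trans (payLE_of_subset hcd))⟩

variable {V : Type*} {t : ℕ} (g : ReachSPGame V t)

/-- The colours of a vertex: `0` for the target of Player 0, and `i + 1` for the target `i` of
Player 1. -/
def colours (v : V) : Set ℕ :=
  {i | (i = 0 ∧ v ∈ g.target₀) ∨ ∃ j : Fin t, i = j + 1 ∧ v ∈ g.target j}

theorem zero_mem_colours {v : V} : 0 ∈ g.colours v ↔ v ∈ g.target₀ := by simp [colours]

theorem succ_mem_colours {v : V} {i : Fin t} : (i : ℕ) + 1 ∈ g.colours v ↔ v ∈ g.target i := by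
  simp [colours, Fin.val_inj]

theorem le_of_mem_colours {v : V} {i : ℕ} (h : i ∈ g.colours v) : i ≤ t := by
  rcases h with ⟨rfl, -⟩ | ⟨j, rfl, -⟩ <;> omega

/-- Player 0 can force a visit to the target of Player 0 from `v` when `c` is the set of the colours
seen so far. -/
inductive Attr : V → Set ℕ → Prop where
  | base {v c} : 0 ∈ c → Attr v c
  | zero {v c u} : g.arena.owner v = 0 → (v, u) ∈ g.arena.E → Attr u (c ∪ g.colours u) → Attr v c
  | one {v c} : g.arena.owner v = 1 → (∀ u, (v, u) ∈ g.arena.E → Attr u (c ∪ g.colours u)) →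
      Attr v c

/-- Player 1 can avoid the target of Player 0 with a payoff that is not below `W`. -/
inductive Lose (W : Set (Set ℕ)) : V → Set ℕ → Prop where
  | base {v c} : ¬ g.Attr v c → ¬ Below W c → Lose W v c
  | zero {v c} : ¬ g.Attr v c → g.arena.owner v = 0 →
      (∀ u, (v, u) ∈ g.arena.E → Lose W u (c ∪ g.colours u)) → Lose W v c
  | one {v c u} : ¬ g.Attr v c → g.arena.owner v = 1 → (v, u) ∈ g.arena.E →
      Lose W u (c ∪ g.colours u) → Lose W v c

/-- Player 0 can allow plays with at least the payoffs in `S`, and ensure that all plays visit the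
target of Player 0 or have a payoff below `W`. In the rule `one`, the payoffs in `S` are distributed
among the successors. -/
inductive Good (W : Set (Set ℕ)) : V → Set ℕ → Set (Set ℕ) → Prop where
  | leaf {v c S} : (∀ p ∈ S, PayLE p c) → ¬ g.Lose W v c → Good W v c S
  | zero {v c S u} : g.arena.owner v = 0 → (v, u) ∈ g.arena.E → Good W u (c ∪ g.colours u) S →
      Good W v c S
  | one {v c S} (F : V → Set (Set ℕ)) : g.arena.owner v = 1 →
      (∀ p ∈ S, ∃ u, (v, u) ∈ g.arena.E ∧ p ∈ F u) →
      (∀ u, (v, u) ∈ g.arena.E → F u ⊆ S) →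
      (∀ u, (v, u) ∈ g.arena.E → Good W u (c ∪ g.colours u) (F u)) → Good W v c S

/-- The colours seen up to position `j` on a sequence, where `c` are those of position `0`. -/
def seen (c : Set ℕ) (ρ : ℕ → V) : ℕ → Set ℕ
  | 0 => c
  | j + 1 => seen c ρ j ∪ g.colours (ρ (j + 1))

theorem seen_shift (c : Set ℕ) (ρ : ℕ → V) (j : ℕ) :
    g.seen (c ∪ g.colours (ρ 1)) (fun k => ρ (k + 1)) j = g.seen c ρ (j + 1) := by
  induction j with
  | zero => rfl
  | succ j ih => rw [seen, ih]; rfl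

theorem seen_consSeq (c : Set ℕ) (v : V) (ρ : ℕ → V) (j : ℕ) :
    g.seen c (consSeq v ρ) (j + 1) = g.seen (c ∪ g.colours (ρ 0)) ρ j :=
  (g.seen_shift c (consSeq v ρ) j).symm

theorem seen_congr {c : Set ℕ} {ρ ρ' : ℕ → V} {j : ℕ} (h : ∀ k ≤ j, ρ k = ρ' k) :
    g.seen c ρ j = g.seen c ρ' j := by
  induction j with
  | zero => rfl
  | succ j ih => rw [seen, seen, ih fun k hk => h k (by omega), h (j + 1) le_rfl]

theorem mem_seen {ρ : ℕ → V} {i j : ℕ} :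
    i ∈ g.seen (g.colours (ρ 0)) ρ j ↔ ∃ k ≤ j, i ∈ g.colours (ρ k) := by
  induction j with
  | zero => simp [seen]
  | succ j ih =>
    simp only [seen, Set.mem_union, ih, Nat.le_add_one_iff, or_and_right, exists_or,
      exists_eq_left]

/-! #### From good sets of payoffs to solutions -/

theorem Attr.exists_strategy {g : ReachSPGame V t} {v : V} {c : Set ℕ} (h : g.Attr v c) :
    ∃ τ, g.arena.Legal τ ∧ ∀ ρ, g.arena.LocalPlay τ v ρ → ∃ j, 0 ∈ g.seen c ρ j := by
  induction h with
  | base h => exact ⟨_, g.arena.legal_anyMove, fun ρ _ => ⟨0, h⟩⟩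
  | zero hv hE _ ih =>
    obtain ⟨τ', hτ', h⟩ := ih
    obtain ⟨τ, hτ, hshift, -⟩ := exists_legal_zero hv hE hτ'
    refine ⟨τ, hτ, fun ρ hρ => ?_⟩
    obtain ⟨rfl, hρ'⟩ := hshift ρ hρ
    obtain ⟨j, hj⟩ := h _ hρ'
    exact ⟨j + 1, by rwa [seen_shift] at hj⟩
  | one hv _ ih =>
    obtain ⟨τ', hτ', h⟩ := exists_legal_forall ih
    obtain ⟨τ, hτ, hshift, -⟩ := exists_legal_one hv hτ'
    refine ⟨τ, hτ, fun ρ hρ => ?_⟩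
    obtain ⟨j, hj⟩ := h _ hρ.edge _ (hshift ρ hρ)
    exact ⟨j + 1, by rwa [seen_shift] at hj⟩

theorem exists_attrMove : ∃ τ : V × Set ℕ → List V → V, (∀ s, g.arena.Legal (τ s)) ∧
    ∀ s, g.Attr s.1 s.2 → ∀ ρ, g.arena.LocalPlay (τ s) s.1 ρ → ∃ j, 0 ∈ g.seen s.2 ρ j :=
  exists_legal_forall (p := fun s : V × Set ℕ => g.Attr s.1 s.2)
    (Q := fun s τ => ∀ ρ, g.arena.LocalPlay τ s.1 ρ → ∃ j, 0 ∈ g.seen s.2 ρ j)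
    fun _ hs => Attr.exists_strategy hs

/-- Moves that force a visit to the target of Player 0 from `s.1` if possible, when the colours in
`s.2` have been seen. -/
noncomputable def attrMove : V × Set ℕ → List V → V := g.exists_attrMove.choose

open Classical in
/-- Stay outside of the losing states until the visit to the target of Player 0 can be forced. The
set `c` holds the colours seen at the first vertex of the list. -/
noncomputable def safeMove (W : Set (Set ℕ)) : Set ℕ → List V → V
  | _, [] => g.arena.init
  | c, [v] => if g.Attr v c then g.attrMove (v, c) [v]
      else if h : ∃ u, (v, u) ∈ g.arena.E ∧ ¬ g.Lose W u (c ∪ g.colours u) then h.choose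
      else g.arena.someSucc v
  | c, v :: u :: l => if g.Attr v c then g.attrMove (v, c) (v :: u :: l)
      else safeMove W (c ∪ g.colours u) (u :: l)

/-- The sequence visits the target of Player 0, or its payoff stays below `W`. -/
def Safe (W : Set (Set ℕ)) (c : Set ℕ) (ρ : ℕ → V) : Prop :=
  (∃ j, 0 ∈ g.seen c ρ j) ∨ ∀ j, Below W (g.seen c ρ j)

variable {g}

theorem legal_safeMove (W : Set (Set ℕ)) (c : Set ℕ) : g.arena.Legal (g.safeMove W c) := by
  have hattr := g.exists_attrMove.choose_spec.1
  intro h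
  induction h generalizing c with
  | nil => exact fun hne => absurd rfl hne
  | cons v l ih =>
    intro hne
    cases l with
    | nil =>
      simp only [safeMove]
      split_ifs with _ h
      · exact hattr (v, c) [v] hne
      · exact h.choose_spec.1
      · exact g.arena.someSucc_mem v
    | cons u l =>
      simp only [safeMove]
      split_ifs
      · exact hattr (v, c) _ hne
      · exact ih (c ∪ g.colours u) (List.cons_ne_nil _ _)

variable {W S : Set (Set ℕ)} {v : V} {c : Set ℕ} {ρ : ℕ → V}

theorem safe_of_shift (h : g.Safe W (c ∪ g.colours (ρ 1)) fun k => ρ (k + 1)) : g.Safe W c ρ := by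
  rcases h with ⟨j, hj⟩ | h
  · exact Or.inl ⟨j + 1, by rwa [seen_shift] at hj⟩
  · refine Or.inr fun j => ?_
    cases j with
    | zero => exact (h 0).of_subset Set.subset_union_left
    | succ j => exact g.seen_shift c ρ j ▸ h j

theorem Attr.exists_zero_mem_seen (hA : g.Attr v c)
    (hρ : g.arena.LocalPlay (g.safeMove W c) v ρ) : ∃ j, 0 ∈ g.seen c ρ j := by
  refine g.exists_attrMove.choose_spec.2 (v, c) hA ρ (hρ.congr fun l => ?_)
  cases l <;> simp only [safeMove, if_pos hA] <;> rfl

theorem localPlay_safeMove_shift (hA : ¬ g.Attr v c)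
    (hρ : g.arena.LocalPlay (g.safeMove W c) v ρ) :
    g.arena.LocalPlay (g.safeMove W (c ∪ g.colours (ρ 1))) (ρ 1) fun k => ρ (k + 1) :=
  hρ.shift fun l => by simp only [safeMove, if_neg hA]

theorem not_lose_safeMove (hA : ¬ g.Attr v c) (hl : ¬ g.Lose W v c)
    (hρ : g.arena.LocalPlay (g.safeMove W c) v ρ) : ¬ g.Lose W (ρ 1) (c ∪ g.colours (ρ 1)) := by
  rcases g.arena.owner_eq_zero_or_one v with h0 | h1
  · have hu : ∃ u, (v, u) ∈ g.arena.E ∧ ¬ g.Lose W u (c ∪ g.colours u) := by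
      by_contra! hu
      exact hl (.zero hA h0 hu)
    have hmove : ρ 1 = hu.choose := by
      simp only [hρ.apply_one h0, safeMove, if_neg hA, dif_pos hu]
    exact hmove ▸ hu.choose_spec.2
  · exact fun h => hl (.one hA h1 hρ.edge h)

theorem exists_zero_mem_seen_of_attr {j : ℕ} (hA : g.Attr (ρ j) (g.seen c ρ j))
    (hρ : g.arena.LocalPlay (g.safeMove W c) v ρ) : ∃ j, 0 ∈ g.seen c ρ j := by
  induction j generalizing v c ρ with
  | zero => exact Attr.exists_zero_mem_seen (hρ.zero ▸ hA) hρ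
  | succ j ih =>
    by_cases hv : g.Attr v c
    · exact hv.exists_zero_mem_seen hρ
    · obtain ⟨k, hk⟩ := ih (by rwa [seen_shift]) (localPlay_safeMove_shift hv hρ)
      exact ⟨k + 1, by rwa [seen_shift] at hk⟩

theorem below_seen_of_not_attr (hl : ¬ g.Lose W v c) (hA : ∀ j, ¬ g.Attr (ρ j) (g.seen c ρ j))
    (hρ : g.arena.LocalPlay (g.safeMove W c) v ρ) (j : ℕ) : Below W (g.seen c ρ j) := by
  have hv : ¬ g.Attr v c := hρ.zero ▸ hA 0
  induction j generalizing v c ρ with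
  | zero => exact by_contra fun hb => hl (.base hv hb)
  | succ j ih =>
    rw [← seen_shift]
    exact ih (not_lose_safeMove hv hl hρ) (fun k => by rw [seen_shift]; exact hA (k + 1))
      (localPlay_safeMove_shift hv hρ) (hA 1)

theorem safe_safeMove (hl : ¬ g.Lose W v c) (hρ : g.arena.LocalPlay (g.safeMove W c) v ρ) :
    g.Safe W c ρ := by
  by_cases hex : ∃ j, g.Attr (ρ j) (g.seen c ρ j)
  · exact Or.inl (exists_zero_mem_seen_of_attr hex.choose_spec hρ)
  · exact Or.inr (below_seen_of_not_attr hl (not_exists.1 hex) hρ)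

theorem Good.exists_strategy (h : g.Good W v c S) : ∃ τ, g.arena.Legal τ ∧
    (∀ ρ, g.arena.LocalPlay τ v ρ → g.Safe W c ρ) ∧
      ∀ p ∈ S, ∃ ρ, g.arena.LocalPlay τ v ρ ∧ ∃ j, PayLE p (g.seen c ρ j) := by
  induction h with
  | leaf hS hl =>
    have hτ := legal_safeMove (g := g)
    refine ⟨_, hτ W _, fun ρ => safe_safeMove hl, fun p hp => ?_⟩
    exact (g.arena.exists_localPlay (hτ W _) _).imp fun ρ hρ => ⟨hρ, 0, hS p hp⟩
  | zero hv hE _ ih =>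
    obtain ⟨τ', hτ', hsafe, hS⟩ := ih
    obtain ⟨τ, hτ, hshift, hcons⟩ := exists_legal_zero hv hE hτ'
    refine ⟨τ, hτ, fun ρ hρ => ?_, fun p hp => ?_⟩
    · obtain ⟨rfl, hρ'⟩ := hshift ρ hρ
      exact safe_of_shift (hsafe _ hρ')
    · obtain ⟨ρ, hρ, j, hj⟩ := hS p hp
      exact ⟨_, hcons ρ hρ, j + 1, by rwa [seen_consSeq, hρ.zero]⟩
  | one F hv hF _ _ ih =>
    obtain ⟨τ', hτ', h⟩ := exists_legal_forall ih
    obtain ⟨τ, hτ, hshift, hcons⟩ := exists_legal_one hv hτ'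
    refine ⟨τ, hτ, fun ρ hρ => safe_of_shift ((h _ hρ.edge).1 _ (hshift ρ hρ)), fun p hp => ?_⟩
    obtain ⟨u, hu, hpu⟩ := hF p hp
    obtain ⟨ρ, hρ, j, hj⟩ := (h u hu).2 p hpu
    exact ⟨_, hcons u hu ρ hρ, j + 1, by rwa [seen_consSeq, hρ.zero]⟩

/-- The colours of all vertices of a sequence. -/
def allColours (g : ReachSPGame V t) (ρ : ℕ → V) : Set ℕ := {i | ∃ k, i ∈ g.colours (ρ k)}

theorem le_of_mem_allColours {i : ℕ} (h : i ∈ g.allColours ρ) : i ≤ t :=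
  g.le_of_mem_colours h.choose_spec

theorem payoff_eq_true_iff (h : g.arena.IsPlay ρ) (i : Fin t) :
    g.toSPGame.payoff ρ i = true ↔ (i : ℕ) + 1 ∈ g.allColours ρ := by
  simp only [SPGame.payoff, decide_eq_true_eq, allColours, Set.mem_ofPred_eq, succ_mem_colours]
  exact and_iff_right h

theorem payoff_le_iff {ρ' : ℕ → V} (h : g.arena.IsPlay ρ) (h' : g.arena.IsPlay ρ') :
    g.toSPGame.payoff ρ ≤ g.toSPGame.payoff ρ' ↔ PayLE (g.allColours ρ) (g.allColours ρ') := by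
  simp only [Pi.le_def, Bool.le_iff_imp, payoff_eq_true_iff h, payoff_eq_true_iff h']
  refine ⟨fun hle i hi hmem => ?_, fun hle i => hle _ (Nat.succ_ne_zero _)⟩
  obtain ⟨m, rfl⟩ := Nat.exists_eq_succ_of_ne_zero hi
  exact hle ⟨m, le_of_mem_allColours hmem⟩ hmem

theorem seen_subset_allColours (ρ : ℕ → V) (j : ℕ) :
    g.seen (g.colours (ρ 0)) ρ j ⊆ g.allColours ρ := fun _ hi =>
  (g.mem_seen.1 hi).imp fun _ hk => hk.2

theorem exists_allColours_subset_seen (ρ : ℕ → V) :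
    ∃ j, ∀ k ≥ j, g.allColours ρ ⊆ g.seen (g.colours (ρ 0)) ρ k := by
  have hex : ∀ i, ∃ j, i ∈ g.allColours ρ → i ∈ g.colours (ρ j) := fun i => by
    by_cases h : i ∈ g.allColours ρ
    · exact h.imp fun j hj _ => hj
    · exact ⟨0, fun h' => absurd h' h⟩
  choose f hf using hex
  refine ⟨(Finset.range (t + 1)).sup f, fun k hk i hi => g.mem_seen.2 ⟨f i, ?_, hf i hi⟩⟩
  have hit : i ∈ Finset.range (t + 1) :=
    Finset.mem_range.2 (Nat.lt_succ_iff.2 (le_of_mem_allColours hi))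
  exact (Finset.le_sup hit).trans hk

theorem hasSolution_of_good (h : g.Good W g.arena.init (g.colours g.arena.init) W) :
    g.toSPGame.HasSolution := by
  obtain ⟨τ, hτ, hsafe, hW⟩ := h.exists_strategy
  refine ⟨hτ.toStrategy 0, fun σ₁ ρ ⟨hplay, hcons, _⟩ hpar => ?_⟩
  have hρ0 : ρ 0 = g.arena.init := hplay.1
  rcases hsafe ρ ⟨hplay.1, hplay.2, hcons⟩ with ⟨j, hj⟩ | hbelow
  · rw [← hρ0, mem_seen] at hj
    obtain ⟨k, -, hk⟩ := hj
    exact ⟨hplay, k, g.zero_mem_colours.1 hk⟩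
  · obtain ⟨j, hj⟩ := exists_allColours_subset_seen (g := g) ρ
    obtain ⟨p, hp, hle, hnle⟩ := (hρ0 ▸ hbelow j).of_subset (hj j le_rfl)
    obtain ⟨ρ', hρ', k, hk⟩ := hW p hp
    have hplay' : g.arena.IsPlay ρ' := ⟨hρ'.zero, hρ'.mem_edges⟩
    have hple : PayLE p (g.allColours ρ') :=
      hk.trans (payLE_of_subset (hρ'.zero ▸ seen_subset_allColours ρ' k))
    have hge := hpar.2 ⟨ρ', ⟨hplay', hρ'.consistent⟩, rfl⟩
      ((payoff_le_iff hplay hplay').2 (hle.trans hple))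
    exact absurd (hple.trans ((payoff_le_iff hplay' hplay).1 hge)) hnle

end ReachSPGame

namespace ReachSPGame

open GameArena

variable {V : Type*} {t : ℕ} {g : ReachSPGame V t}

/-! #### From solutions to good sets of payoffs -/

/-- The colours of the vertices in a list. -/
def listColours (g : ReachSPGame V t) (h : List V) : Set ℕ := {i | ∃ v ∈ h, i ∈ g.colours v}

theorem listColours_pref (ρ : ℕ → V) (j : ℕ) :
    g.listColours (pref ρ j) = g.seen (g.colours (ρ 0)) ρ j := by
  ext i
  simp [listColours, pref, mem_seen]

open Classical in
/-- Move to a successor from which Player 0 cannot force a visit to the target of Player 0, if there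
is one. -/
noncomputable def avoidMove (g : ReachSPGame V t) (h : List V) : V :=
  if hx : ∃ u, (∀ v ∈ h.getLast?, (v, u) ∈ g.arena.E) ∧
    ¬ g.Attr u (g.listColours h ∪ g.colours u) then hx.choose else g.arena.anyMove h

theorem legal_avoidMove : g.arena.Legal g.avoidMove := by
  intro h hne
  rw [avoidMove]
  split_ifs with hx
  · exact hx.choose_spec.1 _ (List.getLast?_eq_getLast_of_ne_nil hne)
  · exact g.arena.legal_anyMove h hne

variable {ρ : ℕ → V} {j : ℕ}

theorem not_attr_avoidMove (hmove : g.arena.owner (ρ j) = 1 → ρ (j + 1) = g.avoidMove (pref ρ j))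
    (hE : (ρ j, ρ (j + 1)) ∈ g.arena.E) (hA : ¬ g.Attr (ρ j) (g.seen (g.colours (ρ 0)) ρ j)) :
    ¬ g.Attr (ρ (j + 1)) (g.seen (g.colours (ρ 0)) ρ (j + 1)) := by
  rcases g.arena.owner_eq_zero_or_one (ρ j) with h0 | h1
  · exact fun h => hA (.zero h0 hE h)
  · have hx : ∃ u, (∀ v ∈ (pref ρ j).getLast?, (v, u) ∈ g.arena.E) ∧
        ¬ g.Attr u (g.listColours (pref ρ j) ∪ g.colours u) := by
      by_contra! hx
      refine hA (.one h1 fun u hu => ?_)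
      rw [← listColours_pref]
      exact hx u fun v hv => by
        rw [getLast?_pref, Option.mem_some_iff] at hv
        exact hv ▸ hu
    have hnext : ρ (j + 1) = hx.choose := (hmove h1).trans (dif_pos hx)
    rw [seen, ← listColours_pref, hnext]
    exact hx.choose_spec.2

variable {σ₀ : g.arena.Strategy 0}

theorem exists_isOutcome_avoid (hρ : ρ ∈ σ₀.plays)
    (hA : ¬ g.Attr (ρ j) (g.seen (g.colours (ρ 0)) ρ j)) :
    ∃ (σ₁ : g.arena.Strategy 1) (ρ' : ℕ → V), IsOutcome σ₀ σ₁ ρ' ∧ (∀ k ≤ j, ρ' k = ρ k) ∧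
      0 ∉ g.allColours ρ' := by
  obtain ⟨σ₁, ρ', hρ', hag, hmove⟩ := exists_isOutcome_extend hρ j legal_avoidMove
  have hnot : ∀ k ≥ j, ¬ g.Attr (ρ' k) (g.seen (g.colours (ρ' 0)) ρ' k) := by
    intro k hk
    induction k, hk using Nat.le_induction with
    | base => rwa [g.seen_congr hag, hag j le_rfl, hag 0 (Nat.zero_le _)]
    | succ k hk ih => exact not_attr_avoidMove (hmove k hk) (hρ'.1.2 k) ih
  refine ⟨σ₁, ρ', hρ', hag, fun ⟨k, hk⟩ => ?_⟩
  exact hnot (j + k) (Nat.le_add_right j k) (.base (g.mem_seen.2 ⟨k, Nat.le_add_left k j, hk⟩))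

/-- The sets of colours of the plays that are consistent with a strategy. -/
def outcomes (σ₀ : g.arena.Strategy 0) : Set (Set ℕ) := g.allColours '' σ₀.plays

theorem subset_Iic_of_mem_outcomes {p : Set ℕ} (hp : p ∈ outcomes σ₀) : p ⊆ Set.Iic t := by
  obtain ⟨ρ, -, rfl⟩ := hp
  exact fun _ => le_of_mem_allColours

theorem finite_outcomes (σ₀ : g.arena.Strategy 0) : (outcomes σ₀).Finite :=
  (Set.finite_Iic t).finite_subsets.subset fun _ => subset_Iic_of_mem_outcomes

theorem below_outcomes (hρ : ρ ∈ σ₀.plays) (hp : g.toSPGame.payoff ρ ∉ g.toSPGame.paretoSet σ₀) :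
    Below (outcomes σ₀) (g.allColours ρ) := by
  have hx : ∃ ρ' ∈ σ₀.plays, g.toSPGame.payoff ρ ≤ g.toSPGame.payoff ρ' ∧
      ¬ g.toSPGame.payoff ρ' ≤ g.toSPGame.payoff ρ := by
    by_contra! hx
    exact hp ⟨⟨ρ, hρ, rfl⟩, fun _ ⟨ρ', hρ', h⟩ hle => h ▸ hx ρ' hρ' (h ▸ hle)⟩
  obtain ⟨ρ', hρ', hle, hnle⟩ := hx
  rw [payoff_le_iff hρ.1 hρ'.1] at hle
  rw [payoff_le_iff hρ'.1 hρ.1] at hnle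
  exact ⟨_, ⟨ρ', hρ', rfl⟩, hle, hnle⟩

theorem below_seen_of_isSolution (h : g.toSPGame.IsSolution σ₀) (hρ : ρ ∈ σ₀.plays)
    (hA : ¬ g.Attr (ρ j) (g.seen (g.colours (ρ 0)) ρ j)) :
    Below (outcomes σ₀) (g.seen (g.colours (ρ 0)) ρ j) := by
  obtain ⟨σ₁, ρ', hout, hag, h0⟩ := exists_isOutcome_avoid hρ hA
  have hpareto : g.toSPGame.payoff ρ' ∉ g.toSPGame.paretoSet σ₀ := fun hp => by
    obtain ⟨-, k, hk⟩ := h σ₁ ρ' hout hp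
    exact h0 ⟨k, g.zero_mem_colours.2 hk⟩
  refine (below_outcomes ⟨hout.1, hout.2.1⟩ hpareto).of_subset ?_
  rw [← hag 0 (Nat.zero_le _), ← g.seen_congr hag]
  exact seen_subset_allColours ρ' j

theorem not_lose_of_isSolution (h : g.toSPGame.IsSolution σ₀) (hρ : ρ ∈ σ₀.plays) :
    ¬ g.Lose (outcomes σ₀) (ρ j) (g.seen (g.colours (ρ 0)) ρ j) := by
  intro hl
  generalize hv : ρ j = v, hc : g.seen (g.colours (ρ 0)) ρ j = c at hl
  induction hl generalizing ρ j with
  | base hA hb =>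
    subst hv hc
    exact hb (below_seen_of_isSolution h hρ hA)
  | zero _ _ _ ih =>
    subst hv hc
    exact ih _ (hρ.1.2 j) hρ rfl rfl
  | one _ hv1 hE _ ih =>
    subst hv hc
    obtain ⟨ρ', hρ', hag, rfl⟩ := exists_play_extend hρ hv1 hE
    refine ih hρ' rfl ?_
    rw [seen, g.seen_congr hag, hag 0 (Nat.zero_le _)]

/-- The payoffs in `S` whose witnesses, given by `w`, agree with `ρ` up to position `j`. -/
def agreeing (S : Set (Set ℕ)) (w : Set ℕ → ℕ → V) (ρ : ℕ → V) (j : ℕ) : Set (Set ℕ) :=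
  {p ∈ S | ∀ k ≤ j, w p k = ρ k}

variable {S : Set (Set ℕ)} {w : Set ℕ → ℕ → V}

theorem agreeing_congr {ρ' : ℕ → V} (h : ∀ k ≤ j, ρ' k = ρ k) :
    agreeing S w ρ' j = agreeing S w ρ j := by
  ext p
  exact and_congr_right fun _ => forall₂_congr fun k hk => by rw [h k hk]

theorem agreeing_succ :
    agreeing S w ρ (j + 1) = {p ∈ agreeing S w ρ j | w p (j + 1) = ρ (j + 1)} := by
  ext p
  simp only [agreeing, Set.mem_ofPred_eq, Nat.le_add_one_iff, or_imp, forall_and, forall_eq,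
    and_assoc]

theorem agreeing_succ_of_owner_zero (hρ : ρ ∈ σ₀.plays) (hw : ∀ p ∈ S, w p ∈ σ₀.plays)
    (h0 : g.arena.owner (ρ j) = 0) : agreeing S w ρ (j + 1) = agreeing S w ρ j := by
  rw [agreeing_succ]
  refine Set.sep_eq_self_iff_mem_true.2 fun p ⟨hp, hag⟩ => ?_
  rw [(hw p hp).2 j (by rwa [hag j le_rfl]), hρ.2 j h0, pref_congr hag]

theorem exists_forall_subset_seen (hS : S.Finite) (hw : ∀ p ∈ S, g.allColours (w p) = p) :
    ∃ J, ∀ p ∈ S, p ⊆ g.seen (g.colours (w p 0)) (w p) J := by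
  choose f hf using fun p => exists_allColours_subset_seen (g := g) (w p)
  refine ⟨hS.toFinset.sup f, fun p hp => ?_⟩
  have hsub := hf p _ (Finset.le_sup (f := f) (hS.mem_toFinset.2 hp))
  rwa [hw p hp] at hsub

theorem good_agreeing_of_isSolution (h : g.toSPGame.IsSolution σ₀)
    (hw : ∀ p ∈ S, w p ∈ σ₀.plays) {J : ℕ}
    (hJ : ∀ p ∈ S, p ⊆ g.seen (g.colours (w p 0)) (w p) J) (hj : j ≤ J) (hρ : ρ ∈ σ₀.plays) :
    g.Good (outcomes σ₀) (ρ j) (g.seen (g.colours (ρ 0)) ρ j) (agreeing S w ρ j) := by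
  induction hj using Nat.decreasingInduction generalizing ρ with
  | self =>
    refine .leaf (fun p ⟨hp, hag⟩ => payLE_of_subset ?_) (not_lose_of_isSolution h hρ)
    rw [← hag 0 (Nat.zero_le _), ← g.seen_congr hag]
    exact hJ p hp
  | of_succ j _ ih =>
    rcases g.arena.owner_eq_zero_or_one (ρ j) with h0 | h1
    · refine .zero h0 (hρ.1.2 j) ?_
      rw [← agreeing_succ_of_owner_zero hρ hw h0]
      exact ih hρ
    · refine .one (fun u => {p ∈ agreeing S w ρ j | w p (j + 1) = u}) h1 ?_
        (fun u _ => Set.sep_subset _ _) fun u hu => ?_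
      · rintro p ⟨hp, hag⟩
        exact ⟨w p (j + 1), hag j le_rfl ▸ (hw p hp).1.2 j, ⟨hp, hag⟩, rfl⟩
      · obtain ⟨ρ', hρ', hag, rfl⟩ := exists_play_extend hρ h1 hu
        have hgood := ih hρ'
        rwa [seen, g.seen_congr hag, hag 0 (Nat.zero_le _), agreeing_succ,
          agreeing_congr hag] at hgood

theorem good_outcomes (h : g.toSPGame.IsSolution σ₀) :
    g.Good (outcomes σ₀) g.arena.init (g.colours g.arena.init) (outcomes σ₀) := by
  have : Nonempty V := ⟨g.arena.init⟩
  have hex : ∀ p ∈ outcomes σ₀, ∃ ρ, ρ ∈ σ₀.plays ∧ g.allColours ρ = p := fun _ hp => hp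
  choose! w hw hcol using hex
  obtain ⟨J, hJ⟩ := exists_forall_subset_seen (finite_outcomes σ₀) hcol
  obtain ⟨ρ, hρ, -⟩ := existsUnique_isOutcome σ₀ (g.arena.legal_anyMove.toStrategy 1)
  have hgood := good_agreeing_of_isSolution h hw hJ (Nat.zero_le J) ⟨hρ.1, hρ.2.1⟩
  have hall : agreeing (outcomes σ₀) w ρ 0 = outcomes σ₀ :=
    Set.sep_eq_self_iff_mem_true.2 fun p hp k hk => by
      rw [Nat.le_zero.1 hk, (hw p hp).1.1, hρ.1.1]
  rwa [seen, hρ.1.1, hall] at hgood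

theorem exists_good_of_hasSolution (h : g.toSPGame.HasSolution) :
    ∃ W : Set (Set ℕ), (∀ p ∈ W, p ⊆ Set.Iic t) ∧
      g.Good W g.arena.init (g.colours g.arena.init) W := by
  obtain ⟨σ₀, h⟩ := h
  exact ⟨outcomes σ₀, fun _ => subset_Iic_of_mem_outcomes, good_outcomes h⟩

end ReachSPGame

/-! ### Stratified programs -/

namespace FOFormula

/-- All relation symbols of the formula are smaller than `m`. -/
def UsesBelow (m : ℕ) : FOFormula → Prop
  | lt _ _ => True
  | rel r _ => r < m
  | neg φ => φ.UsesBelow m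
  | and φ ψ => φ.UsesBelow m ∧ ψ.UsesBelow m
  | ex φ => φ.UsesBelow m

instance decidableUsesBelow (m : ℕ) : (φ : FOFormula) → Decidable (φ.UsesBelow m)
  | lt _ _ => inferInstanceAs (Decidable True)
  | rel r _ => inferInstanceAs (Decidable (r < m))
  | neg φ => decidableUsesBelow m φ
  | and φ ψ => @instDecidableAnd _ _ (decidableUsesBelow m φ) (decidableUsesBelow m ψ)
  | ex φ => decidableUsesBelow m φ

instance decidableWF (ar : ℕ → ℕ) : (φ : FOFormula) → Decidable (φ.WF ar)
  | lt _ _ => inferInstanceAs (Decidable True)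
  | rel r args => inferInstanceAs (Decidable (args.length = ar r))
  | neg φ => decidableWF ar φ
  | and φ ψ => @instDecidableAnd _ _ (decidableWF ar φ) (decidableWF ar ψ)
  | ex φ => decidableWF ar φ

theorem holds_congr {N m : ℕ} {ρ ρ' : RelStore} (h : ∀ r < m, ρ r = ρ' r) {φ : FOFormula}
    (hφ : φ.UsesBelow m) (env : List ℕ) : φ.Holds N ρ env ↔ φ.Holds N ρ' env := by
  induction φ generalizing env with
  | lt i j => exact Iff.rfl
  | rel r args => simp only [Holds, h r hφ]
  | neg φ ih => simp only [Holds, ih hφ]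
  | and φ ψ ih₁ ih₂ => simp only [Holds, ih₁ hφ.1, ih₂ hφ.2]
  | ex φ ih => simp only [Holds, ih hφ]

/-- Universal quantification. -/
def all (φ : FOFormula) : FOFormula := .neg (.ex (.neg φ))

/-- Implication. -/
def imp (φ ψ : FOFormula) : FOFormula := .neg (.and φ (.neg ψ))

/-- Equivalence. -/
def iff (φ ψ : FOFormula) : FOFormula := .and (.imp φ ψ) (.imp ψ φ)

/-- Equality of variables. -/
def eq (i j : ℕ) : FOFormula := .and (.neg (.lt i j)) (.neg (.lt j i))

section

variable {N : ℕ} {ρ : RelStore} {env : List ℕ} {φ ψ : FOFormula} {i j : ℕ}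

theorem holds_or : (or φ ψ).Holds N ρ env ↔ φ.Holds N ρ env ∨ ψ.Holds N ρ env := by
  simp only [or, Holds]; tauto

theorem holds_all : (all φ).Holds N ρ env ↔ ∀ x < N, φ.Holds N ρ (env ++ [x]) := by
  simp only [all, Holds]; push Not; rfl

theorem holds_imp : (imp φ ψ).Holds N ρ env ↔ (φ.Holds N ρ env → ψ.Holds N ρ env) := by
  simp only [imp, Holds]; tauto

theorem holds_iff : (iff φ ψ).Holds N ρ env ↔ (φ.Holds N ρ env ↔ ψ.Holds N ρ env) := by
  simp only [iff, Holds, holds_imp]; tauto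

theorem holds_eq : (eq i j).Holds N ρ env ↔ env.getD i 0 = env.getD j 0 := by
  simp only [eq, Holds]; omega

end

end FOFormula

namespace RelInstr

/-- The instruction uses only relations below `m`, apart from the one that it iterates. -/
def UsesBelow (m : ℕ) : RelInstr → Prop
  | define _ φ => φ.UsesBelow m
  | iterate _ φ => φ.UsesBelow (m + 1)

instance decidableUsesBelow (m : ℕ) : (I : RelInstr) → Decidable (I.UsesBelow m)
  | define _ φ => inferInstanceAs (Decidable (φ.UsesBelow m))
  | iterate _ φ => inferInstanceAs (Decidable (φ.UsesBelow (m + 1)))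

instance decidableWF (ar : ℕ → ℕ) : (I : RelInstr) → Decidable (I.WF ar)
  | define _ φ => inferInstanceAs (Decidable (φ.WF ar))
  | iterate _ φ => inferInstanceAs (Decidable (φ.WF ar))

/-- The instructions compute the relations `m, m + 1, …` in this order. -/
def Stratified : ℕ → List RelInstr → Prop
  | _, [] => True
  | m, I :: P => I.target = m ∧ I.UsesBelow m ∧ Stratified (m + 1) P

instance decidableStratified : (m : ℕ) → (P : List RelInstr) → Decidable (Stratified m P)
  | _, [] => inferInstanceAs (Decidable True)
  | m, I :: P =>
    letI := decidableStratified (m + 1) P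
    inferInstanceAs (Decidable (I.target = m ∧ I.UsesBelow m ∧ Stratified (m + 1) P))

variable {ar : ℕ → ℕ} {N : ℕ}

/-- The relation that the instruction computes satisfies in `ρ` its specification: the formula
defines it, or it is closed under the formula and has the induction principle of the inflationary
iteration of the formula. -/
def Solved (ar : ℕ → ℕ) (N : ℕ) (ρ : RelStore) : RelInstr → Prop
  | define r φ => ∀ a, a.length = ar r → (∀ x ∈ a, x < N) → (ρ r a ↔ φ.Holds N ρ a)
  | iterate r φ =>
    (∀ a, a.length = ar r → (∀ x ∈ a, x < N) → φ.Holds N (update ρ r (ρ r)) a → ρ r a) ∧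
    ∀ Q : List ℕ → Prop, (∀ R : List ℕ → Prop, (∀ a, R a → Q a) →
      ∀ a, a.length = ar r → (∀ x ∈ a, x < N) → φ.Holds N (update ρ r R) a → Q a) →
      ∀ a, ρ r a → Q a

theorem foldl_apply_of_lt {m : ℕ} {P : List RelInstr} (hP : Stratified m P) (ρ : RelStore) {s : ℕ}
    (hs : s < m) : P.foldl (fun ρ I => I.apply ar N ρ) ρ s = ρ s := by
  induction P generalizing m ρ with
  | nil => rfl
  | cons I P ih =>
    obtain ⟨rfl, -, hP⟩ := hP
    rw [List.foldl_cons, ih hP _ (by omega), apply_of_ne _ hs.ne]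

theorem solved_of_eqOn {I : RelInstr} (hI : I.UsesBelow I.target) {ρ ρ' : RelStore}
    (h : ∀ s < I.target + 1, ρ' s = I.apply ar N ρ s) : I.Solved ar N ρ' := by
  have hbelow : ∀ s < I.target, ρ' s = ρ s := fun s hs =>
    (h s (by omega)).trans (apply_of_ne ρ hs.ne)
  cases I with
  | define r φ =>
    intro a ha haN
    rw [h r r.lt_succ_self, apply_define ha haN]
    exact FOFormula.holds_congr (fun s hs => (hbelow s hs).symm) hI a
  | iterate r φ =>
    refine ⟨fun a ha haN hφ => ?_, fun Q hQ a hr => ?_⟩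
    · rw [update_eq_self] at hφ
      rw [h r r.lt_succ_self]
      exact apply_iterate_closed ha haN ((FOFormula.holds_congr h hI a).1 hφ)
    · rw [h r r.lt_succ_self] at hr
      refine apply_iterate_induction Q (fun R hR b hb hbN hφ => hQ R hR b hb hbN ?_) hr
      refine (FOFormula.holds_congr (fun s hs => ?_) hI b).1 hφ
      rcases (Nat.lt_succ_iff.1 (show s < r + 1 from hs)).eq_or_lt with rfl | hsr
      · simp only [update_self]
      · rw [update_of_ne hsr.ne, update_of_ne hsr.ne, hbelow s hsr]

theorem solved_foldl_apply {m : ℕ} {P : List RelInstr} (hP : Stratified m P) (ρ : RelStore) :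
    ∀ I ∈ P, I.Solved ar N (P.foldl (fun ρ I => I.apply ar N ρ) ρ) := by
  induction P generalizing m ρ with
  | nil => simp
  | cons I P ih =>
    obtain ⟨rfl, hu, hP⟩ := hP
    refine List.forall_mem_cons.2 ⟨?_, ih hP _⟩
    exact solved_of_eqOn hu fun s hs => foldl_apply_of_lt hP _ hs

end RelInstr

/-! ### The program for the synthesis problem -/

namespace SPSProgram

open FOFormula

abbrev inpR : ℕ := 0
abbrev zeroR : ℕ := 1
abbrev succR : ℕ := 2
abbrev twoR : ℕ := 3
abbrev plusR : ℕ := 4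
abbrev timesR : ℕ := 5
abbrev halfR : ℕ := 6
abbrev oddR : ℕ := 7
abbrev bitR : ℕ := 8
abbrev isnR : ℕ := 9
abbrev istR : ℕ := 10
abbrev fieldR : ℕ := 11
abbrev edgeR : ℕ := 12
abbrev ownR : ℕ := 13
abbrev colR : ℕ := 14
abbrev stepR : ℕ := 15
abbrev attrR : ℕ := 16
abbrev subR : ℕ := 17
abbrev belowR : ℕ := 18
abbrev loseR : ℕ := 19
abbrev unionR : ℕ := 20
abbrev goodR : ℕ := 21
abbrev resR : ℕ := 22

/-- The arity of the relation `r`. -/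
def arity (r : ℕ) : ℕ :=
  [1, 1, 2, 2, 3, 3, 2, 1, 2, 1, 1, 2, 2, 1, 2, 3, 2, 2, 2, 3, 3, 5, 0].getD r 0

local infixr:35 " ⩓ " => FOFormula.and
local infixr:30 " ⩔ " => FOFormula.or

/-- `zeroR [x]`: `x = 0`. -/
def zeroF : FOFormula := neg (ex (lt 1 0))

/-- `succR [x, y]`: `y = x + 1`. -/
def succF : FOFormula := lt 0 1 ⩓ neg (ex (lt 0 2 ⩓ lt 2 1))

/-- `twoR [x, y]`: `y = x + 2`. -/
def twoF : FOFormula := ex (rel succR [0, 2] ⩓ rel succR [2, 1])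

/-- `plusR [x, y, z]`: `x + y = z`. -/
def plusF : FOFormula :=
  (rel zeroR [1] ⩓ eq 0 2) ⩔
    ex (rel succR [3, 1] ⩓ ex (rel succR [4, 2] ⩓ rel plusR [0, 3, 4]))

/-- `timesR [x, y, z]`: `x * y = z`. -/
def timesF : FOFormula :=
  (rel zeroR [1] ⩓ rel zeroR [2]) ⩔
    ex (rel succR [3, 1] ⩓ ex (rel timesR [0, 3, 4] ⩓ rel plusR [4, 0, 2]))

/-- `halfR [x, y]`: `x / 2 = y`. -/
def halfF : FOFormula := ex (rel plusR [1, 1, 2] ⩓ (eq 2 0 ⩔ rel succR [2, 0]))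

/-- `oddR [x]`: `x` is odd. -/
def oddF : FOFormula := ex (rel halfR [0, 1] ⩓ neg (rel plusR [1, 1, 0]))

/-- `bitR [x, i]`: the bit `i` of `x` is one. -/
def bitF : FOFormula :=
  (rel zeroR [1] ⩓ rel oddR [0]) ⩔
    ex (rel succR [2, 1] ⩓ ex (rel halfR [0, 3] ⩓ rel bitR [3, 2]))

/-- `isnR [x]`: `x` is the number of vertices, the length of the leading block of ones. -/
def isnF : FOFormula := neg (rel inpR [0]) ⩓ all (imp (lt 1 0) (rel inpR [1]))

/-- `istR [x]`: `x` is the number of objectives, the length of the second block of ones. -/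
def istF : FOFormula :=
  ex (rel isnR [1] ⩓ ex (rel succR [1, 2] ⩓ ex (rel plusR [2, 0, 3] ⩓ neg (rel inpR [3]) ⩓
    all (imp (neg (lt 4 2) ⩓ lt 4 3) (rel inpR [4])))))

/-- `fieldR [k, j]`: the bit `j` of the row `k` of the input, at the position
`n + t + 2 + k * n + j`, is one. -/
def fieldF : FOFormula :=
  ex (rel isnR [2] ⩓ lt 1 2 ⩓ ex (rel istR [3] ⩓ ex (rel plusR [2, 3, 4] ⩓ ex (rel twoR [4, 5] ⩓
    ex (rel timesR [0, 2, 6] ⩓ ex (rel plusR [5, 6, 7] ⩓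
      ex (rel plusR [7, 1, 8] ⩓ rel inpR [8])))))))

/-- `edgeR [v, u]`: there is an edge from `v` to `u`. -/
def edgeF : FOFormula :=
  ex (rel istR [2] ⩓ ex (rel plusR [2, 0, 3] ⩓ ex (rel succR [3, 4] ⩓
    ex (rel twoR [4, 5] ⩓ rel fieldR [5, 1]))))

/-- `ownR [v]`: `v` is a vertex of Player 1. -/
def ownF : FOFormula := ex (rel zeroR [1] ⩓ rel fieldR [1, 0])

/-- `colR [v, i]`: `v` belongs to the target set `i`. -/
def colF : FOFormula :=
  ex (rel istR [2] ⩓ neg (lt 2 1) ⩓ ex (rel twoR [1, 3] ⩓ rel fieldR [3, 0]))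

/-- `stepR [c, u, c']`: `c'` is the union of `c` and the colours of `u`. -/
def stepF : FOFormula := all (iff (rel bitR [2, 3]) (rel bitR [0, 3] ⩔ rel colR [1, 3]))

/-- `attrR [v, c]`: `ReachSPGame.Attr`. -/
def attrF : FOFormula :=
  ex (rel zeroR [2] ⩓ rel bitR [1, 2]) ⩔
  (neg (rel ownR [0]) ⩓ ex (rel edgeR [0, 2] ⩓ ex (rel stepR [1, 2, 3] ⩓ rel attrR [2, 3]))) ⩔
  (rel ownR [0] ⩓
    all (imp (rel edgeR [0, 2]) (all (imp (rel stepR [1, 2, 3]) (rel attrR [2, 3])))))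

/-- `subR [p, q]`: `ReachSPGame.PayLE`. -/
def subF : FOFormula := all (imp (neg (rel zeroR [2]) ⩓ rel bitR [0, 2]) (rel bitR [1, 2]))

/-- `belowR [W, c]`: `ReachSPGame.Below`. -/
def belowF : FOFormula := ex (rel bitR [0, 2] ⩓ rel subR [1, 2] ⩓ neg (rel subR [2, 1]))

/-- `loseR [W, v, c]`: `ReachSPGame.Lose`. -/
def loseF : FOFormula :=
  neg (rel attrR [1, 2]) ⩓ (neg (rel belowR [0, 2]) ⩔
  (neg (rel ownR [1]) ⩓
    all (imp (rel edgeR [1, 3]) (all (imp (rel stepR [2, 3, 4]) (rel loseR [0, 3, 4]))))) ⩔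
  (rel ownR [1] ⩓ ex (rel edgeR [1, 3] ⩓ ex (rel stepR [2, 3, 4] ⩓ rel loseR [0, 3, 4]))))

/-- `unionR [S₁, S₂, S]`: `S` is the union of `S₁` and `S₂`. -/
def unionF : FOFormula := all (iff (rel bitR [2, 3]) (rel bitR [0, 3] ⩔ rel bitR [1, 3]))

/-- `goodR [W, v, c, 0, S]`: `ReachSPGame.Good`; `goodR [W, v, c, j + 1, S]`: the set `S` can be
distributed among the successors of `v` that are smaller than `j`, so that the successors become
good. The auxiliary index bounds the number of variables, since it avoids quantifying over a
distribution. -/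
def goodF : FOFormula :=
  (rel zeroR [3] ⩓ all (imp (rel bitR [4, 5]) (rel subR [5, 2])) ⩓ neg (rel loseR [0, 1, 2])) ⩔
  (rel zeroR [3] ⩓ neg (rel ownR [1]) ⩓
    ex (rel edgeR [1, 5] ⩓ ex (rel stepR [2, 5, 6] ⩓ rel goodR [0, 5, 6, 3, 4]))) ⩔
  (rel zeroR [3] ⩓ rel ownR [1] ⩓
    ex (rel isnR [5] ⩓ ex (rel succR [5, 6] ⩓ rel goodR [0, 1, 2, 6, 4]))) ⩔
  (ex (rel zeroR [5] ⩓ rel succR [5, 3]) ⩓ rel zeroR [4]) ⩔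
  ex (rel twoR [5, 3] ⩓ ex (rel succR [5, 6] ⩓
    ((neg (rel edgeR [1, 5]) ⩓ rel goodR [0, 1, 2, 6, 4]) ⩔
    (rel edgeR [1, 5] ⩓ ex (rel zeroR [7] ⩓ ex (rel stepR [2, 5, 8] ⩓
      ex (ex (rel unionR [9, 10, 4] ⩓ rel goodR [0, 5, 8, 7, 9] ⩓
        rel goodR [0, 1, 2, 6, 10]))))))))

/-- `resR []`: the game has a solution. -/
def resF : FOFormula :=
  ex (ex (rel zeroR [1] ⩓ ex (rel succR [1, 2] ⩓ ex (rel fieldR [2, 3] ⩓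
    ex (rel stepR [1, 3, 4] ⩓ rel goodR [0, 3, 4, 1, 0])))))

/-- The program for the synthesis problem. -/
def instrs : List RelInstr :=
  [.define zeroR zeroF, .define succR succF, .define twoR twoF, .iterate plusR plusF,
    .iterate timesR timesF, .define halfR halfF, .define oddR oddF, .iterate bitR bitF,
    .define isnR isnF, .define istR istF, .define fieldR fieldF, .define edgeR edgeF,
    .define ownR ownF, .define colR colF, .define stepR stepF, .iterate attrR attrF,
    .define subR subF, .define belowR belowF, .iterate loseR loseF, .define unionR unionF,
    .iterate goodR goodF, .define resR resF]

theorem wf_instrs : ∀ I ∈ instrs, I.WF arity := by decide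

theorem stratified_instrs : RelInstr.Stratified 1 instrs := by decide

/-- All relations of `ρ` are as the program computes them on the universe `N`. -/
def Solved (N : ℕ) (ρ : RelStore) : Prop := ∀ I ∈ instrs, I.Solved arity N ρ

end SPSProgram

/-! ### Sets as numbers -/

/-- The set that the number `m` encodes: the positions of its ones. -/
def bitSet (m : ℕ) : Set ℕ := {i | m.testBit i = true}

theorem mem_bitSet {m i : ℕ} : i ∈ bitSet m ↔ m.testBit i = true := Iff.rfl

theorem bitSet_injective : Injective bitSet := fun _ _ h =>
  Nat.eq_of_testBit_eq fun i => Bool.eq_iff_iff.2 (Set.ext_iff.1 h i)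

theorem bitSet_or (a b : ℕ) : bitSet (a ||| b) = bitSet a ∪ bitSet b :=
  Set.ext fun i => by simp only [mem_bitSet, Set.mem_union, Nat.testBit_or, Bool.or_eq_true]

open Classical in
/-- The number with the digits `i < k` that belong to `s`. -/
noncomputable def code (k : ℕ) (s : Set ℕ) : ℕ := Nat.ofBits fun i : Fin k => decide ((i : ℕ) ∈ s)

theorem code_empty (k : ℕ) : code k ∅ = 0 :=
  Nat.eq_of_testBit_eq fun i => by simp [code, Nat.testBit_ofBits]

theorem code_lt (k : ℕ) (s : Set ℕ) : code k s < 2 ^ k := Nat.ofBits_lt_two_pow _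

theorem bitSet_code {k : ℕ} {s : Set ℕ} (hs : s ⊆ Set.Iio k) : bitSet (code k s) = s := by
  ext i
  by_cases hi : i < k
  · simp only [mem_bitSet, code, Nat.testBit_ofBits_lt _ _ hi, decide_eq_true_eq]
  · rw [mem_bitSet, code, Nat.testBit_ofBits_ge _ _ (not_lt.1 hi)]
    exact iff_of_false Bool.false_ne_true fun h => hi (hs h)

theorem exists_le_bitSet_eq {m : ℕ} {s : Set ℕ} (hs : s ⊆ bitSet m) : ∃ a ≤ m, bitSet a = s := by
  have hcode : bitSet (code m s) = s :=
    bitSet_code fun i hi => lt_of_lt_of_le Nat.lt_two_pow_self (Nat.ge_two_pow_of_testBit (hs hi))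
  have hand : m &&& code m s = code m s := bitSet_injective (Set.ext fun i => by
    rw [mem_bitSet, Nat.testBit_and, Bool.and_eq_true]
    exact and_iff_right_of_imp fun hi => hs (hcode ▸ hi))
  exact ⟨code m s, hand ▸ Nat.and_le_left, hcode⟩

/-- The set of sets that the number `m` encodes: the sets that are encoded by the positions of its
ones. -/
def bitSets (m : ℕ) : Set (Set ℕ) := bitSet '' bitSet m

theorem bitSets_injective : Injective bitSets :=
  bitSet_injective.image_injective.comp bitSet_injective

theorem bitSets_or (a b : ℕ) : bitSets (a ||| b) = bitSets a ∪ bitSets b := by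
  rw [bitSets, bitSet_or, Set.image_union, bitSets, bitSets]

theorem bitSets_eq_empty_iff {m : ℕ} : bitSets m = ∅ ↔ m = 0 := by
  rw [← bitSets_injective.eq_iff (b := 0), show bitSets 0 = ∅ by simp [bitSets, bitSet]]

theorem exists_or_eq_of_union_eq {S : ℕ} {S₁ S₂ : Set (Set ℕ)} (h : S₁ ∪ S₂ = bitSets S) :
    ∃ a ≤ S, ∃ b ≤ S, bitSets a = S₁ ∧ bitSets b = S₂ ∧ S = a ||| b := by
  obtain ⟨A, hA, rfl⟩ := Set.subset_image_iff.1 (Set.subset_union_left.trans h.subset)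
  obtain ⟨B, hB, rfl⟩ := Set.subset_image_iff.1 (Set.subset_union_right.trans h.subset)
  obtain ⟨a, ha, rfl⟩ := exists_le_bitSet_eq hA
  obtain ⟨b, hb, rfl⟩ := exists_le_bitSet_eq hB
  exact ⟨a, ha, b, hb, rfl, rfl, bitSets_injective (h.symm.trans (bitSets_or a b).symm)⟩

theorem exists_bitSets_eq {k : ℕ} {W : Set (Set ℕ)} (hW : ∀ p ∈ W, p ⊆ Set.Iio k) :
    ∃ m < 2 ^ 2 ^ k, bitSets m = W := by
  refine ⟨code (2 ^ k) (code k '' W), code_lt _ _, ?_⟩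
  rw [bitSets, bitSet_code (Set.image_subset_iff.2 fun p _ => code_lt k p), Set.image_image]
  exact (Set.image_congr fun p hp => bitSet_code (hW p hp)).trans (Set.image_id' W)

theorem lt_of_testBit {N a i : ℕ} (ha : a < N) (hi : a.testBit i = true) : i < N :=
  (Nat.lt_two_pow_self.trans_le (Nat.ge_two_pow_of_testBit hi)).trans ha

theorem eq_iff_forall_lt_testBit {N a b : ℕ} (ha : a < N)
    (hb : ∀ i, b.testBit i = true → i < N) :
    a = b ↔ ∀ i < N, (a.testBit i = true ↔ b.testBit i = true) := by
  refine ⟨fun h i _ => by rw [h], fun h => Nat.eq_of_testBit_eq fun i => Bool.eq_iff_iff.2 ?_⟩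
  exact ⟨fun hi => (h i (lt_of_testBit ha hi)).1 hi, fun hi => (h i (hb i hi)).2 hi⟩

/-! ### Arithmetic of the program -/

theorem exists_lt_and_iff_of_forall {N a : ℕ} {P Q : ℕ → Prop} (ha : a < N)
    (hP : ∀ x < N, P x ↔ x = a) : (∃ x < N, P x ∧ Q x) ↔ Q a := by
  constructor
  · rintro ⟨x, hx, hPx, hQ⟩
    rwa [← (hP x hx).1 hPx]
  · exact fun hQ => ⟨a, ha, (hP a ha).2 rfl, hQ⟩

namespace SPSProgram

open FOFormula ReachSPGame

variable {N : ℕ} {ρ : RelStore} {a b c : ℕ} {Q : ℕ → Prop} {R : List ℕ → Prop}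

theorem zeroR_iff (h : Solved N ρ) (ha : a < N) : ρ zeroR [a] ↔ a = 0 := by
  rw [h (.define zeroR zeroF) (by simp [instrs]) [a] rfl (by simpa using ha)]
  simp only [zeroF, Holds, List.cons_append, List.nil_append, List.getD_cons_zero,
    List.getD_cons_succ]
  refine ⟨fun h' => ?_, ?_⟩
  · by_contra h0
    exact h' ⟨0, by omega, by omega⟩
  · rintro rfl ⟨x, -, hx⟩
    omega

theorem succR_iff (h : Solved N ρ) (ha : a < N) (hb : b < N) : ρ succR [a, b] ↔ b = a + 1 := by
  rw [h (.define succR succF) (by simp [instrs]) [a, b] rfl (by simp [ha, hb])]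
  simp only [succF, Holds, List.cons_append, List.nil_append, List.getD_cons_zero,
    List.getD_cons_succ]
  refine ⟨fun ⟨_, hnone⟩ => ?_, ?_⟩
  · by_contra h0
    exact hnone ⟨a + 1, by omega, by omega, by omega⟩
  · rintro rfl
    exact ⟨by omega, fun ⟨_, _, _, _⟩ => by omega⟩

theorem exists_zeroR (h : Solved N ρ) (hN : 0 < N) : (∃ x < N, ρ zeroR [x] ∧ Q x) ↔ Q 0 :=
  exists_lt_and_iff_of_forall hN fun _ hx => zeroR_iff h hx

theorem exists_succR (h : Solved N ρ) (ha : a + 1 < N) :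
    (∃ x < N, ρ succR [a, x] ∧ Q x) ↔ Q (a + 1) :=
  exists_lt_and_iff_of_forall ha fun _ hx => succR_iff h (by omega) hx

theorem exists_succR_left (h : Solved N ρ) (hb : b < N) :
    (∃ x < N, ρ succR [x, b] ∧ Q x) ↔ ∃ x, b = x + 1 ∧ Q x :=
  ⟨fun ⟨x, hx, hs, hQ⟩ => ⟨x, (succR_iff h hx hb).1 hs, hQ⟩,
    fun ⟨x, hs, hQ⟩ => ⟨x, by omega, (succR_iff h (by omega) hb).2 hs, hQ⟩⟩

theorem twoR_iff (h : Solved N ρ) (ha : a < N) (hb : b < N) : ρ twoR [a, b] ↔ b = a + 2 := by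
  rw [h (.define twoR twoF) (by simp [instrs]) [a, b] rfl (by simp [ha, hb])]
  simp only [twoF, Holds, List.cons_append, List.nil_append, List.getD_cons_zero,
    List.getD_cons_succ, List.map_cons, List.map_nil, and_comm (a := ρ succR [a, _]),
    exists_succR_left h hb]
  refine ⟨?_, ?_⟩
  · rintro ⟨x, rfl, hx⟩
    rw [(succR_iff h ha (by omega)).1 hx]
  · rintro rfl
    exact ⟨a + 1, rfl, (succR_iff h ha (by omega)).2 rfl⟩

theorem exists_twoR (h : Solved N ρ) (ha : a + 2 < N) :
    (∃ x < N, ρ twoR [a, x] ∧ Q x) ↔ Q (a + 2) :=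
  exists_lt_and_iff_of_forall ha fun _ hx => twoR_iff h (by omega) hx

theorem exists_twoR_left (h : Solved N ρ) (hb : b < N) :
    (∃ x < N, ρ twoR [x, b] ∧ Q x) ↔ ∃ x, b = x + 2 ∧ Q x :=
  ⟨fun ⟨x, hx, hs, hQ⟩ => ⟨x, (twoR_iff h hx hb).1 hs, hQ⟩,
    fun ⟨x, hs, hQ⟩ => ⟨x, by omega, (twoR_iff h (by omega) hb).2 hs, hQ⟩⟩

theorem holds_plusF (h : Solved N ρ) (hb : b < N) (hc : c < N) :
    plusF.Holds N (update ρ plusR R) [a, b, c] ↔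
      b = 0 ∧ a = c ∨ ∃ b', b = b' + 1 ∧ ∃ c', c = c' + 1 ∧ R [a, b', c'] := by
  simp (disch := decide) only [plusF, Holds, holds_or, holds_eq, List.cons_append, List.nil_append,
    List.getD_cons_zero, List.getD_cons_succ, List.map_cons, List.map_nil, update_self,
    update_of_ne, zeroR_iff h hb, exists_succR_left h hb, exists_succR_left h hc]

theorem plusR_iff (h : Solved N ρ) (ha : a < N) (hb : b < N) (hc : c < N) :
    ρ plusR [a, b, c] ↔ a + b = c := by
  obtain ⟨hclosed, hind⟩ := h (.iterate plusR plusF) (by simp [instrs])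
  constructor
  · intro hp
    refine hind (fun l => ∀ a b c, l = [a, b, c] → a + b = c) ?_ _ hp a b c rfl
    rintro R hR _ - hlt hF a b c rfl
    simp only [List.forall_mem_cons] at hlt
    rcases (holds_plusF h hlt.2.1 hlt.2.2.1).1 hF with ⟨rfl, rfl⟩ | ⟨b', rfl, c', rfl, hr⟩
    · rfl
    · rw [← add_assoc, hR _ hr a b' c' rfl]
  · rintro rfl
    induction b with
    | zero => exact hclosed _ rfl (by simp [ha, hb]) ((holds_plusF h hb hc).2 (Or.inl ⟨rfl, rfl⟩))
    | succ b ih =>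
      exact hclosed _ rfl (by simp [ha, hb, hc]) ((holds_plusF h hb hc).2
        (Or.inr ⟨b, rfl, a + b, rfl, ih (by omega) (by omega)⟩))

theorem exists_plusR (h : Solved N ρ) (hab : a + b < N) :
    (∃ x < N, ρ plusR [a, b, x] ∧ Q x) ↔ Q (a + b) :=
  exists_lt_and_iff_of_forall hab fun _ hx =>
    (plusR_iff h (by omega) (by omega) hx).trans eq_comm

theorem holds_timesF (h : Solved N ρ) (ha : a < N) (hb : b < N) (hc : c < N) :
    timesF.Holds N (update ρ timesR R) [a, b, c] ↔
      b = 0 ∧ c = 0 ∨ ∃ b', b = b' + 1 ∧ ∃ c' < N, R [a, b', c'] ∧ c' + a = c := by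
  simp (disch := decide) only [timesF, Holds, holds_or, List.cons_append, List.nil_append,
    List.getD_cons_zero, List.getD_cons_succ, List.map_cons, List.map_nil, update_self,
    update_of_ne, zeroR_iff h hb, zeroR_iff h hc, exists_succR_left h hb]
  refine or_congr_right (exists_congr fun b' => and_congr_right fun _ => exists_congr fun c' =>
    and_congr_right fun hc' => ?_)
  rw [plusR_iff h hc' ha hc]

theorem timesR_iff (h : Solved N ρ) (ha : a < N) (hb : b < N) (hc : c < N) :
    ρ timesR [a, b, c] ↔ a * b = c := by
  obtain ⟨hclosed, hind⟩ := h (.iterate timesR timesF) (by simp [instrs])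
  constructor
  · intro hp
    refine hind (fun l => ∀ a b c, l = [a, b, c] → a * b = c) ?_ _ hp a b c rfl
    rintro R hR _ - hlt hF a b c rfl
    simp only [List.forall_mem_cons] at hlt
    rcases (holds_timesF h hlt.1 hlt.2.1 hlt.2.2.1).1 hF with
      ⟨rfl, rfl⟩ | ⟨b', rfl, c', -, hr, rfl⟩
    · rfl
    · rw [mul_add, mul_one, hR _ hr a b' c' rfl]
  · rintro rfl
    induction b with
    | zero =>
      exact hclosed _ rfl (by simp [ha, hb]) ((holds_timesF h ha hb hc).2 (Or.inl ⟨rfl, rfl⟩))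
    | succ b ih =>
      rw [mul_add, mul_one] at hc ⊢
      exact hclosed _ rfl (by simp [ha, hb, hc]) ((holds_timesF h ha hb hc).2
        (Or.inr ⟨b, rfl, a * b, by omega, ih (by omega) (by omega), rfl⟩))

theorem exists_timesR (h : Solved N ρ) (ha : a < N) (hb : b < N) (hab : a * b < N) :
    (∃ x < N, ρ timesR [a, b, x] ∧ Q x) ↔ Q (a * b) :=
  exists_lt_and_iff_of_forall hab fun _ hx => (timesR_iff h ha hb hx).trans eq_comm

theorem halfR_iff (h : Solved N ρ) (ha : a < N) (hb : b < N) : ρ halfR [a, b] ↔ b = a / 2 := by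
  rw [h (.define halfR halfF) (by simp [instrs]) [a, b] rfl (by simp [ha, hb])]
  simp only [halfF, Holds, holds_or, holds_eq, List.cons_append, List.nil_append,
    List.getD_cons_zero, List.getD_cons_succ, List.map_cons, List.map_nil]
  refine ⟨fun ⟨x, hx, hp, hs⟩ => ?_, ?_⟩
  · rw [plusR_iff h hb hb hx] at hp
    rw [succR_iff h hx ha] at hs
    omega
  · rintro rfl
    refine ⟨a / 2 + a / 2, by omega, (plusR_iff h hb hb (by omega)).2 rfl, ?_⟩
    rw [succR_iff h (by omega) ha]
    omega

theorem exists_halfR (h : Solved N ρ) (ha : a < N) :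
    (∃ x < N, ρ halfR [a, x] ∧ Q x) ↔ Q (a / 2) :=
  exists_lt_and_iff_of_forall (by omega) fun _ hx => halfR_iff h ha hx

theorem oddR_iff (h : Solved N ρ) (ha : a < N) : ρ oddR [a] ↔ a % 2 = 1 := by
  rw [h (.define oddR oddF) (by simp [instrs]) [a] rfl (by simpa using ha)]
  simp only [oddF, Holds, List.cons_append, List.nil_append, List.getD_cons_zero,
    List.getD_cons_succ, List.map_cons, List.map_nil, exists_halfR h ha]
  rw [plusR_iff h (by omega) (by omega) ha]
  omega

theorem holds_bitF (h : Solved N ρ) (ha : a < N) (hb : b < N) :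
    bitF.Holds N (update ρ bitR R) [a, b] ↔
      b = 0 ∧ a % 2 = 1 ∨ ∃ i, b = i + 1 ∧ R [a / 2, i] := by
  simp (disch := decide) only [bitF, Holds, holds_or, List.cons_append, List.nil_append,
    List.getD_cons_zero, List.getD_cons_succ, List.map_cons, List.map_nil, update_self,
    update_of_ne, zeroR_iff h hb, oddR_iff h ha, exists_succR_left h hb, exists_halfR h ha]

theorem bitR_iff (h : Solved N ρ) {i : ℕ} (ha : a < N) (hi : i < N) :
    ρ bitR [a, i] ↔ a.testBit i = true := by
  obtain ⟨hclosed, hind⟩ := h (.iterate bitR bitF) (by simp [instrs])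
  constructor
  · intro hp
    refine hind (fun l => ∀ a i, l = [a, i] → a.testBit i = true) ?_ _ hp a i rfl
    rintro R hR _ - hlt hF a i rfl
    simp only [List.forall_mem_cons] at hlt
    rcases (holds_bitF h hlt.1 hlt.2.1).1 hF with ⟨rfl, ha⟩ | ⟨i, rfl, hr⟩
    · rwa [Nat.testBit_zero, decide_eq_true_eq]
    · rw [Nat.testBit_succ]
      exact hR _ hr _ _ rfl
  · intro hbit
    refine hclosed _ rfl (by simp [ha, hi]) ((holds_bitF h ha hi).2 ?_)
    induction i generalizing a with
    | zero => exact Or.inl ⟨rfl, by rwa [Nat.testBit_zero, decide_eq_true_eq] at hbit⟩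
    | succ i ih =>
      rw [Nat.testBit_succ] at hbit
      have ha' : a / 2 < N := by omega
      exact Or.inr ⟨i, rfl, hclosed _ rfl (by simp [ha', Nat.lt_of_succ_lt hi])
        ((holds_bitF h ha' (by omega)).2 (ih ha' (by omega) hbit))⟩

theorem exists_bitR (h : Solved N ρ) (ha : a < N) :
    (∃ x < N, ρ bitR [a, x] ∧ Q x) ↔ ∃ x, a.testBit x = true ∧ Q x :=
  exists_congr fun _ => ⟨fun ⟨hx, hb, hQ⟩ => ⟨(bitR_iff h ha hx).1 hb, hQ⟩, fun ⟨hb, hQ⟩ =>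
    ⟨lt_of_testBit ha hb, (bitR_iff h ha (lt_of_testBit ha hb)).2 hb, hQ⟩⟩

theorem forall_bitR (h : Solved N ρ) (ha : a < N) :
    (∀ x < N, ρ bitR [a, x] → Q x) ↔ ∀ x, a.testBit x = true → Q x :=
  forall_congr' fun _ => ⟨fun hQ hb => hQ (lt_of_testBit ha hb)
    ((bitR_iff h ha (lt_of_testBit ha hb)).2 hb), fun hQ hx hb => hQ ((bitR_iff h ha hx).1 hb)⟩

theorem subR_iff (h : Solved N ρ) (ha : a < N) (hb : b < N) :
    ρ subR [a, b] ↔ PayLE (bitSet a) (bitSet b) := by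
  rw [h (.define subR subF) (by simp [instrs]) [a, b] rfl (by simp [ha, hb])]
  simp only [subF, Holds, holds_all, holds_imp, List.cons_append, List.nil_append,
    List.getD_cons_zero, List.getD_cons_succ, List.map_cons, List.map_nil, and_imp]
  refine forall_congr' fun i => ⟨fun hsub hi hai => ?_, fun hsub hiN hi hai => ?_⟩
  · have hiN := lt_of_testBit ha hai
    exact (bitR_iff h hb hiN).1
      (hsub hiN (by rwa [zeroR_iff h hiN]) ((bitR_iff h ha hiN).2 hai))
  · exact (bitR_iff h hb hiN).2
      (hsub (by rwa [zeroR_iff h hiN] at hi) ((bitR_iff h ha hiN).1 hai))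

theorem unionR_iff (h : Solved N ρ) (ha : a < N) (hb : b < N) (hc : c < N) :
    ρ unionR [a, b, c] ↔ c = a ||| b := by
  rw [h (.define unionR unionF) (by simp [instrs]) [a, b, c] rfl (by simp [ha, hb, hc]),
    eq_iff_forall_lt_testBit hc fun i hi => ?_]
  · simp only [unionF, Holds, holds_all, holds_iff, holds_or, List.cons_append, List.nil_append,
      List.getD_cons_zero, List.getD_cons_succ, List.map_cons, List.map_nil]
    refine forall₂_congr fun i hi => ?_
    rw [bitR_iff h ha hi, bitR_iff h hb hi, bitR_iff h hc hi, Nat.testBit_or, Bool.or_eq_true]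
  · rw [Nat.testBit_or, Bool.or_eq_true] at hi
    exact hi.elim (lt_of_testBit ha) (lt_of_testBit hb)

end SPSProgram

/-! ### Reading the input -/

namespace ReachSPInstance

variable (I : ReachSPInstance)

/-- The rows of the encoding of an instance, which all have length `n`: the owners, the initial
vertex, the target sets, the adjacency matrix. -/
def rows : List (List Bool) :=
  (List.ofFn fun v => decide (I.game.arena.owner v = 1)) :: bits {I.game.arena.init} ::
    bits I.game.target₀ :: ((List.ofFn fun i => bits (I.game.target i)) ++
      List.ofFn fun v => List.ofFn fun v' => decide ((v, v') ∈ I.game.arena.E))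

theorem encode_eq : I.encode = List.replicate I.n true ++ false ::
    (List.replicate I.t true ++ false :: I.rows.flatten) := by
  simp [encode, rows]

theorem length_of_mem_rows {l : List Bool} (hl : l ∈ I.rows) : l.length = I.n := by
  simp only [rows, List.mem_cons, List.mem_append, List.mem_ofFn] at hl
  rcases hl with rfl | rfl | rfl | ⟨i, rfl⟩ | ⟨i, rfl⟩ <;> simp [bits]

theorem n_pos : 0 < I.n := Fin.pos I.game.arena.init

theorem length_encode : I.encode.length = I.n + I.t + 2 + (3 + I.t + I.n) * I.n := by
  have hrows : I.rows.flatten.length = (3 + I.t + I.n) * I.n := by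
    rw [List.length_flatten, List.map_congr_left fun l hl => I.length_of_mem_rows hl,
      List.map_const', List.sum_replicate, smul_eq_mul]
    simp only [rows, List.length_cons, List.length_append, List.length_ofFn]
    ring
  rw [encode_eq]
  simp only [List.length_append, List.length_cons, List.length_replicate, hrows]
  ring

theorem getElem?_flatten_of_length {α : Type*} {L : List (List α)} {n : ℕ}
    (hL : ∀ l ∈ L, l.length = n) {k j : ℕ} (hj : j < n) :
    L.flatten[k * n + j]? = (L[k]?.getD [])[j]? := by
  induction L generalizing k with
  | nil => simp
  | cons l L ih =>
    have hl : l.length = n := hL l List.mem_cons_self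
    rw [List.flatten_cons]
    cases k with
    | zero =>
      rw [List.getElem?_append_left (by omega)]
      simp
    | succ k =>
      rw [List.getElem?_append_right (by rw [hl]; linarith [Nat.le_mul_of_pos_left n k.succ_pos]),
        hl, show (k + 1) * n + j - n = k * n + j by rw [add_mul]; omega,
        ih fun l hl => hL l (List.mem_cons_of_mem _ hl), List.getElem?_cons_succ]

theorem getD_encode_of_lt {i : ℕ} (hi : i < I.n) : I.encode.getD i false = true := by
  rw [encode_eq, List.getD_append _ _ _ _ (by simpa using hi), List.getD_replicate true hi]

theorem getD_encode_n : I.encode.getD I.n false = false := by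
  rw [encode_eq, List.getD_append_right _ _ _ _ (by simp)]
  simp

theorem getD_encode_add (i : ℕ) : I.encode.getD (I.n + 1 + i) false =
    (List.replicate I.t true ++ false :: I.rows.flatten).getD i false := by
  rw [encode_eq, List.getD_append_right _ _ _ _ (by simp; omega), List.length_replicate,
    show I.n + 1 + i - I.n = i + 1 by omega, List.getD_cons_succ]

theorem getD_encode_of_lt_t {i : ℕ} (hi : i < I.t) : I.encode.getD (I.n + 1 + i) false = true := by
  rw [getD_encode_add, List.getD_append _ _ _ _ (by simpa using hi), List.getD_replicate true hi]

theorem getD_encode_t : I.encode.getD (I.n + 1 + I.t) false = false := by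
  rw [getD_encode_add, List.getD_append_right _ _ _ _ (by simp)]
  simp

/-- The bit `j` of the row `k`. -/
def entry (k j : ℕ) : Bool := (I.rows[k]?.getD []).getD j false

theorem getD_encode_row {k j : ℕ} (hj : j < I.n) :
    I.encode.getD (I.n + I.t + 2 + k * I.n + j) false = I.entry k j := by
  rw [show I.n + I.t + 2 + k * I.n + j = I.n + 1 + (I.t + 1 + (k * I.n + j)) by ring,
    getD_encode_add, List.getD_append_right _ _ _ _ (by simp; omega), List.length_replicate,
    show I.t + 1 + (k * I.n + j) - I.t = k * I.n + j + 1 by omega, List.getD_cons_succ,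
    List.getD_eq_getElem?_getD, getElem?_flatten_of_length (fun l hl => I.length_of_mem_rows hl) hj,
    entry, List.getD_eq_getElem?_getD]

theorem getD_bits {S : Finset (Fin I.n)} {v : Fin I.n} :
    (bits S).getD v false = true ↔ v ∈ S := by
  simp [bits]

theorem entry_owner {v : Fin I.n} : I.entry 0 v = true ↔ I.game.arena.owner v = 1 := by
  simp [entry, rows]

theorem entry_init {v : Fin I.n} : I.entry 1 v = true ↔ v = I.game.arena.init := by
  rw [entry, rows, List.getElem?_cons_succ, List.getElem?_cons_zero, Option.getD_some, getD_bits,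
    Finset.mem_singleton]

theorem entry_target {i : ℕ} (hi : i ≤ I.t) {v : Fin I.n} :
    I.entry (i + 2) v = true ↔ i ∈ I.game.colours v := by
  rw [entry, rows, List.getElem?_cons_succ, List.getElem?_cons_succ]
  cases i with
  | zero =>
    rw [List.getElem?_cons_zero, Option.getD_some, getD_bits, I.game.zero_mem_colours]
  | succ i =>
    rw [List.getElem?_cons_succ, List.getElem?_append_left (by simpa using hi),
      List.getElem?_ofFn, dif_pos (show i < I.t from hi), Option.getD_some, getD_bits]
    exact (I.game.succ_mem_colours (i := ⟨i, hi⟩)).symm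

theorem entry_edge {v u : Fin I.n} :
    I.entry (I.t + v + 1 + 2) u = true ↔ (v, u) ∈ I.game.arena.E := by
  rw [entry, rows, List.getElem?_cons_succ, List.getElem?_cons_succ, List.getElem?_cons_succ,
    List.getElem?_append_right (by simp)]
  simp

end ReachSPInstance

namespace SPSProgram

open FOFormula ReachSPInstance

/-- The relations of `ρ` are those that the program computes from the encoding of `I` on the
universe `N`, which is large enough for the codes of all sets of payoffs. -/
structure Correct (I : ReachSPInstance) (N : ℕ) (ρ : RelStore) : Prop where
  solved : Solved N ρ
  size : N = I.encode.length * 2 ^ 2 ^ (I.t + 1)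
  input : ∀ i, ρ inpR [i] ↔ I.encode.getD i false = true

namespace Correct

variable {I : ReachSPInstance} {N : ℕ} {ρ : RelStore} {Q : ℕ → Prop}

theorem length_le (h : Correct I N ρ) : I.encode.length ≤ N := by
  rw [h.size]
  exact Nat.le_mul_of_pos_right _ (by positivity)

theorem row_lt (h : Correct I N ρ) {k j : ℕ} (hk : k < 3 + I.t + I.n) (hj : j < I.n) :
    I.n + I.t + 2 + k * I.n + j < N := by
  refine lt_of_lt_of_le ?_ h.length_le
  rw [length_encode]
  nlinarith

theorem n_add_t_lt (h : Correct I N ρ) : I.n + I.t + 4 < N := by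
  have hlen := h.length_le
  rw [length_encode] at hlen
  have hrow : 3 + I.t + I.n ≤ (3 + I.t + I.n) * I.n := Nat.le_mul_of_pos_right _ I.n_pos
  omega

theorem two_pow_le (h : Correct I N ρ) : 2 ^ 2 ^ (I.t + 1) ≤ N := by
  rw [h.size]
  refine Nat.le_mul_of_pos_left _ ?_
  rw [length_encode]
  omega

theorem fin_lt (h : Correct I N ρ) (v : Fin I.n) : (v : ℕ) < N := by
  have := h.n_add_t_lt
  omega

theorem isnR_iff (h : Correct I N ρ) {a : ℕ} (ha : a < N) : ρ isnR [a] ↔ a = I.n := by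
  rw [h.solved (.define isnR isnF) (by simp [instrs]) [a] rfl (by simpa using ha)]
  simp only [isnF, Holds, holds_all, holds_imp, List.cons_append, List.nil_append,
    List.getD_cons_zero, List.getD_cons_succ, List.map_cons, List.map_nil, h.input]
  constructor
  · rintro ⟨hend, hones⟩
    rcases lt_trichotomy a I.n with hlt | rfl | hgt
    · exact absurd (I.getD_encode_of_lt hlt) hend
    · rfl
    · exact absurd (I.getD_encode_n.symm.trans (hones I.n (hgt.trans ha) hgt)) Bool.false_ne_true
  · rintro rfl
    exact ⟨by rw [I.getD_encode_n]; exact Bool.false_ne_true, fun b _ hb => I.getD_encode_of_lt hb⟩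

theorem exists_isnR (h : Correct I N ρ) : (∃ x < N, ρ isnR [x] ∧ Q x) ↔ Q I.n :=
  exists_lt_and_iff_of_forall (by have := h.n_add_t_lt; omega) fun _ => h.isnR_iff

theorem istR_iff (h : Correct I N ρ) {a : ℕ} (ha : a < N) : ρ istR [a] ↔ a = I.t := by
  have hnt := h.n_add_t_lt
  rw [h.solved (.define istR istF) (by simp [instrs]) [a] rfl (by simpa using ha)]
  simp only [istF, Holds, holds_all, holds_imp, List.cons_append, List.nil_append,
    List.getD_cons_zero, List.getD_cons_succ, List.map_cons, List.map_nil, h.input, h.exists_isnR,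
    exists_succR h.solved (show I.n + 1 < N by omega)]
  constructor
  · rintro ⟨m, hm, hplus, hend, hones⟩
    obtain rfl := (plusR_iff h.solved (by omega) ha hm).1 hplus
    rcases lt_trichotomy a I.t with hlt | rfl | hgt
    · exact absurd (I.getD_encode_of_lt_t hlt) hend
    · rfl
    · exact absurd (I.getD_encode_t.symm.trans
        (hones (I.n + 1 + I.t) (by omega) ⟨by omega, by omega⟩)) Bool.false_ne_true
  · rintro rfl
    rw [exists_plusR h.solved (by omega), I.getD_encode_t]
    refine ⟨Bool.false_ne_true, fun b _ hb => ?_⟩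
    obtain ⟨c, rfl⟩ := Nat.exists_eq_add_of_le (not_lt.1 hb.1)
    exact I.getD_encode_of_lt_t (by omega)

theorem exists_istR (h : Correct I N ρ) : (∃ x < N, ρ istR [x] ∧ Q x) ↔ Q I.t :=
  exists_lt_and_iff_of_forall (by have := h.n_add_t_lt; omega) fun _ => h.istR_iff

theorem fieldR_iff (h : Correct I N ρ) {k j : ℕ} (hk : k < 3 + I.t + I.n) (hj : j < N) :
    ρ fieldR [k, j] ↔ j < I.n ∧ I.entry k j = true := by
  have hnt := h.n_add_t_lt
  rw [h.solved (.define fieldR fieldF) (by simp [instrs]) [k, j] rfl (by simp; omega)]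
  simp only [fieldF, Holds, List.cons_append, List.nil_append, List.getD_cons_zero,
    List.getD_cons_succ, List.map_cons, List.map_nil, h.input, h.exists_isnR, h.exists_istR]
  refine and_congr_right fun hjn => ?_
  have hpos := h.row_lt hk hjn
  rw [exists_plusR h.solved (by omega), exists_twoR h.solved (by omega),
    exists_timesR h.solved (by omega) (by omega) (by omega), exists_plusR h.solved (by omega),
    exists_plusR h.solved hpos, I.getD_encode_row hjn]

theorem edgeR_iff (h : Correct I N ρ) {v : Fin I.n} {u : ℕ} (hu : u < N) :
    ρ edgeR [v, u] ↔ ∃ hu : u < I.n, (v, ⟨u, hu⟩) ∈ I.game.arena.E := by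
  have hnt := h.n_add_t_lt
  rw [h.solved (.define edgeR edgeF) (by simp [instrs]) [v, u] rfl (by simp [h.fin_lt, hu])]
  simp only [edgeF, Holds, List.cons_append, List.nil_append, List.getD_cons_zero,
    List.getD_cons_succ, List.map_cons, List.map_nil, h.exists_istR]
  rw [exists_plusR h.solved (by omega), exists_succR h.solved (by omega),
    exists_twoR h.solved (by omega), h.fieldR_iff (by omega) hu, ← exists_prop]
  exact exists_congr fun hu => I.entry_edge (u := ⟨u, hu⟩)

theorem exists_edgeR (h : Correct I N ρ) {v : Fin I.n} :
    (∃ u < N, ρ edgeR [v, u] ∧ Q u) ↔ ∃ u : Fin I.n, (v, u) ∈ I.game.arena.E ∧ Q u := by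
  constructor
  · rintro ⟨u, hu, he, hQ⟩
    obtain ⟨hu, he⟩ := (h.edgeR_iff hu).1 he
    exact ⟨⟨u, hu⟩, he, hQ⟩
  · rintro ⟨u, he, hQ⟩
    exact ⟨u, h.fin_lt u, (h.edgeR_iff (h.fin_lt u)).2 ⟨u.2, he⟩, hQ⟩

theorem forall_edgeR (h : Correct I N ρ) {v : Fin I.n} :
    (∀ u < N, ρ edgeR [v, u] → Q u) ↔ ∀ u : Fin I.n, (v, u) ∈ I.game.arena.E → Q u := by
  simpa only [not_exists, not_and, not_not] using
    not_congr (h.exists_edgeR (v := v) (Q := fun u => ¬ Q u))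

theorem ownR_iff (h : Correct I N ρ) {v : Fin I.n} :
    ρ ownR [v] ↔ I.game.arena.owner v = 1 := by
  have hnt := h.n_add_t_lt
  rw [h.solved (.define ownR ownF) (by simp [instrs]) [v] rfl (by simp [h.fin_lt])]
  simp only [ownF, Holds, List.cons_append, List.nil_append, List.getD_cons_zero,
    List.getD_cons_succ, List.map_cons, List.map_nil]
  rw [exists_zeroR h.solved (by omega), h.fieldR_iff (by omega) (h.fin_lt v), I.entry_owner]
  exact and_iff_right v.2

theorem exists_initR (h : Correct I N ρ) :
    (∃ v < N, ρ fieldR [1, v] ∧ Q v) ↔ Q I.game.arena.init := by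
  refine exists_lt_and_iff_of_forall (h.fin_lt _) fun v hv => ?_
  rw [h.fieldR_iff (by omega) hv, ← exists_prop]
  exact (exists_congr fun hv => I.entry_init (v := ⟨v, hv⟩)).trans
    ⟨fun ⟨hv, he⟩ => congrArg Fin.val he, by rintro rfl; exact ⟨Fin.is_lt _, rfl⟩⟩

theorem colR_iff (h : Correct I N ρ) {v : Fin I.n} {i : ℕ} (hi : i < N) :
    ρ colR [v, i] ↔ i ∈ I.game.colours v := by
  have hnt := h.n_add_t_lt
  rw [h.solved (.define colR colF) (by simp [instrs]) [v, i] rfl (by simp [h.fin_lt, hi])]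
  simp only [colF, Holds, List.cons_append, List.nil_append, List.getD_cons_zero,
    List.getD_cons_succ, List.map_cons, List.map_nil, h.exists_istR, not_lt]
  by_cases hit : i ≤ I.t
  · rw [exists_twoR h.solved (by omega), h.fieldR_iff (by omega) (h.fin_lt v),
      I.entry_target hit, and_iff_right hit, and_iff_right v.2]
  · exact iff_of_false (fun hc => hit hc.1) fun hc => hit (I.game.le_of_mem_colours hc)

end Correct

end SPSProgram

/-! ### Distributing a set of payoffs -/

section

variable {n : ℕ} {α : Type*}

/-- The set `S` is the union of sets `F u`, for the `u ∈ A` below `j`, such that `G u (F u)`. -/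
def Distributed (A : Set (Fin n)) (G : Fin n → Set α → Prop) (j : ℕ) (S : Set α) : Prop :=
  ∃ F : Fin n → Set α, (∀ p ∈ S, ∃ u ∈ A, (u : ℕ) < j ∧ p ∈ F u) ∧
    ∀ u ∈ A, (u : ℕ) < j → F u ⊆ S ∧ G u (F u)

variable {A : Set (Fin n)} {G : Fin n → Set α → Prop} {S : Set α}

theorem distributed_zero_iff : Distributed A G 0 S ↔ S = ∅ := by
  simp [Distributed, Set.eq_empty_iff_forall_notMem]

theorem distributed_succ_iff_of_notMem {j : Fin n} (hj : j ∉ A) :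
    Distributed A G (j + 1) S ↔ Distributed A G j S := by
  have hlt : ∀ u ∈ A, ((u : ℕ) < j + 1 ↔ (u : ℕ) < j) := fun u hu => by
    have hne : (u : ℕ) ≠ j := fun h => hj (Fin.ext h ▸ hu)
    omega
  simp +contextual only [Distributed, hlt, ← exists_prop]

theorem distributed_succ_iff_of_mem {j : Fin n} (hj : j ∈ A) :
    Distributed A G (j + 1) S ↔ ∃ S₁ S₂, S₁ ∪ S₂ = S ∧ G j S₁ ∧ Distributed A G j S₂ := by
  have hlt : ∀ u : Fin n, (u : ℕ) < j + 1 ↔ u = j ∨ (u : ℕ) < j := fun u => by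
    rw [Nat.lt_succ_iff_lt_or_eq, or_comm, Fin.ext_iff]
  constructor
  · rintro ⟨F, hS, hF⟩
    refine ⟨F j, {p | ∃ u ∈ A, (u : ℕ) < j ∧ p ∈ F u}, subset_antisymm ?_ fun p hp => ?_,
      (hF j hj j.val.lt_succ_self).2, F, fun p hp => hp,
      fun u hu huj => ⟨fun p hp => ⟨u, hu, huj, hp⟩, (hF u hu ((hlt u).2 (Or.inr huj))).2⟩⟩
    · refine Set.union_subset (hF j hj j.val.lt_succ_self).1 ?_
      rintro p ⟨u, hu, huj, hp⟩
      exact (hF u hu ((hlt u).2 (Or.inr huj))).1 hp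
    · obtain ⟨u, hu, huj, hpu⟩ := hS p hp
      rcases (hlt u).1 huj with rfl | huj
      · exact Or.inl hpu
      · exact Or.inr ⟨u, hu, huj, hpu⟩
  · rintro ⟨S₁, S₂, rfl, hG, F, hS, hF⟩
    have hne : ∀ u : Fin n, (u : ℕ) < j → update F j S₁ u = F u := fun u huj =>
      update_of_ne (by rintro rfl; exact huj.false) _ _
    refine ⟨update F j S₁, ?_, fun u hu huj => ?_⟩
    · rintro p (hp | hp)
      · exact ⟨j, hj, j.val.lt_succ_self, by rwa [update_self]⟩
      · obtain ⟨u, hu, huj, hpu⟩ := hS p hp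
        exact ⟨u, hu, huj.trans j.val.lt_succ_self, by rwa [hne u huj]⟩
    · rcases (hlt u).1 huj with rfl | huj
      · rw [update_self]
        exact ⟨Set.subset_union_left, hG⟩
      · rw [hne u huj]
        exact ⟨(hF u hu huj).1.trans Set.subset_union_right, (hF u hu huj).2⟩

end

namespace ReachSPGame

variable {n t : ℕ} {g : ReachSPGame (Fin n) t} {W S : Set (Set ℕ)} {v : Fin n} {c : Set ℕ}

/-- The meaning of the relation `goodR` of the program: `Good` at the index `0`, and at the index
`j + 1` a distribution of the payoffs among the successors below `j`. -/
def GoodAt (g : ReachSPGame (Fin n) t) (W : Set (Set ℕ)) (v : Fin n) (c : Set ℕ) :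
    ℕ → Set (Set ℕ) → Prop
  | 0, S => g.Good W v c S
  | j + 1, S =>
    Distributed {u | (v, u) ∈ g.arena.E} (fun u => g.Good W u (c ∪ g.colours u)) j S

theorem goodAt_one_iff : g.GoodAt W v c 1 S ↔ S = ∅ := distributed_zero_iff

theorem goodAt_add_two_iff_of_notMem {u : Fin n} (hu : (v, u) ∉ g.arena.E) :
    g.GoodAt W v c (u + 2) S ↔ g.GoodAt W v c (u + 1) S :=
  distributed_succ_iff_of_notMem hu

theorem goodAt_add_two_iff_of_mem {u : Fin n} (hu : (v, u) ∈ g.arena.E) :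
    g.GoodAt W v c (u + 2) S ↔
      ∃ S₁ S₂, S₁ ∪ S₂ = S ∧ g.Good W u (c ∪ g.colours u) S₁ ∧ g.GoodAt W v c (u + 1) S₂ :=
  distributed_succ_iff_of_mem hu

theorem GoodAt.good (h : g.GoodAt W v c (n + 1) S) (hv : g.arena.owner v = 1) :
    g.Good W v c S := by
  obtain ⟨F, hS, hF⟩ := h
  refine .one F hv (fun p hp => ?_) (fun u hu => (hF u hu u.2).1) fun u hu => (hF u hu u.2).2
  obtain ⟨u, hu, -, hpu⟩ := hS p hp
  exact ⟨u, hu, hpu⟩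

end ReachSPGame

/-! ### Correctness of the program -/

namespace SPSProgram

open FOFormula ReachSPInstance ReachSPGame

namespace Correct

variable {I : ReachSPInstance} {N : ℕ} {ρ : RelStore} {Q : ℕ → Prop} {R : List ℕ → Prop}
  {s : Set ℕ} {v : Fin I.n}

local notation "#" s => code (I.t + 1) s

theorem code_lt (h : Correct I N ρ) (s : Set ℕ) : (#s) < N :=
  (_root_.code_lt _ s).trans (Nat.lt_two_pow_self.trans_le h.two_pow_le)

theorem testBit_code (hs : s ⊆ Set.Iio (I.t + 1)) {i : ℕ} : (#s).testBit i = true ↔ i ∈ s := by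
  rw [← mem_bitSet, bitSet_code hs]

theorem union_colours_subset (hs : s ⊆ Set.Iio (I.t + 1)) (u : Fin I.n) :
    s ∪ I.game.colours u ⊆ Set.Iio (I.t + 1) :=
  Set.union_subset hs fun _ hi => Nat.lt_succ_of_le (I.game.le_of_mem_colours hi)

theorem stepR_iff (h : Correct I N ρ) (hs : s ⊆ Set.Iio (I.t + 1)) {c : ℕ} (hc : c < N) :
    ρ stepR [#s, v, c] ↔ c = #(s ∪ I.game.colours v) := by
  rw [h.solved (.define stepR stepF) (by simp [instrs]) _ rfl (by simp [h.code_lt, h.fin_lt, hc]),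
    eq_iff_forall_lt_testBit hc fun i => lt_of_testBit (h.code_lt _)]
  simp only [stepF, holds_all, holds_iff, holds_or, Holds, List.cons_append, List.nil_append,
    List.getD_cons_zero, List.getD_cons_succ, List.map_cons, List.map_nil]
  refine forall₂_congr fun i hi => ?_
  rw [bitR_iff h.solved hc hi, bitR_iff h.solved (h.code_lt s) hi, h.colR_iff hi, testBit_code hs,
    testBit_code (union_colours_subset hs v), Set.mem_union]

theorem exists_stepR (h : Correct I N ρ) (hs : s ⊆ Set.Iio (I.t + 1)) :
    (∃ c < N, ρ stepR [#s, v, c] ∧ Q c) ↔ Q (#(s ∪ I.game.colours v)) :=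
  exists_lt_and_iff_of_forall (h.code_lt _) fun _ hc => h.stepR_iff hs hc

theorem forall_stepR (h : Correct I N ρ) (hs : s ⊆ Set.Iio (I.t + 1)) :
    (∀ c < N, ρ stepR [#s, v, c] → Q c) ↔ Q (#(s ∪ I.game.colours v)) := by
  simpa only [not_exists, not_and, not_not] using
    not_congr (h.exists_stepR (v := v) hs (Q := fun c => ¬ Q c))

theorem holds_attrF (h : Correct I N ρ) (hs : s ⊆ Set.Iio (I.t + 1)) :
    attrF.Holds N (update ρ attrR R) [v, #s] ↔ 0 ∈ s ∨
      (I.game.arena.owner v = 0 ∧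
        ∃ u : Fin I.n, (v, u) ∈ I.game.arena.E ∧ R [u, #(s ∪ I.game.colours u)]) ∨
      (I.game.arena.owner v = 1 ∧
        ∀ u : Fin I.n, (v, u) ∈ I.game.arena.E → R [u, #(s ∪ I.game.colours u)]) := by
  have hN : 0 < N := (h.code_lt s).pos
  simp (disch := decide) only [attrF, Holds, holds_or, holds_all, holds_imp, List.cons_append,
    List.nil_append, List.getD_cons_zero, List.getD_cons_succ, List.map_cons, List.map_nil,
    update_self, update_of_ne, exists_zeroR h.solved hN, h.ownR_iff, I.game.arena.owner_ne_one_iff,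
    bitR_iff h.solved (h.code_lt s) hN, testBit_code hs, h.exists_edgeR, h.forall_edgeR,
    h.exists_stepR hs, h.forall_stepR hs]

theorem attrR_iff (h : Correct I N ρ) (hs : s ⊆ Set.Iio (I.t + 1)) :
    ρ attrR [v, #s] ↔ I.game.Attr v s := by
  obtain ⟨hclosed, hind⟩ := h.solved (.iterate attrR attrF) (by simp [instrs])
  have hclosed {v s} (hs : s ⊆ Set.Iio (I.t + 1)) := fun hF =>
    hclosed [(v : Fin I.n), #s] rfl (by simp [h.fin_lt, h.code_lt]) ((h.holds_attrF hs).2 hF)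
  constructor
  · intro hp
    refine hind (fun l => ∀ (v : Fin I.n) (s : Set ℕ), s ⊆ Set.Iio (I.t + 1) → l = [↑v, #s] →
      I.game.Attr v s) ?_ _ hp v s hs rfl
    rintro R hR _ - - hF v s hs rfl
    rcases (h.holds_attrF hs).1 hF with h0 | ⟨hv, u, he, hr⟩ | ⟨hv, hr⟩
    · exact .base h0
    · exact .zero hv he (hR _ hr u _ (union_colours_subset hs u) rfl)
    · exact .one hv fun u he => hR _ (hr u he) u _ (union_colours_subset hs u) rfl
  · intro hA
    induction hA with
    | base h0 => exact hclosed hs (Or.inl h0)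
    | zero hv he _ ih =>
      exact hclosed hs (Or.inr (Or.inl ⟨hv, _, he, ih (union_colours_subset hs _)⟩))
    | one hv _ ih =>
      exact hclosed hs (Or.inr (Or.inr ⟨hv, fun u he => ih u he (union_colours_subset hs u)⟩))

theorem belowR_iff (h : Correct I N ρ) {W : ℕ} (hW : W < N) (hs : s ⊆ Set.Iio (I.t + 1)) :
    ρ belowR [W, #s] ↔ Below (bitSets W) s := by
  rw [h.solved (.define belowR belowF) (by simp [instrs]) _ rfl (by simp [h.code_lt, hW])]
  simp only [belowF, Holds, List.cons_append, List.nil_append, List.getD_cons_zero,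
    List.getD_cons_succ, List.map_cons, List.map_nil, exists_bitR h.solved hW, Below, bitSets,
    Set.exists_mem_image, mem_bitSet]
  refine exists_congr fun p => and_congr_right fun hp => ?_
  have hpN := lt_of_testBit hW hp
  rw [subR_iff h.solved (h.code_lt s) hpN, subR_iff h.solved hpN (h.code_lt s), bitSet_code hs]

theorem holds_loseF (h : Correct I N ρ) {W : ℕ} (hW : W < N) (hs : s ⊆ Set.Iio (I.t + 1)) :
    loseF.Holds N (update ρ loseR R) [W, v, #s] ↔ ¬ I.game.Attr v s ∧
      (¬ Below (bitSets W) s ∨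
      (I.game.arena.owner v = 0 ∧
        ∀ u : Fin I.n, (v, u) ∈ I.game.arena.E → R [W, u, #(s ∪ I.game.colours u)]) ∨
      (I.game.arena.owner v = 1 ∧
        ∃ u : Fin I.n, (v, u) ∈ I.game.arena.E ∧ R [W, u, #(s ∪ I.game.colours u)])) := by
  simp (disch := decide) only [loseF, Holds, holds_or, holds_all, holds_imp, List.cons_append,
    List.nil_append, List.getD_cons_zero, List.getD_cons_succ, List.map_cons, List.map_nil,
    update_self, update_of_ne, h.ownR_iff, I.game.arena.owner_ne_one_iff, h.attrR_iff hs,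
    h.belowR_iff hW hs, h.exists_edgeR, h.forall_edgeR, h.exists_stepR hs, h.forall_stepR hs]

theorem loseR_iff (h : Correct I N ρ) {W : ℕ} (hW : W < N) (hs : s ⊆ Set.Iio (I.t + 1)) :
    ρ loseR [W, v, #s] ↔ I.game.Lose (bitSets W) v s := by
  obtain ⟨hclosed, hind⟩ := h.solved (.iterate loseR loseF) (by simp [instrs])
  have hclosed {v s} (hs : s ⊆ Set.Iio (I.t + 1)) := fun hF => hclosed [W, (v : Fin I.n), #s] rfl
    (by simp [hW, h.fin_lt, h.code_lt]) ((h.holds_loseF hW hs).2 hF)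
  constructor
  · intro hp
    refine hind (fun l => ∀ (v : Fin I.n) (s : Set ℕ), s ⊆ Set.Iio (I.t + 1) → l = [W, ↑v, #s] →
      I.game.Lose (bitSets W) v s) ?_ _ hp v s hs rfl
    rintro R hR _ - - hF v s hs rfl
    obtain ⟨hA, hb | ⟨hv, hr⟩ | ⟨hv, u, he, hr⟩⟩ := (h.holds_loseF hW hs).1 hF
    · exact .base hA hb
    · exact .zero hA hv fun u he => hR _ (hr u he) u _ (union_colours_subset hs u) rfl
    · exact .one hA hv he (hR _ hr u _ (union_colours_subset hs u) rfl)
  · intro hL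
    induction hL with
    | base hA hb => exact hclosed hs ⟨hA, Or.inl hb⟩
    | zero hA hv _ ih =>
      exact hclosed hs
        ⟨hA, Or.inr (Or.inl ⟨hv, fun u he => ih u he (union_colours_subset hs u)⟩)⟩
    | one hA hv he _ ih =>
      exact hclosed hs ⟨hA, Or.inr (Or.inr ⟨hv, _, he, ih (union_colours_subset hs _)⟩)⟩

variable {W S j : ℕ}

theorem forall_bitSets_payLE_iff (h : Correct I N ρ) (hS : S < N) (hs : s ⊆ Set.Iio (I.t + 1)) :
    (∀ p < N, ρ bitR [S, p] → ρ subR [p, #s]) ↔ ∀ p ∈ bitSets S, PayLE p s := by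
  rw [forall_bitR h.solved hS, bitSets, Set.forall_mem_image]
  refine forall₂_congr fun p hp => ?_
  rw [subR_iff h.solved (lt_of_testBit hS hp) (h.code_lt s), bitSet_code hs]

theorem holds_goodF_zero (h : Correct I N ρ) (hW : W < N) (hS : S < N)
    (hs : s ⊆ Set.Iio (I.t + 1)) :
    goodF.Holds N (update ρ goodR R) [W, v, #s, 0, S] ↔
      ((∀ p ∈ bitSets S, PayLE p s) ∧ ¬ I.game.Lose (bitSets W) v s) ∨
      (I.game.arena.owner v = 0 ∧
        ∃ u : Fin I.n, (v, u) ∈ I.game.arena.E ∧ R [W, u, #(s ∪ I.game.colours u), 0, S]) ∨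
      (I.game.arena.owner v = 1 ∧ R [W, v, #s, I.n + 1, S]) := by
  have hnt := h.n_add_t_lt
  have hN : 0 < N := by omega
  simp (disch := decide) only [goodF, Holds, holds_or, holds_all, holds_imp, List.cons_append,
    List.nil_append, List.getD_cons_zero, List.getD_cons_succ, List.map_cons, List.map_nil,
    update_self, update_of_ne, zeroR_iff h.solved hN, exists_zeroR h.solved hN, true_and,
    h.forall_bitSets_payLE_iff hS hs, h.loseR_iff hW hs, h.ownR_iff,
    I.game.arena.owner_ne_one_iff, h.exists_edgeR, h.exists_stepR hs, h.exists_isnR,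
    exists_succR h.solved (show I.n + 1 < N by omega), succR_iff h.solved hN hN,
    exists_twoR_left h.solved hN, reduceCtorEq, false_and, exists_false, or_false]

theorem holds_goodF_one (h : Correct I N ρ) (hS : S < N) :
    goodF.Holds N (update ρ goodR R) [W, v, #s, 1, S] ↔ S = 0 := by
  have hnt := h.n_add_t_lt
  have hN : 0 < N := by omega
  have hN' : 1 < N := by omega
  simp (disch := decide) only [goodF, Holds, holds_or, List.cons_append, List.nil_append,
    List.getD_cons_zero, List.getD_cons_succ, List.map_cons, List.map_nil, update_of_ne,
    zeroR_iff h.solved hS, zeroR_iff h.solved hN', exists_zeroR h.solved hN,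
    succR_iff h.solved hN hN', zero_add, exists_twoR_left h.solved hN', Nat.reduceEqDiff,
    one_ne_zero, true_and, false_and, exists_false, false_or, or_false]

theorem holds_goodF_add_two (h : Correct I N ρ) (hS : S < N) (hs : s ⊆ Set.Iio (I.t + 1))
    {i : Fin I.n} :
    goodF.Holds N (update ρ goodR R) [W, v, #s, i + 2, S] ↔
      ((v, i) ∉ I.game.arena.E ∧ R [W, v, #s, i + 1, S]) ∨
      ((v, i) ∈ I.game.arena.E ∧ ∃ a < N, ∃ b < N, S = a ||| b ∧
        R [W, i, #(s ∪ I.game.colours i), 0, a] ∧ R [W, v, #s, i + 1, b]) := by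
  have hnt := h.n_add_t_lt
  have hN : 0 < N := by omega
  have hi : (i : ℕ) + 2 < N := by omega
  simp (disch := decide) only [goodF, Holds, holds_or, List.cons_append, List.nil_append,
    List.getD_cons_zero, List.getD_cons_succ, List.map_cons, List.map_nil, update_self,
    update_of_ne, zeroR_iff h.solved hi, exists_zeroR h.solved hN, succR_iff h.solved hN hi,
    exists_twoR_left h.solved hi, Nat.add_right_cancel_iff, exists_eq_left',
    exists_succR h.solved (show (i : ℕ) + 1 < N by omega), h.exists_stepR hs, reduceCtorEq,
    false_and, false_or, Nat.reduceEqDiff, zero_add, h.edgeR_iff (h.fin_lt i), i.2,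
    exists_true_left]
  refine or_congr_right (and_congr_right fun _ => exists_congr fun a => and_congr_right fun ha =>
    exists_congr fun b => and_congr_right fun hb => ?_)
  rw [unionR_iff h.solved ha hb hS]

theorem goodAt_of_goodR (h : Correct I N ρ) (hW : W < N) (hs : s ⊆ Set.Iio (I.t + 1))
    (hj : j ≤ I.n + 1) (hp : ρ goodR [W, v, #s, j, S]) :
    I.game.GoodAt (bitSets W) v s j (bitSets S) := by
  refine (h.solved (.iterate goodR goodF) (by simp [instrs])).2
    (fun l => ∀ (v : Fin I.n) (s : Set ℕ) (j S : ℕ), s ⊆ Set.Iio (I.t + 1) → j ≤ I.n + 1 →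
      l = [W, ↑v, #s, j, S] → I.game.GoodAt (bitSets W) v s j (bitSets S)) ?_ _ hp v s j S hs hj rfl
  rintro R hR _ - hlt hF v s j S hs hj rfl
  have hS : S < N := hlt S (by simp)
  match j with
  | 0 =>
    rcases (h.holds_goodF_zero hW hS hs).1 hF with ⟨hle, hl⟩ | ⟨hv, u, he, hr⟩ | ⟨hv, hr⟩
    · exact .leaf hle hl
    · exact .zero hv he (hR _ hr u _ 0 S (union_colours_subset hs u) (Nat.zero_le _) rfl)
    · exact GoodAt.good (hR _ hr v s (I.n + 1) S hs le_rfl rfl) hv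
  | 1 =>
    obtain rfl := (h.holds_goodF_one hS).1 hF
    exact goodAt_one_iff.2 (bitSets_eq_empty_iff.2 rfl)
  | i + 2 =>
    let u : Fin I.n := ⟨i, by omega⟩
    rcases (h.holds_goodF_add_two hS hs (i := u)).1 hF with
      ⟨he, hr⟩ | ⟨he, a, -, b, -, rfl, hra, hrb⟩
    · exact (goodAt_add_two_iff_of_notMem he).2 (hR _ hr v s (u + 1) S hs (by omega) rfl)
    · exact (goodAt_add_two_iff_of_mem he).2 ⟨_, _, (bitSets_or a b).symm,
        hR _ hra u _ 0 a (union_colours_subset hs u) (Nat.zero_le _) rfl,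
        hR _ hrb v s (u + 1) b hs (by omega) rfl⟩

theorem goodR_of_holds (h : Correct I N ρ) (hW : W < N) (hj : j ≤ I.n + 1) (hS : S < N)
    (hF : goodF.Holds N (update ρ goodR (ρ goodR)) [W, v, #s, j, S]) :
    ρ goodR [W, v, #s, j, S] := by
  have hjN : j < N := by have := h.n_add_t_lt; omega
  exact (h.solved (.iterate goodR goodF) (by simp [instrs])).1 _ rfl
    (by simp [hW, hS, hjN, h.fin_lt, h.code_lt]) hF

theorem goodR_of_distributed (h : Correct I N ρ) (hW : W < N) (hs : s ⊆ Set.Iio (I.t + 1))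
    (hj : j ≤ I.n) (hS : S < N)
    (hd : Distributed {u | (v, u) ∈ I.game.arena.E} (fun u X => ∀ a < N, bitSets a = X →
      ρ goodR [W, u, #(s ∪ I.game.colours u), 0, a]) j (bitSets S)) :
    ρ goodR [W, v, #s, j + 1, S] := by
  refine h.goodR_of_holds hW (Nat.succ_le_succ hj) hS ?_
  induction j generalizing S with
  | zero => exact (h.holds_goodF_one hS).2 (bitSets_eq_empty_iff.1 (distributed_zero_iff.1 hd))
  | succ i ih =>
    have ih {S} (hS : S < N) hd := h.goodR_of_holds hW (by omega) hS (ih (S := S) (by omega) hS hd)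
    refine (h.holds_goodF_add_two hS hs (i := ⟨i, hj⟩)).2 ?_
    by_cases he : (v, ⟨i, hj⟩) ∈ I.game.arena.E
    · obtain ⟨S₁, S₂, hu, hS₁, hS₂⟩ := (distributed_succ_iff_of_mem (j := ⟨i, hj⟩) he).1 hd
      obtain ⟨a, ha, b, hb, rfl, rfl, hor⟩ := exists_or_eq_of_union_eq hu
      exact Or.inr ⟨he, a, by omega, b, by omega, hor, hS₁ a (by omega) rfl, ih (by omega) hS₂⟩
    · exact Or.inl ⟨he, ih hS ((distributed_succ_iff_of_notMem (j := ⟨i, hj⟩) he).1 hd)⟩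

theorem goodR_of_good (h : Correct I N ρ) (hW : W < N) (hs : s ⊆ Set.Iio (I.t + 1)) (hS : S < N)
    (hg : I.game.Good (bitSets W) v s (bitSets S)) : ρ goodR [W, v, #s, 0, S] := by
  generalize hX : bitSets S = X at hg
  induction hg generalizing S with
  | leaf hle hl =>
    subst hX
    exact h.goodR_of_holds hW (Nat.zero_le _) hS ((h.holds_goodF_zero hW hS hs).2
      (Or.inl ⟨hle, hl⟩))
  | zero hv he _ ih =>
    exact h.goodR_of_holds hW (Nat.zero_le _) hS ((h.holds_goodF_zero hW hS hs).2
      (Or.inr (Or.inl ⟨hv, _, he, ih (union_colours_subset hs _) hS hX⟩)))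
  | one F hv hcov hF _ ih =>
    subst hX
    refine h.goodR_of_holds hW (Nat.zero_le _) hS ((h.holds_goodF_zero hW hS hs).2
      (Or.inr (Or.inr ⟨hv, h.goodR_of_distributed hW hs le_rfl hS ⟨F, fun p hp => ?_,
        fun u hu _ => ⟨hF u hu, fun a ha => ih u hu (union_colours_subset hs u) ha⟩⟩⟩)))
    obtain ⟨u, hu, hpu⟩ := hcov p hp
    exact ⟨u, hu, u.2, hpu⟩

theorem goodR_iff (h : Correct I N ρ) (hW : W < N) (hs : s ⊆ Set.Iio (I.t + 1)) (hS : S < N) :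
    ρ goodR [W, v, #s, 0, S] ↔ I.game.Good (bitSets W) v s (bitSets S) :=
  ⟨h.goodAt_of_goodR hW hs (Nat.zero_le _), h.goodR_of_good hW hs hS⟩

theorem resR_iff (h : Correct I N ρ) : ρ resR [] ↔ I.game.toSPGame.HasSolution := by
  have hnt := h.n_add_t_lt
  have hN : 0 < N := by omega
  have hempty : ∅ ⊆ Set.Iio (I.t + 1) := Set.empty_subset _
  have hinit : I.game.colours I.game.arena.init ⊆ Set.Iio (I.t + 1) := by
    simpa only [Set.empty_union] using union_colours_subset hempty I.game.arena.init
  rw [h.solved (.define resR resF) (by simp [instrs]) [] rfl (by simp)]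
  simp only [resF, Holds, List.nil_append, List.cons_append, List.getD_cons_zero,
    List.getD_cons_succ, List.map_cons, List.map_nil, exists_zeroR h.solved hN,
    exists_succR h.solved (show 0 + 1 < N by omega), zero_add, h.exists_initR]
  rw [← code_empty (I.t + 1)]
  simp only [h.exists_stepR hempty]
  rw [code_empty, Set.empty_union]
  constructor
  · rintro ⟨W, hW, hgood⟩
    exact hasSolution_of_good ((h.goodR_iff hW hinit hW).1 hgood)
  · intro hsol
    obtain ⟨W, hsub, hgood⟩ := exists_good_of_hasSolution hsol
    obtain ⟨w, hw, rfl⟩ :=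
      exists_bitSets_eq (k := I.t + 1) fun p hp i hi => Nat.lt_succ_of_le (hsub p hp hi)
    have hw := hw.trans_le h.two_pow_le
    exact ⟨w, hw, (h.goodR_iff hw hinit hw).2 hgood⟩

end Correct

theorem correct_foldl_apply (I : ReachSPInstance) :
    Correct I (I.encode.length * 2 ^ 2 ^ (I.t + 1))
      (instrs.foldl (fun ρ J => J.apply arity (I.encode.length * 2 ^ 2 ^ (I.t + 1)) ρ)
        (StackProg.inputRel I.encode)) where
  solved := RelInstr.solved_foldl_apply stratified_instrs _
  size := rfl
  input i := by
    rw [RelInstr.foldl_apply_of_lt stratified_instrs _ (by decide)]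
    simp [StackProg.inputRel, inpR]

end SPSProgram

theorem theorem1 :
    InFPT ReachSPInstance.encode ReachSPInstance.t ReachSPInstance.SPS := by
  exact inFPT_of_relProgram rfl rfl SPSProgram.wf_instrs (fun I => ⟨I.n, _, I.encode_eq⟩)
    fun I => (SPSProgram.correct_foldl_apply I).resR_iff
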